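/- Let $n\ge 2$ and let $\mu$ be the spherical Lebesgue measure on $\mathbb S^{n-1}$. Let $\mathcal K_+^2$ be the class of convex bodies in $\mathbb R^n$ that contain the origin in their interior and whose boundary is a $C^2$ hypersurface of strictly positive Gauss curvature. For $K\in\mathcal K_+^2$ let $h_K$ be the support function on $\mathbb S^{n-1}$, let $X_K(x)=h_K(x)x+\nabla h_K(x)$ be the inverse Gauss map, and for $h\in C^2(\mathbb S^{n-1})$ let $D^2h=\nabla^2h+h\,\mathrm I$. Let $Q(A^1,\dots,A^{n-1})$ denote the mixed discriminant of symmetric matrices, normalized by $Q(A,\dots,A)=\det A$, let $$V(K_1,\dots,K_n)=\frac1n\int_{\mathbb S^{n-1}}h_{K_1}\,Q(D^2h_{K_2},\dots,D^2h_{K_n})\,d\mu$$ be the mixed volume, $V(K)=V(K,\dots,K)$, and let $V(K[n-j],L[j])$ be the mixed volume of $n-j$ copies of $K$ and $j$ copies of $L$. Put $dV_K=\frac1n h_K\det(D^2h_K)\,d\mu$, $dS_2K=h_K^{-1}\det(D^2h_K)\,d\mu$ and, for a measure $\mathbf m$ on $\mathbb S^{n-1}$, $\delta_2^{\mathbf m}(K,L)=\big(\int_{\mathbb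 S^{n-1}}(h_K-h_L)^2\,d\mathbf m\big)^{1/2}$. The Hilbert-Brunn-Minkowski operator of $K$ is $$L_Kz=\frac{Q(D^2(zh_K),D^2h_K,\dots,D^2h_K)}{\det(D^2h_K)}-z,\qquad z\in C^2(\mathbb S^{n-1}).$$ The operator $-L_K$ is essentially self-adjoint in $L^2(V_K)$; the spectrum of its closure is discrete, and its distinct elements in increasing order are denoted $\lambda_0(-L_K)<\lambda_1(-L_K)<\lambda_2(-L_K)<\cdots$ (here $\lambda_0=0$ and $\lambda_1=1$). **Theorem.** Let $K,L\in\mathcal K_+^2$. There is exactly one $v\in\mathbb R^n$ with $$\int_{\mathbb S^{n-1}}\frac{\langle x,X_L(x)-v\rangle}{h_K(x)^2}\,x\,dV_K(x)=0,$$ and for this $v$, with $c=\dfrac{V(K[n-1],L[1])}{V(K)}$ and the extended homothetic transform $\widetilde K[L]=cK+v$ of $K$ relative to $L$, $$\frac{V(K[n-1],L[1])^2}{V(K)}-V(K[n-2],L[2])\ \ge\ \frac1n\big(\lambda_2(-L_K)-1\big)\Big(\delta_2^{S_2K}\big(L,\widetilde K[L]\big)\Big)^2 .$$ -/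

import Mathlib

open MeasureTheory Topology
open scoped Pointwise Gradient RealInnerProductSpace

noncomputable section

namespace ConvexStability

/-- Euclidean space `ℝⁿ`. -/
abbrev E (n : ℕ) := EuclideanSpace ℝ (Fin n)

/-- The unit sphere `S^{n-1}` of `ℝⁿ`. -/
abbrev Sph (n : ℕ) := Metric.sphere (0 : E n) 1

/-- The spherical Lebesgue measure on `S^{n-1}`. -/
def sphMeasure (n : ℕ) : Measure (Sph n) := (volume : Measure (E n)).toSphere

/-! ### Calculus on the sphere through `1`-homogeneous extension -/

/-- The `1`-homogeneous extension `y ↦ |y| z(y / |y|)` to `ℝⁿ` of a function `z` on the sphere. -/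
def homExt {n : ℕ} (z : Sph n → ℝ) (y : E n) : ℝ :=
  if hy : y = 0 then 0
  else ‖y‖ * z ⟨‖y‖⁻¹ • y, by
    rw [mem_sphere_zero_iff_norm, norm_smul, norm_inv, norm_norm,
      inv_mul_cancel₀ (norm_ne_zero_iff.mpr hy)]⟩

/-- `z ∈ C²(S^{n-1})`: equivalently, its `1`-homogeneous extension is `C²` off the origin. -/
def IsC2 {n : ℕ} (z : Sph n → ℝ) : Prop :=
  ContDiffOn ℝ 2 (homExt z) {0}ᶜ

/-- The Euclidean Hessian of `f` at `x`, as a linear operator. -/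
def hess {n : ℕ} (f : E n → ℝ) (x : E n) : E n →L[ℝ] E n :=
  fderiv ℝ (∇ f) x

/-- The restriction to the hyperplane `ν^⊥` of the quadratic form of an operator `A`, as an
operator on `ν^⊥`: apply `A`, then project orthogonally. -/
def restrictPerp {n : ℕ} (ν : E n) (A : E n →L[ℝ] E n) :
    (ℝ ∙ ν)ᗮ →ₗ[ℝ] (ℝ ∙ ν)ᗮ :=
  (((ℝ ∙ ν)ᗮ.orthogonalProjectionOnto ∘L A ∘L (ℝ ∙ ν)ᗮ.subtypeL :
    (ℝ ∙ ν)ᗮ →L[ℝ] (ℝ ∙ ν)ᗮ) : (ℝ ∙ ν)ᗮ →ₗ[ℝ] (ℝ ∙ ν)ᗮ)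

/-- The restricted Hessian `D²z = ∇²z + z I` on the tangent space `x^⊥` of the sphere at `x`. -/
def D2 {n : ℕ} (z : Sph n → ℝ) (x : Sph n) :
    (ℝ ∙ (x : E n))ᗮ →ₗ[ℝ] (ℝ ∙ (x : E n))ᗮ :=
  restrictPerp (x : E n) (hess (homExt z) x)

/-! ### Convex bodies of class `C²` with positive Gauss curvature -/

/-- The Gauss curvature at `p` of the hypersurface `{φ = φ p}`, with respect to the unit normal
`ν = ∇φ / |∇φ|`: the determinant of the Weingarten map `dν` on the tangent space `(∇φ)^⊥`. -/
def gaussCurvature {n : ℕ} (φ : E n → ℝ) (p : E n) : ℝ :=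
  LinearMap.det (‖∇ φ p‖⁻¹ • restrictPerp (∇ φ p) (hess φ p))

/-- The class `𝒦₊²`: convex bodies with the origin in the interior, whose boundary is a `C²`
hypersurface with strictly positive Gauss curvature. Near each boundary point `p` the body is the
sublevel set `{φ ≤ 0}` of a `C²` function `φ` with `∇φ(p) ≠ 0` (so that `∇φ / |∇φ|` is the outer
unit normal of the boundary). -/
structure MemKPlusTwo {n : ℕ} (K : ConvexBody (E n)) : Prop where
  zero_mem_interior : (0 : E n) ∈ interior (K : Set (E n))
  boundary : ∀ p ∈ frontier (K : Set (E n)), ∃ φ : E n → ℝ,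
    ContDiffAt ℝ 2 φ p ∧ ∇ φ p ≠ 0 ∧ (∀ᶠ y in 𝓝 p, y ∈ K ↔ φ y ≤ 0) ∧ 0 < gaussCurvature φ p

/-- The support function `h_K` on the sphere. -/
def supportFn {n : ℕ} (K : ConvexBody (E n)) (x : Sph n) : ℝ :=
  sSup ((fun y : E n => ⟪(x : E n), y⟫) '' (K : Set (E n)))

/-- The inverse Gauss map `X_K(x) = h_K(x) x + ∇h_K(x)`, which is the Euclidean gradient at `x`
of the `1`-homogeneous extension of `h_K`. -/
def inverseGaussMap {n : ℕ} (K : ConvexBody (E n)) (x : Sph n) : E n :=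
  ∇ (homExt (supportFn K)) x

/-! ### Measures and `L²`-distances -/

/-- The `L_p`-surface-area measure `dS_p K = h_K^{1-p} det(D²h_K) dμ`. -/
def surfaceAreaMeasure {n : ℕ} (p : ℝ) (K : ConvexBody (E n)) : Measure (Sph n) :=
  (sphMeasure n).withDensity fun x =>
    ENNReal.ofReal (supportFn K x ^ (1 - p) * LinearMap.det (D2 (supportFn K) x))

/-- The cone-volume measure `dV_K = (1/n) h_K det(D²h_K) dμ`. -/
def coneMeasure {n : ℕ} (K : ConvexBody (E n)) : Measure (Sph n) :=
  (sphMeasure n).withDensity fun x =>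
    ENNReal.ofReal ((1 / (n : ℝ)) * supportFn K x * LinearMap.det (D2 (supportFn K) x))

/-- The `L²`-distance of two convex bodies with respect to a measure on the sphere. -/
def delta2 {n : ℕ} (m : Measure (Sph n)) (K L : ConvexBody (E n)) : ℝ :=
  √(∫ x, (supportFn K x - supportFn L x) ^ 2 ∂m)

/-! ### Mixed discriminants and mixed volumes -/

/-- The mixed discriminant
`Q(A¹,…,Aᵐ) = (1/m!) ∑ δ_{i₁⋯iₘ}^{j₁⋯jₘ} A¹_{i₁j₁} ⋯ Aᵐ_{iₘjₘ}`,
with the generalized Kronecker delta `det (δ_{i_s}^{j_t})`. -/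
def mixedDisc {m : ℕ} {ι : Type*} [Fintype ι] [DecidableEq ι]
    (A : Fin m → Matrix ι ι ℝ) : ℝ :=
  (1 / (m.factorial : ℝ)) * ∑ i : Fin m → ι, ∑ j : Fin m → ι,
    (Matrix.of fun s t : Fin m => if i s = j t then (1 : ℝ) else 0).det * ∏ s, A s (i s) (j s)

/-- The mixed discriminant of operators on the tangent space `x^⊥`, computed in an orthonormal
basis. -/
def mixedDiscTangent {n m : ℕ} (x : Sph n)
    (A : Fin m → ((ℝ ∙ (x : E n))ᗮ →ₗ[ℝ] (ℝ ∙ (x : E n))ᗮ)) : ℝ :=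
  mixedDisc fun s =>
    LinearMap.toMatrix (stdOrthonormalBasis ℝ (ℝ ∙ (x : E n))ᗮ).toBasis
      (stdOrthonormalBasis ℝ (ℝ ∙ (x : E n))ᗮ).toBasis (A s)

/-- The mixed volume functional
`V(h₁,…,hₙ) = (1/n) ∫ h₁ Q(D²h₂,…,D²hₙ) dμ` on functions on `S^{n-1}`. -/
def mixedVolume : {n : ℕ} → (Fin n → Sph n → ℝ) → ℝ
  | 0, _ => 0
  | m + 1, h => (1 / ((m + 1 : ℕ) : ℝ)) *
      ∫ x, h 0 x * mixedDiscTangent x (fun i : Fin m => D2 (h i.succ) x) ∂(sphMeasure (m + 1))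

/-- `V(K[n-j], L[j])`. -/
def mixedVol {n : ℕ} (K L : ConvexBody (E n)) (j : ℕ) : ℝ :=
  mixedVolume fun i : Fin n => if (i : ℕ) < n - j then supportFn K else supportFn L

/-- `V(K) = V(K,…,K)`. -/
def vol {n : ℕ} (K : ConvexBody (E n)) : ℝ :=
  mixedVolume fun _ : Fin n => supportFn K

/-! ### The extended homothetic transform -/

/-- The equation `∫ (⟨x, X_L(x) - v⟩ / h_K(x)²) x dV_K(x) = 0` for the translation vector `v`. -/
def IsTransformVector {n : ℕ} (K L : ConvexBody (E n)) (v : E n) : Prop :=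
  ∫ x : Sph n, (⟪(x : E n), inverseGaussMap L x - v⟫ / supportFn K x ^ 2) • (x : E n)
    ∂(coneMeasure K) = 0

/-- The one-point body `{v}`. -/
def pointBody {n : ℕ} (v : E n) : ConvexBody (E n) :=
  ⟨{v}, convex_singleton v, isCompact_singleton, Set.singleton_nonempty v⟩

/-- The body `c K + v` with `c = V(K[n-1], L[1]) / V(K)`. -/
def homotheticTransform {n : ℕ} (K L : ConvexBody (E n)) (v : E n) : ConvexBody (E n) :=
  (mixedVol K L 1 / vol K) • K + pointBody v

/-! ### The Hilbert-Brunn-Minkowski operator and its eigenvalues -/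

/-- `-L_K z = z - Q(D²(z h_K), D²h_K, …, D²h_K) / det(D²h_K)`, for `z ∈ C²(S^{n-1})`. -/
def negHBM {n : ℕ} (K : ConvexBody (E n)) (z : Sph n → ℝ) (x : Sph n) : ℝ :=
  z x - mixedDiscTangent x (fun i : Fin (n - 1) =>
      if (i : ℕ) = 0 then D2 (fun y => z y * supportFn K y) x else D2 (supportFn K) x) /
    LinearMap.det (D2 (supportFn K) x)

/-- The real Hilbert space `L²(V_K)`. -/
abbrev L2 {n : ℕ} (K : ConvexBody (E n)) := Lp ℝ 2 (coneMeasure K)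

/-- The graph in `L²(V_K) × L²(V_K)` of `-L_K` with domain `C²(S^{n-1})`; for `K ∈ 𝒦₊²` the
spanning set is already a linear subspace. -/
def negHBMGraph {n : ℕ} (K : ConvexBody (E n)) : Submodule ℝ (L2 K × L2 K) :=
  Submodule.span ℝ {p | ∃ z : Sph n → ℝ, IsC2 z ∧
    p.1 =ᵐ[coneMeasure K] z ∧ p.2 =ᵐ[coneMeasure K] negHBM K z}

/-- The self-adjoint realization of `-L_K` in `L²(V_K)`: the closure of `-L_K` on `C²(S^{n-1})`
(this operator is essentially self-adjoint, so its closure is its unique self-adjoint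
extension). -/
def negHBMOp {n : ℕ} (K : ConvexBody (E n)) : L2 K →ₗ.[ℝ] L2 K :=
  (negHBMGraph K).toLinearPMap.closure

/-- The (real) spectrum of a closed operator `A` on a real Hilbert space: those `t` for which
`A - t : dom A → H` is not bijective. -/
def pSpectrum {H : Type*} [NormedAddCommGroup H] [InnerProductSpace ℝ H]
    (A : H →ₗ.[ℝ] H) : Set ℝ :=
  {t | ¬ Function.Bijective fun u : A.domain => A u - t • (u : H)}

/-- The elements of a discrete set bounded below, listed increasingly, each of them once. -/
def increasingList (S : Set ℝ) : ℕ → ℝ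
  | 0 => sInf S
  | i + 1 => sInf {t ∈ S | increasingList S i < t}

/-- The eigenvalue `λ_i(-L_K)`: distinct eigenvalues in increasing order,
`λ₀ < λ₁ < λ₂ < ⋯`. -/
def eigenvalueHBM {n : ℕ} (K : ConvexBody (E n)) (i : ℕ) : ℝ :=
  increasingList (pSpectrum (negHBMOp K)) i

end ConvexStability

end

open MeasureTheory Topology
open scoped Pointwise Gradient RealInnerProductSpace

noncomputable section

namespace ConvexStability

/-! ### Mixed discriminants -/

section MixedDisc

variable {m : ℕ} {ι : Type*} [Fintype ι] [DecidableEq ι]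

/-! Put `z = (h_L - h_{cK+v}) / h_K`. Since `h_L / h_K = z + c + ⟨x,v⟩ / h_K`, where constants are
eigenfunctions of `-L_K` for the value 0 and the functions `⟨x,w⟩ / h_K` are eigenfunctions for the
value 1, the deficit in Minkowski's inequality equals `⟨-L_K z, z⟩ - ‖z‖²` in `L²(V_K)`
(`IsPosC2.integral_deficit`). The choice of `c` makes `z` orthogonal to the constants, and the
equation for `v` says that `z` is orthogonal to every `⟨x,w⟩ / h_K`. Hence `⟨-L_K z, z⟩ ≥ λ₂ ‖z‖²`,
and `‖z‖²` is `1/n` times the squared distance. The vector `v` is unique because its linear system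
has a positive definite matrix.

Integration by parts on the sphere comes from a null Lagrangian: `∫ det DΨ = 0` for compactly
supported `Ψ`. Varying the field `|y| ∇H(y)`, where `H` is the `1`-homogeneous support function, and
passing to polar coordinates, the first variation yields Green's formula (`IsPosC2.integral_green`),
hence symmetry and nonnegativity of `-L_K`; the second variation yields the Bochner identity
(`IsPosC2.integral_relTrace_sq_sub`).

The spectral inequality needs `-L_K ≥ 1` off the constants and the two lowest eigenspaces. For `n ≥
3` the Bochner formula gives `⟨Au,u⟩ ≤ ‖Au‖²` for `A = -L_K`, which excludes spectrum in `(0,1)`.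
For `n = 2` the formula is void, and the planar Minkowski inequality is proved directly with
degenerating ellipses. An element of an eigenspace of the closed operator is a limit of `C²`
functions whose gradients (value 0) or Hessians (value 1) tend to zero in `L²`; a Poincaré
inequality on the sphere identifies the limit as a constant or as some `⟨x,v⟩ / h_K`.

Neither essential self-adjointness nor discreteness of the spectrum is needed. If no real number is
regular for the closed operator, the listed `λ₂` is 0 and nonnegativity suffices; otherwise a gap
argument for symmetric operators with a regular point applies (`increasingList_two_mul_le`). The
support function is `C²` with positive definite restricted Hessian by the inverse function theorem
(`MemKPlusTwo.isPosC2`). -/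

theorem mixedDisc_const (hm : Fintype.card ι = m) (A : Matrix ι ι ℝ) :
    mixedDisc (fun _ : Fin m => A) = A.det := by
  have key : ∀ i : Fin m → ι, ∑ j : Fin m → ι,
      (Matrix.of fun s t : Fin m => if i s = j t then (1 : ℝ) else 0).det * ∏ s, A (i s) (j s) =
      if Function.Injective i then A.det else 0 := by
    intro i
    -- Expanding the Kronecker determinant over permutations `σ` leaves only `j = i ∘ σ`, so the
    -- inner sum is a determinant with rows and columns selected by `i`. It vanishes when `i`
    -- repeats an index, and the `m!` injective `i` cancel the prefactor.
    have h1 : ∑ j : Fin m → ι,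
        (Matrix.of fun s t : Fin m => if i s = j t then (1 : ℝ) else 0).det * ∏ s, A (i s) (j s) =
        (A.submatrix i i).det := by
      rw [← Matrix.det_transpose, Matrix.det_apply']
      simp_rw [Matrix.det_apply', Finset.sum_mul]
      rw [Finset.sum_comm]
      refine Finset.sum_congr rfl fun σ _ => ?_
      rw [Finset.sum_eq_single (fun t => i (σ t))]
      · simp [Matrix.transpose_apply]
      · intro j _ hj
        obtain ⟨t, ht⟩ : ∃ t, j t ≠ i (σ t) := by
          by_contra! h
          exact hj (funext h)
        rw [Finset.prod_eq_zero (Finset.mem_univ t)]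
        · simp
        · simp [Ne.symm ht]
      · simp
    rw [h1]
    split_ifs with hi
    · have hb : Function.Bijective i := (Fintype.bijective_iff_injective_and_card i).2
        ⟨hi, by simp [hm]⟩
      exact Matrix.det_submatrix_equiv_self (Equiv.ofBijective i hb) A
    · simp only [Function.Injective, not_forall] at hi
      obtain ⟨a, b, hab, hne⟩ := hi
      exact Matrix.det_zero_of_row_eq hne (by ext t; simp [Matrix.submatrix_apply, hab])
  unfold mixedDisc
  rw [Finset.sum_congr rfl fun i _ => key i, ← Finset.sum_filter, Finset.sum_const, nsmul_eq_mul,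
    ← mul_assoc]
  have hc : (Finset.univ.filter fun i : Fin m → ι => Function.Injective i).card = m.factorial := by
    classical
    rw [← Fintype.card_subtype, Fintype.card_congr (Equiv.subtypeInjectiveEquivEmbedding (Fin m) ι),
      Fintype.card_embedding_eq, Fintype.card_fin, hm, Nat.descFactorial_self]
  rw [hc, one_div, inv_mul_cancel₀ (by exact_mod_cast m.factorial_ne_zero), one_mul]

/-- Reindexing `i` and `j` by the same permutation permutes rows and columns of the Kronecker matrix
alike, which leaves its determinant unchanged. -/
theorem mixedDisc_comp_perm (A : Fin m → Matrix ι ι ℝ) (π : Equiv.Perm (Fin m)) :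
    mixedDisc (fun s => A (π s)) = mixedDisc A := by
  unfold mixedDisc
  congr 1
  refine Fintype.sum_equiv (π.arrowCongr (Equiv.refl ι)) _ _ fun i => ?_
  refine Fintype.sum_equiv (π.arrowCongr (Equiv.refl ι)) _ _ fun j => ?_
  have h1 : ∏ s, A (π s) (i s) (j s) =
      ∏ s, A s ((π.arrowCongr (Equiv.refl ι)) i s) ((π.arrowCongr (Equiv.refl ι)) j s) := by
    rw [← Equiv.prod_comp π (fun s => A s ((π.arrowCongr (Equiv.refl ι)) i s)
      ((π.arrowCongr (Equiv.refl ι)) j s))]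
    simp [Equiv.arrowCongr]
  rw [h1]
  congr 1
  rw [← Matrix.det_submatrix_equiv_self π (Matrix.of fun s t : Fin m =>
    if (π.arrowCongr (Equiv.refl ι)) i s = (π.arrowCongr (Equiv.refl ι)) j t then (1 : ℝ) else 0)]
  congr 1
  ext s t
  simp [Equiv.arrowCongr]

variable (m ι) in
/-- The mixed discriminant as a multilinear map. -/
def mixedDiscMultilinear : MultilinearMap ℝ (fun _ : Fin m => Matrix ι ι ℝ) ℝ :=
  (1 / (m.factorial : ℝ)) • ∑ i : Fin m → ι, ∑ j : Fin m → ι,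
    (Matrix.of fun s t : Fin m => if i s = j t then (1 : ℝ) else 0).det •
      (MultilinearMap.mkPiAlgebra ℝ (Fin m) ℝ).compLinearMap
        fun s => Matrix.entryLinearMap ℝ ℝ (i s) (j s)

theorem mixedDiscMultilinear_apply (A : Fin m → Matrix ι ι ℝ) :
    mixedDiscMultilinear m ι A = mixedDisc A := by
  simp [mixedDiscMultilinear, mixedDisc]

/-- The mixed discriminant of copies of two matrices only depends on the number of copies. -/
theorem mixedDisc_ite_eq {s s' : Finset (Fin m)} (hs : s.card = s'.card) (F H : Matrix ι ι ℝ) :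
    mixedDisc (fun i => if i ∈ s then F else H) = mixedDisc (fun i => if i ∈ s' then F else H) := by
  let e : {x // x ∈ s} ≃ {x // x ∈ s'} := Finset.equivOfCardEq hs
  rw [← mixedDisc_comp_perm (fun i => if i ∈ s' then F else H) (Equiv.extendSubtype e)]
  congr 1
  ext1 i
  by_cases hi : i ∈ s
  · rw [if_pos hi, if_pos (Equiv.extendSubtype_mem e i hi)]
  · rw [if_neg hi, if_neg (Equiv.extendSubtype_not_mem e i hi)]

open Polynomial in
/-- The coefficients of the polynomial `det (H + t F)` in terms of mixed discriminants. -/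
theorem coeff_eq_choose_mul_mixedDisc (hm : Fintype.card ι = m) (F H : Matrix ι ι ℝ)
    (P : ℝ[X]) (hP : ∀ t, P.eval t = (H + t • F).det) (s : Finset (Fin m)) :
    P.coeff s.card = (m.choose s.card : ℝ) * mixedDisc (fun i => if i ∈ s then F else H) := by
  have h1 : P = ∑ s : Finset (Fin m),
      C (mixedDisc (fun i => if i ∈ s then F else H)) * X ^ s.card := by
    refine Polynomial.funext fun t => ?_
    rw [hP, ← mixedDisc_const hm, ← mixedDiscMultilinear_apply]
    -- The determinant is the mixed discriminant with all slots equal; multilinearity expands it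
    -- over the set `s` of slots that receive `t • F`, with weight `t ^ s.card`.
    have := (mixedDiscMultilinear m ι).map_add_univ (fun _ => t • F) (fun _ => H)
    have h2 : (fun _ : Fin m => H + t • F) = (fun _ => t • F) + fun _ => H := by
      ext1 i; simp [add_comm]
    rw [h2, this, Polynomial.eval_finsetSum]
    refine Finset.sum_congr rfl fun s _ => ?_
    have h3 : s.piecewise (fun _ => t • F) (fun _ => H) =
        s.piecewise (fun i => (fun _ => t) i • (s.piecewise (fun _ => F) (fun _ => H)) i)
          (s.piecewise (fun _ => F) (fun _ => H)) := by
      ext1 i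
      by_cases hi : i ∈ s <;> simp [hi]
    rw [h3, MultilinearMap.map_piecewise_smul, mixedDiscMultilinear_apply]
    simp only [Finset.prod_const, smul_eq_mul, eval_mul, eval_C, eval_pow, eval_X]
    rw [mul_comm]
    congr 2
  rw [h1, finsetSum_coeff]
  simp_rw [coeff_C_mul_X_pow]
  rw [← Finset.sum_filter]
  rw [Finset.sum_congr rfl fun s' hs' =>
    mixedDisc_ite_eq (s := s') (s' := s) (Finset.mem_filter.1 hs').2.symm F H]
  rw [Finset.sum_const, nsmul_eq_mul]
  congr 2
  have : (Finset.univ.filter fun s' : Finset (Fin m) => s.card = s'.card) =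
      Finset.univ.powersetCard s.card := by
    ext s'; simp [Finset.mem_powersetCard, eq_comm]
  rw [this, Finset.card_powersetCard, Finset.card_fin]

end MixedDisc

/-! ### The polynomial `det (1 + t T)` -/

section DetPoly

open Polynomial

variable {V : Type*} [AddCommGroup V] [Module ℝ V] [FiniteDimensional ℝ V]

/-- The polynomial `det (1 + X T)`. -/
def detPoly (T : Module.End ℝ V) : ℝ[X] :=
  (1 + (X : ℝ[X]) • (LinearMap.toMatrix (Module.finBasis ℝ V) (Module.finBasis ℝ V) T).map C).det

theorem eval_detPoly (T : Module.End ℝ V) (t : ℝ) :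
    (detPoly T).eval t = LinearMap.det (1 + t • T) := by
  rw [← LinearMap.det_toMatrix (Module.finBasis ℝ V), detPoly, ← coe_evalRingHom,
    RingHom.map_det]
  congr 1
  ext i j
  simp [LinearMap.toMatrix_one, Matrix.one_apply, apply_ite (Polynomial.eval t)]
  exact mul_comm _ _

theorem natDegree_detPoly_le (T : Module.End ℝ V) :
    (detPoly T).natDegree ≤ Module.finrank ℝ V := by
  have := natDegree_det_X_add_C_le
    (LinearMap.toMatrix (Module.finBasis ℝ V) (Module.finBasis ℝ V) T) 1
  rw [Fintype.card_fin] at this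
  refine le_trans (le_of_eq ?_) this
  unfold detPoly
  rw [add_comm]
  congr 3
  exact (Matrix.map_one _ C.map_zero C.map_one).symm

theorem detPoly_eq (T : Module.End ℝ V) :
    ∃ Q : ℝ[X], detPoly T = 1 + C (LinearMap.trace ℝ V T) * X + Q * X ^ 2 := by
  have := Matrix.det_one_add_X_smul
    (LinearMap.toMatrix (Module.finBasis ℝ V) (Module.finBasis ℝ V) T)
  refine ⟨_, by
    rw [detPoly, this, ← LinearMap.trace_eq_matrix_trace, Polynomial.smul_eq_C_mul]⟩

theorem coeff_zero_detPoly (T : Module.End ℝ V) : (detPoly T).coeff 0 = 1 := by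
  obtain ⟨Q, hQ⟩ := detPoly_eq T
  rw [hQ]; simp [coeff_zero_eq_eval_zero]

theorem coeff_one_detPoly (T : Module.End ℝ V) :
    (detPoly T).coeff 1 = LinearMap.trace ℝ V T := by
  obtain ⟨Q, hQ⟩ := detPoly_eq T
  rw [hQ]; simp [coeff_one, coeff_mul_X_pow']

/-- Compare the coefficients of `t²` in `det (1 + tT) det (1 - tT) = det (1 - t² T²)`: the left side
gives twice the wanted coefficient minus `(tr T)²`, the right side `-tr T²`. -/
theorem coeff_two_detPoly (T : Module.End ℝ V) :
    (detPoly T).coeff 2 = (LinearMap.trace ℝ V T ^ 2 - LinearMap.trace ℝ V (T * T)) / 2 := by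
  have h : detPoly T * (detPoly T).comp (-X) = (detPoly (-(T * T))).comp (X ^ 2) := by
    refine Polynomial.funext fun t => ?_
    simp only [eval_mul, eval_comp, eval_neg, eval_X, eval_pow, eval_detPoly]
    rw [← map_mul]
    congr 1
    rw [neg_smul, mul_add, add_mul, one_mul, mul_one, mul_neg, add_mul, one_mul, smul_mul_smul_comm, smul_neg, sq]
    abel
  obtain ⟨Q, hQ⟩ := detPoly_eq T
  obtain ⟨R, hR⟩ := detPoly_eq (-(T * T))
  have h2 := congrArg (fun p => p.coeff 2) h
  rw [hQ, hR] at h2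
  simp only [add_comp, one_comp, mul_comp, C_comp, X_comp, pow_comp] at h2
  set a := LinearMap.trace ℝ V T
  set Q' := Q.comp (-X)
  have e1 : (1 + C a * X + Q * X ^ 2) * (1 + C a * -X + Q' * (-X) ^ 2) =
      1 + C 0 * X + (C (- a ^ 2) + Q + Q') * X ^ 2 + (C a * Q' - C a * Q + Q * Q' * X) * X ^ 3 := by
    simp only [map_neg, map_pow, map_zero]; ring
  have e2 : Q'.coeff 0 = Q.coeff 0 := by
    simp [Q', coeff_zero_eq_eval_zero]
  rw [e1] at h2
  have e3 : (1 + C (LinearMap.trace ℝ V (-(T * T))) * X ^ 2 + R.comp (X ^ 2) * (X ^ 2) ^ 2) =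
    1 + C (LinearMap.trace ℝ V (-(T * T))) * X ^ 2 + R.comp (X ^ 2) * X ^ 4 := by ring
  rw [e3] at h2
  simp only [coeff_add, coeff_mul_X_pow', coeff_C_mul_X, coeff_one] at h2
  norm_num [e2, coeff_C] at h2
  have e4 : (detPoly T).coeff 2 = Q.coeff 0 := by
    rw [hQ]
    simp only [coeff_add, coeff_mul_X_pow', coeff_C_mul_X, coeff_one]
    norm_num
  have e5 : (C a ^ 2).coeff 0 = a ^ 2 := by simp [coeff_zero_eq_eval_zero]
  rw [e4]
  rw [e5] at h2
  linarith

end DetPoly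

end ConvexStability

end

open MeasureTheory Topology
open scoped Pointwise Gradient RealInnerProductSpace

noncomputable section

namespace ConvexStability

/-! ### Null Lagrangians -/

open Polynomial in
/-- If a family of polynomials of bounded degree has vanishing integral for all small values of the
variable, then all its coefficients have vanishing integral. -/
theorem integral_coeff_eq_zero {Ω : Type*} [MeasurableSpace Ω] {μ : Measure Ω} (P : Ω → ℝ[X])
    (N : ℕ) (hdeg : ∀ y, (P y).natDegree ≤ N) (hint : ∀ t, Integrable (fun y => (P y).eval t) μ)
    (h : ∃ ε > 0, ∀ t : ℝ, |t| < ε → ∫ y, (P y).eval t ∂μ = 0) (k : ℕ) :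
    ∫ y, (P y).coeff k ∂μ = 0 := by
  have hco : ∀ k, Integrable (fun y => (P y).coeff k) μ := by
    intro k
    -- Interpolation at the nodes `0, …, N` writes each coefficient as a fixed combination of
    -- values, so the coefficients inherit integrability.
    let v : ℕ → ℝ := fun i => i
    have hv : Set.InjOn v (Finset.range (N + 1)) := fun a _ b _ hab => Nat.cast_injective (R := ℝ) hab
    have : ∀ y, (P y).coeff k = ∑ i ∈ Finset.range (N + 1),
        (P y).eval (v i) * (Lagrange.basis (Finset.range (N + 1)) v i).coeff k := by
      intro y
      conv_lhs => rw [Lagrange.eq_interpolate (f := P y) hv (by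
        rw [Finset.card_range]
        exact lt_of_le_of_lt degree_le_natDegree (by exact_mod_cast Nat.lt_succ_of_le (hdeg y)))]
      rw [Lagrange.interpolate_apply, finsetSum_coeff]
      simp_rw [coeff_C_mul]
    simp_rw [this]
    exact integrable_finsetSum _ fun i _ => (hint _).mul_const _
  rcases lt_or_ge N k with hk | hk
  · rw [integral_congr_ae (g := fun _ => 0)
      (ae_of_all _ fun y => coeff_eq_zero_of_natDegree_lt ((hdeg y).trans_lt hk))]
    simp
  set Q : ℝ[X] := ∑ k ∈ Finset.range (N + 1), C (∫ y, (P y).coeff k ∂μ) * X ^ k with hQ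
  have hev : ∀ t, Q.eval t = ∫ y, (P y).eval t ∂μ := by
    intro t
    have : ∀ y, (P y).eval t = ∑ k ∈ Finset.range (N + 1), (P y).coeff k * t ^ k := fun y =>
      eval_eq_sum_range' (Nat.lt_succ_of_le (hdeg y)) t
    simp_rw [this]
    rw [integral_finsetSum _ fun i _ => (hco i).mul_const _, hQ, eval_finsetSum]
    refine Finset.sum_congr rfl fun i _ => ?_
    rw [integral_mul_const]
    simp
  obtain ⟨ε, hε, h0⟩ := h
  have hQ0 : Q = 0 := by
    -- The polynomial with integrated coefficients vanishes on a whole interval, hence identically.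
    refine eq_zero_of_infinite_isRoot Q (Set.Infinite.mono (s := Set.Ioo 0 ε) ?_
      (Set.Ioo_infinite hε))
    intro t ht
    rw [Set.mem_ofPred_eq, IsRoot, hev]
    exact h0 t (by rw [abs_of_pos ht.1]; exact ht.2)
  have := congrArg (fun p => p.coeff k) hQ0
  simp only [hQ, finsetSum_coeff, coeff_C_mul_X_pow, coeff_zero] at this
  rw [Finset.sum_ite_eq] at this
  rwa [if_pos (Finset.mem_range.2 (Nat.lt_succ_of_le hk))] at this

section NullLagrangian

variable {V : Type*} [NormedAddCommGroup V] [InnerProductSpace ℝ V] [FiniteDimensional ℝ V]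

/-- Along `s ↦ 1 + sT`, `0 ≤ s ≤ 1`, no operator has a kernel because `‖sT‖ < 1`; the determinant
starts at 1 and cannot change sign. -/
theorem det_one_add_pos {T : V →L[ℝ] V} (hT : ‖T‖ < 1) :
    0 < LinearMap.det (1 + (T : V →ₗ[ℝ] V)) := by
  have hne : ∀ s ∈ Set.Icc (0 : ℝ) 1, LinearMap.det (1 + s • (T : V →ₗ[ℝ] V)) ≠ 0 := by
    intro s hs h0
    obtain ⟨u, hu, hu0⟩ := Submodule.exists_mem_ne_zero_of_ne_bot
      (LinearMap.bot_lt_ker_of_det_eq_zero h0).ne'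
    have h1 : u + s • T u = 0 := by simpa using hu
    have h2 : ‖u‖ = |s| * ‖T u‖ := by
      rw [← Real.norm_eq_abs, ← norm_smul, ← norm_neg (s • T u)]
      exact congrArg norm (eq_neg_of_add_eq_zero_left h1)
    have h3 : 0 < ‖u‖ := norm_pos_iff.2 hu0
    have h4 : |s| ≤ 1 := by rw [abs_of_nonneg hs.1]; exact hs.2
    have h5 := T.le_opNorm u
    nlinarith [norm_nonneg (T u)]
  have hcont : Continuous fun s : ℝ => LinearMap.det (1 + s • (T : V →ₗ[ℝ] V)) := by
    simp_rw [← eval_detPoly]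
    exact Polynomial.continuous _
  by_contra hneg
  have h01 : (0 : ℝ) ∈ Set.Icc (LinearMap.det (1 + (1 : ℝ) • (T : V →ₗ[ℝ] V)))
      (LinearMap.det (1 + (0 : ℝ) • (T : V →ₗ[ℝ] V))) := by
    simp only [one_smul, zero_smul, add_zero, Set.mem_Icc, map_one]
    exact ⟨not_lt.1 hneg, zero_le_one⟩
  obtain ⟨s, hs, hs0⟩ := intermediate_value_Icc' zero_le_one hcont.continuousOn h01
  exact hne s hs hs0

open Polynomial in
theorem coeff_finrank_detPoly (T : Module.End ℝ V) :
    (detPoly T).coeff (Module.finrank ℝ V) = LinearMap.det T := by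
  have := coeff_det_X_add_C_card
    (LinearMap.toMatrix (Module.finBasis ℝ V) (Module.finBasis ℝ V) T) 1
  rw [Fintype.card_fin, LinearMap.det_toMatrix] at this
  rw [← this]
  unfold detPoly
  rw [add_comm]
  congr 3
  exact (Matrix.map_one _ C.map_zero C.map_one).symm

theorem continuous_det_fderiv {Ψ : V → V} (h : ContDiff ℝ 1 Ψ) :
    Continuous fun y => LinearMap.det (fderiv ℝ Ψ y : V →ₗ[ℝ] V) :=
  ContinuousLinearMap.continuous_det.comp (h.continuous_fderiv one_ne_zero)

variable [MeasurableSpace V] [BorelSpace V]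

variable (V) in
-- For small `t` the map `y + t Ψ(y)` is a bijection of a large ball onto itself with positive
-- Jacobian, so `∫ (det (1 + t DΨ) - 1) = 0`. This is polynomial in `t`, and its top coefficient is
-- `∫ det DΨ`.
theorem integral_det_fderiv_eq_zero [Nontrivial V] {Ψ : V → V} (h : ContDiff ℝ 1 Ψ)
    (hc : HasCompactSupport Ψ) :
    ∫ y, LinearMap.det (fderiv ℝ Ψ y : V →ₗ[ℝ] V) = 0 := by
  obtain ⟨C, hC⟩ := h.lipschitzWith_of_hasCompactSupport hc one_ne_zero
  obtain ⟨R, hR⟩ := hc.isCompact.isBounded.subset_ball (0 : V)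
  have hdC : ∀ y, ‖fderiv ℝ Ψ y‖ ≤ C := fun y => norm_fderiv_le_of_lipschitz ℝ hC
  have hdsupp : ∀ y, y ∉ Metric.ball (0 : V) R → fderiv ℝ Ψ y = 0 := fun y hy =>
    image_eq_zero_of_notMem_tsupport fun hy' => hy (hR (tsupport_fderiv_subset ℝ hy'))
  have hint : ∀ t : ℝ, Integrable fun y =>
      (detPoly (fderiv ℝ Ψ y : V →ₗ[ℝ] V) - 1).eval t := by
    intro t
    simp only [Polynomial.eval_sub, eval_detPoly, Polynomial.eval_one]
    refine Continuous.integrable_of_hasCompactSupport ?_ ?_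
    · refine Continuous.sub ?_ continuous_const
      have : Continuous fun y => ((1 : V →L[ℝ] V) + t • fderiv ℝ Ψ y).det :=
        ContinuousLinearMap.continuous_det.comp
          (continuous_const.add ((h.continuous_fderiv one_ne_zero).const_smul t))
      exact this
    · refine HasCompactSupport.intro (isCompact_closedBall (0 : V) R) fun y hy => ?_
      rw [hdsupp y fun h' => hy (Metric.ball_subset_closedBall h')]
      simp
  have key := integral_coeff_eq_zero (μ := (volume : Measure V))
    (fun y => detPoly (fderiv ℝ Ψ y : V →ₗ[ℝ] V) - 1) (Module.finrank ℝ V)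
    (fun y => (Polynomial.natDegree_sub_le _ _).trans (by simp [natDegree_detPoly_le])) hint ?_
    (Module.finrank ℝ V)
  · rw [← key]
    refine integral_congr_ae (ae_of_all _ fun y => ?_)
    have hn : Module.finrank ℝ V ≠ 0 := Module.finrank_pos.ne'
    simp [Polynomial.coeff_sub, coeff_finrank_detPoly, Polynomial.coeff_one, hn]
  -- With `C` a Lipschitz constant of `Ψ`, this radius forces `|t| C < 1`, which gives both
  -- bijectivity of the perturbed identity and positivity of its Jacobian.
  refine ⟨((C : ℝ) + 1)⁻¹, inv_pos.2 (by positivity), fun t ht => ?_⟩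
  have htC : |t| * C < 1 := by
    have h1 : |t| * (C + 1) < 1 := by
      have hC1 : (0 : ℝ) < C + 1 := by positivity
      rwa [inv_eq_one_div, lt_div_iff₀ hC1] at ht
    have := abs_nonneg t
    nlinarith
  set f : V → V := fun y => y + t • Ψ y with hf
  have hfl : ApproximatesLinearOn f ((ContinuousLinearEquiv.refl ℝ V : V ≃L[ℝ] V) : V →L[ℝ] V)
      Set.univ (‖t‖₊ * C) := by
    intro x _ y _
    have : f x - f y - (ContinuousLinearEquiv.refl ℝ V : V →L[ℝ] V) (x - y) =
        t • (Ψ x - Ψ y) := by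
      simp only [hf, ContinuousLinearEquiv.coe_refl, ContinuousLinearMap.coe_id', id_eq, smul_sub]
      abel
    rw [this, norm_smul, NNReal.coe_mul, coe_nnnorm, mul_assoc]
    gcongr
    rw [← dist_eq_norm, ← dist_eq_norm]
    exact hC.dist_le_mul x y
  have hlt : ‖t‖₊ * C < ‖((ContinuousLinearEquiv.refl ℝ V).symm : V →L[ℝ] V)‖₊⁻¹ := by
    have : ‖((ContinuousLinearEquiv.refl ℝ V).symm : V →L[ℝ] V)‖₊ = 1 := by
      ext; simp
    rw [this, inv_one]
    exact_mod_cast htC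
  have hinj : Function.Injective f := Set.injOn_univ.1 (hfl.injOn (Or.inr hlt))
  have hsurj : Function.Surjective f := hfl.surjective (Or.inr hlt)
  have hfix : ∀ y, y ∉ Metric.ball (0 : V) R → f y = y := fun y hy => by
    simp [hf, image_eq_zero_of_notMem_tsupport fun h' => hy (hR h')]
  -- Outside the ball `f` is the identity; being a bijection of the space, it must then map the ball
  -- onto itself.
  have himg : f '' Metric.ball (0 : V) R = Metric.ball (0 : V) R := by
    ext y
    constructor
    · rintro ⟨x, hx, rfl⟩
      by_contra hy
      exact hy (by rwa [hinj (hfix _ hy)])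
    · intro hy
      obtain ⟨x, rfl⟩ := hsurj y
      by_cases hx : x ∈ Metric.ball (0 : V) R
      · exact ⟨x, hx, rfl⟩
      · rw [hfix x hx] at hy; exact absurd hy hx
  have hder : ∀ y, HasFDerivAt f ((1 : V →L[ℝ] V) + t • fderiv ℝ Ψ y) y := fun y =>
    (hasFDerivAt_id y).add (((h.differentiable one_ne_zero) y).hasFDerivAt.const_smul t)
  have hcv := integral_image_eq_integral_abs_det_fderiv_smul (volume : Measure V)
    (Metric.isOpen_ball (x := (0 : V)) (ε := R)).measurableSet
    (fun y _ => (hder y).hasFDerivWithinAt) hinj.injOn (fun _ => (1 : ℝ))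
  rw [himg] at hcv
  have hdet : ∀ y, |((1 : V →L[ℝ] V) + t • fderiv ℝ Ψ y).det| =
      (detPoly (fderiv ℝ Ψ y : V →ₗ[ℝ] V)).eval t := by
    intro y
    rw [eval_detPoly]
    refine abs_of_pos ?_
    refine det_one_add_pos (T := t • fderiv ℝ Ψ y) ?_
    rw [norm_smul]
    exact lt_of_le_of_lt (mul_le_mul_of_nonneg_left (hdC y) (norm_nonneg t)) htC
  simp only [smul_eq_mul, mul_one, hdet] at hcv
  have hon : ∫ y, (detPoly (fderiv ℝ Ψ y : V →ₗ[ℝ] V) - 1).eval t =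
      ∫ y in Metric.ball (0 : V) R, (detPoly (fderiv ℝ Ψ y : V →ₗ[ℝ] V) - 1).eval t := by
    refine (setIntegral_eq_integral_of_forall_compl_eq_zero fun y hy => ?_).symm
    rw [Polynomial.eval_sub, eval_detPoly, hdsupp y hy]
    simp
  rw [hon]
  have hone : IntegrableOn (fun _ : V => (1 : ℝ)) (Metric.ball (0 : V) R) :=
    integrableOn_const (measure_ball_lt_top).ne
  have hint2 : IntegrableOn (fun y => (detPoly (fderiv ℝ Ψ y : V →ₗ[ℝ] V)).eval t)
      (Metric.ball (0 : V) R) := by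
    refine ((hint t).integrableOn.add hone).congr (ae_of_all _ fun y => ?_)
    simp
  simp only [Polynomial.eval_sub, Polynomial.eval_one]
  rw [integral_sub hint2 hone, hcv, sub_self]

variable (V) in
/-- First and second variation of the null Lagrangian `∫ det DΦ`. -/
theorem integral_variation_eq_zero [Nontrivial V] {Φ Ψ : V → V} (hΦ : ContDiff ℝ 1 Φ)
    (hΦc : HasCompactSupport Φ) (hΨ : ContDiff ℝ 1 Ψ) (hΨc : HasCompactSupport Ψ)
    (B : V → V →ₗ[ℝ] V) (hB : ∀ y ∈ tsupport Ψ, (fderiv ℝ Φ y : V →ₗ[ℝ] V) * B y = 1) (k : ℕ)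
    (hk : k ≠ 0) :
    ∫ y, LinearMap.det (fderiv ℝ Φ y : V →ₗ[ℝ] V) *
      (detPoly (B y * (fderiv ℝ Ψ y : V →ₗ[ℝ] V))).coeff k = 0 := by
  have hzero : ∀ t : ℝ, Integrable (fun y => LinearMap.det (fderiv ℝ (Φ + t • Ψ) y : V →ₗ[ℝ] V)) ∧
      ∫ y, LinearMap.det (fderiv ℝ (Φ + t • Ψ) y : V →ₗ[ℝ] V) = 0 := by
    intro t
    have h1 : ContDiff ℝ 1 (Φ + t • Ψ) := hΦ.add (hΨ.const_smul t)
    have h2 : HasCompactSupport (Φ + t • Ψ) := hΦc.add (hΨc.mono (by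
      intro y hy hy'; apply hy; simp [hy']))
    refine ⟨(continuous_det_fderiv h1).integrable_of_hasCompactSupport ?_,
      integral_det_fderiv_eq_zero V h1 h2⟩
    refine (h2.fderiv ℝ).mono' ?_
    intro y hy
    apply subset_tsupport
    intro h0
    apply hy
    simp only [h0]
    simp
  have hev : ∀ (t : ℝ) (y : V), (Polynomial.C (LinearMap.det (fderiv ℝ Φ y : V →ₗ[ℝ] V)) *
      (detPoly (B y * (fderiv ℝ Ψ y : V →ₗ[ℝ] V)) - 1)).eval t =
      LinearMap.det (fderiv ℝ (Φ + t • Ψ) y : V →ₗ[ℝ] V) -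
      LinearMap.det (fderiv ℝ (Φ + (0 : ℝ) • Ψ) y : V →ₗ[ℝ] V) := by
    intro t y
    have hd : ∀ t : ℝ, fderiv ℝ (Φ + t • Ψ) y = fderiv ℝ Φ y + t • fderiv ℝ Ψ y := fun t => by
      rw [fderiv_add (hΦ.differentiable one_ne_zero y)
        ((hΨ.differentiable one_ne_zero y).const_smul t),
        fderiv_const_smul (hΨ.differentiable one_ne_zero y)]
    rw [hd, hd, zero_smul, add_zero, Polynomial.eval_mul, Polynomial.eval_C, Polynomial.eval_sub,
      eval_detPoly, Polynomial.eval_one, mul_sub, mul_one, ← map_mul]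
    congr 2
    -- `B` is only assumed to invert `DΦ` on the support of `Ψ`; elsewhere `DΨ = 0` and both sides
    -- vanish.
    by_cases hy : y ∈ tsupport Ψ
    · rw [mul_add, mul_one, mul_smul_comm, ← mul_assoc, hB y hy, one_mul]
      rfl
    · have : fderiv ℝ Ψ y = 0 :=
        image_eq_zero_of_notMem_tsupport fun hy' => hy (tsupport_fderiv_subset ℝ hy')
      simp [this]
  have := integral_coeff_eq_zero (μ := (volume : Measure V))
    (fun y => Polynomial.C (LinearMap.det (fderiv ℝ Φ y : V →ₗ[ℝ] V)) *
      (detPoly (B y * (fderiv ℝ Ψ y : V →ₗ[ℝ] V)) - 1)) (Module.finrank ℝ V)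
    (fun y => Polynomial.natDegree_C_mul_le _ _ |>.trans
      ((Polynomial.natDegree_sub_le _ _).trans (by simp [natDegree_detPoly_le])))
    (fun t => by
      simp_rw [hev]
      exact (hzero t).1.sub (hzero 0).1)
    ⟨1, one_pos, fun t _ => by
      simp_rw [hev]
      rw [integral_sub (hzero t).1 (hzero 0).1, (hzero t).2, (hzero 0).2, sub_zero]⟩ k
  rw [← this]
  refine integral_congr_ae (ae_of_all _ fun y => ?_)
  simp [Polynomial.coeff_one, hk]

end NullLagrangian

/-! ### Radial cutoffs -/

section Cutoff

variable {V : Type*} [NormedAddCommGroup V] [InnerProductSpace ℝ V]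

/-- Since the outer radius is less than 1, the cutoff vanishes near the origin and removes the
singularity of `Θ` there. -/
theorem contDiff_bump_norm_smul (b : ContDiffBump (1 : ℝ)) (hb : b.rOut < 1) {Θ : V → V}
    (hΘ : ContDiffOn ℝ 1 Θ {0}ᶜ) : ContDiff ℝ 1 fun y => b ‖y‖ • Θ y := by
  rw [contDiff_iff_contDiffAt]
  intro y
  by_cases hy : y = 0
  · have : (fun y => b ‖y‖ • Θ y) =ᶠ[𝓝 y] fun _ => 0 := by
      filter_upwards [Metric.ball_mem_nhds y (sub_pos.2 hb)] with u hu
      rw [hy, mem_ball_zero_iff] at hu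
      rw [b.zero_of_le_dist, zero_smul]
      rw [Real.dist_eq, abs_sub_comm, abs_of_pos (by linarith [b.rOut_pos])]
      linarith
    exact contDiffAt_const.congr_of_eventuallyEq this
  · exact (b.contDiff.contDiffAt.comp y (contDiffAt_norm ℝ hy)).smul
      (hΘ.contDiffAt (isOpen_compl_singleton.mem_nhds hy))

theorem tsupport_bump_norm_smul_subset (b : ContDiffBump (1 : ℝ)) (Θ : V → V) :
    tsupport (fun y => b ‖y‖ • Θ y) ⊆ {y | |‖y‖ - 1| ≤ b.rOut} := by
  refine closure_minimal ?_ (isClosed_le (by fun_prop) continuous_const)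
  intro y hy
  by_contra h
  apply hy
  simp only [Set.mem_ofPred_eq, not_le] at h
  simp only [b.zero_of_le_dist (x := ‖y‖) (by rw [Real.dist_eq]; exact h.le), zero_smul]

variable [FiniteDimensional ℝ V]

theorem hasCompactSupport_bump_norm_smul (b : ContDiffBump (1 : ℝ)) (Θ : V → V) :
    HasCompactSupport fun y => b ‖y‖ • Θ y := by
  refine (isCompact_closedBall (0 : V) (1 + b.rOut)).of_isClosed_subset (isClosed_tsupport _) ?_
  refine (tsupport_bump_norm_smul_subset b Θ).trans fun y hy => ?_
  have hy' : |‖y‖ - 1| ≤ b.rOut := hy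
  rw [mem_closedBall_zero_iff]
  linarith [(abs_le.1 hy').2]

variable [MeasurableSpace V] [BorelSpace V]

/-- Variation of `∫ det DΦ` for fields defined away from the origin. -/
theorem integral_radial_variation_eq_zero [Nontrivial V] {Φ Ψ : V → V}
    (hΦ : ContDiffOn ℝ 1 Φ {0}ᶜ) (hΨ : ContDiffOn ℝ 1 Ψ {0}ᶜ) (b : ContDiffBump (1 : ℝ))
    (hb : b.rOut < 1 / 2) (B : V → V →ₗ[ℝ] V)
    (hB : ∀ y ≠ 0, (fderiv ℝ Φ y : V →ₗ[ℝ] V) * B y = 1) (k : ℕ) (hk : k ≠ 0) :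
    ∫ y, LinearMap.det (fderiv ℝ Φ y : V →ₗ[ℝ] V) *
      (detPoly (B y * (fderiv ℝ (fun y => b ‖y‖ • Ψ y) y : V →ₗ[ℝ] V))).coeff k = 0 := by
  -- This second cutoff equals 1 for `|‖y‖ - 1| ≤ 1/2`, hence near the support of the first one: the
  -- truncated `Φ` has compact support and the same derivative as `Φ` where `Ψ` is varied.
  let b2 : ContDiffBump (1 : ℝ) := ⟨1 / 2, 3 / 4, by norm_num, by norm_num⟩
  have hnear : ∀ y, |‖y‖ - 1| ≤ b.rOut →
      fderiv ℝ (fun y => b2 ‖y‖ • Φ y) y = fderiv ℝ Φ y := by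
    intro y hy
    refine Filter.EventuallyEq.fderiv_eq ?_
    have : {y : V | |‖y‖ - 1| < 1 / 2} ∈ 𝓝 y :=
      (isOpen_lt (by fun_prop) continuous_const).mem_nhds (lt_of_le_of_lt hy hb)
    filter_upwards [this] with u hu
    rw [b2.one_of_mem_closedBall (by rw [Metric.mem_closedBall, Real.dist_eq]; exact hu.le),
      one_smul]
  have key := integral_variation_eq_zero V
    (contDiff_bump_norm_smul b2 (by norm_num [b2]) hΦ) (hasCompactSupport_bump_norm_smul b2 Φ)
    (contDiff_bump_norm_smul b (by linarith) hΨ) (hasCompactSupport_bump_norm_smul b Ψ) B ?_ k hk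
  · rw [← key]
    refine integral_congr_ae (ae_of_all _ fun y => ?_)
    by_cases hy : |‖y‖ - 1| ≤ b.rOut
    · simp only [hnear y hy]
    · have : fderiv ℝ (fun y => b ‖y‖ • Ψ y) y = 0 :=
        image_eq_zero_of_notMem_tsupport fun hy' =>
          hy (tsupport_bump_norm_smul_subset b Ψ (tsupport_fderiv_subset ℝ hy'))
      have h1 : (detPoly (0 : V →ₗ[ℝ] V)).coeff k = 0 := by
        have : detPoly (0 : V →ₗ[ℝ] V) = 1 := by
          refine Polynomial.funext fun t => ?_
          simp [eval_detPoly]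
        rw [this, Polynomial.coeff_one, if_neg hk]
      simp [this, h1]
  · intro y hy
    have hy' := tsupport_bump_norm_smul_subset b Ψ hy
    rw [hnear y hy']
    refine hB y fun h0 => ?_
    rw [h0] at hy'
    norm_num at hy'
    linarith

end Cutoff

end ConvexStability

end

open MeasureTheory Topology
open scoped Pointwise Gradient RealInnerProductSpace

noncomputable section

namespace ConvexStability

/-! ### Polar coordinates and homogeneous functions -/

section Homogeneous

variable {n : ℕ}

theorem norm_sph (x : Sph n) : ‖(x : E n)‖ = 1 := mem_sphere_zero_iff_norm.1 x.2

theorem sph_ne_zero (x : Sph n) : (x : E n) ≠ 0 := by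
  intro h
  have := norm_sph x
  rw [h, norm_zero] at this
  exact zero_ne_one this

theorem inner_sph_self (x : Sph n) : ⟪(x : E n), (x : E n)⟫ = 1 := by
  rw [real_inner_self_eq_norm_sq, norm_sph x, one_pow]

theorem exists_smul_sph {y : E n} (hy : y ≠ 0) : ∃ x : Sph n, y = ‖y‖ • (x : E n) :=
  ⟨⟨‖y‖⁻¹ • y, by rw [mem_sphere_zero_iff_norm, norm_smul, norm_inv, norm_norm,
      inv_mul_cancel₀ (norm_ne_zero_iff.mpr hy)]⟩, by
    simp [smul_smul, mul_inv_cancel₀ (norm_ne_zero_iff.mpr hy)]⟩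

instance : IsFiniteMeasure (sphMeasure n) := by unfold sphMeasure; infer_instance

instance : (sphMeasure n).IsOpenPosMeasure := by unfold sphMeasure; infer_instance

/-- Integration in polar coordinates. -/
theorem integral_polar (hn : n ≠ 0) (k : ℝ → ℝ) (w : Sph n → ℝ) (g : E n → ℝ)
    (hg : ∀ r > 0, ∀ x : Sph n, g (r • (x : E n)) = k r * w x) :
    ∫ y, g y = (∫ r in Set.Ioi (0 : ℝ), r ^ (n - 1) * k r) * ∫ x, w x ∂(sphMeasure n) := by
  have : Nonempty (Fin n) := ⟨⟨0, Nat.pos_of_ne_zero hn⟩⟩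
  have hd : Module.finrank ℝ (E n) - 1 = n - 1 := by simp
  calc ∫ y, g y = ∫ y : ({(0)}ᶜ : Set (E n)), g y.1 ∂((volume : Measure (E n)).comap (↑)) := by
        rw [integral_subtype_comap (measurableSet_singleton _).compl fun x => g x,
          restrict_compl_singleton]
    _ = ∫ p : Sph n × Set.Ioi (0 : ℝ), w p.1 * k p.2.1
          ∂((sphMeasure n).prod (.volumeIoiPow (n - 1))) := by
        rw [← hd]
        unfold sphMeasure
        rw [← (volume : Measure (E n)).measurePreserving_homeomorphUnitSphereProd.integral_comp
          (Homeomorph.measurableEmbedding _)]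
        refine integral_congr_ae (ae_of_all _ fun y => ?_)
        have hy : (y : E n) ≠ 0 := y.2
        have h1 := hg ‖(y : E n)‖ (norm_pos_iff.2 hy) (homeomorphUnitSphereProd (E n) y).1
        rw [homeomorphUnitSphereProd_apply_fst_coe, smul_smul,
          mul_inv_cancel₀ (norm_ne_zero_iff.2 hy), one_smul] at h1
        simp only [homeomorphUnitSphereProd_apply_snd_coe]
        rw [h1, mul_comm]
    _ = (∫ x, w x ∂(sphMeasure n)) * ∫ r : Set.Ioi (0 : ℝ), k r ∂(.volumeIoiPow (n - 1)) :=
        integral_prod_mul w fun r : Set.Ioi (0 : ℝ) => k r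
    _ = _ := by
        rw [mul_comm]
        congr 1
        simp only [Measure.volumeIoiPow, ENNReal.ofReal]
        rw [integral_withDensity_eq_integral_smul,
          integral_subtype_comap measurableSet_Ioi fun a => Real.toNNReal (a ^ (n - 1)) • k a,
          setIntegral_congr_fun measurableSet_Ioi fun x hx => ?_]
        · simp only [NNReal.smul_def, smul_eq_mul]
          rw [Real.coe_toNNReal _ (pow_nonneg hx.out.le _)]
        · exact (measurable_subtype_coe.pow_const _).real_toNNReal

theorem inner_gradient (f : E n → ℝ) (y v : E n) : ⟪∇ f y, v⟫ = fderiv ℝ f y v := by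
  simp [gradient]

theorem gradient_eq_sum (f : E n → ℝ) (y : E n) :
    ∇ f y = ∑ i, fderiv ℝ f y (EuclideanSpace.basisFun (Fin n) ℝ i) •
      EuclideanSpace.basisFun (Fin n) ℝ i := by
  conv_lhs => rw [← (EuclideanSpace.basisFun (Fin n) ℝ).sum_repr' (∇ f y)]
  refine Finset.sum_congr rfl fun i _ => ?_
  rw [real_inner_comm, inner_gradient]

theorem contDiffOn_gradient {f : E n → ℝ} {s : Set (E n)} (hs : IsOpen s) {k : ℕ}
    (hf : ContDiffOn ℝ (k + 1 : ℕ) f s) : ContDiffOn ℝ k (∇ f) s := by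
  have : ∇ f = fun y => ∑ i, fderiv ℝ f y (EuclideanSpace.basisFun (Fin n) ℝ i) •
      EuclideanSpace.basisFun (Fin n) ℝ i := funext fun y => gradient_eq_sum f y
  rw [this]
  refine ContDiffOn.sum fun i _ => ?_
  exact ((hf.fderiv_of_isOpen hs (by norm_cast)).clm_apply contDiffOn_const).smul contDiffOn_const

theorem inner_hess {f : E n → ℝ} {y : E n} (h : ContDiffAt ℝ 2 f y) (u v : E n) :
    ⟪hess f y u, v⟫ = fderiv ℝ (fderiv ℝ f) y u v := by
  have hd : DifferentiableAt ℝ (fderiv ℝ f) y :=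
    (h.fderiv_right (m := 1) (by norm_num)).differentiableAt one_ne_zero
  have hg : DifferentiableAt ℝ (∇ f) y := by
    have : ∇ f = fun y => ∑ i, fderiv ℝ f y (EuclideanSpace.basisFun (Fin n) ℝ i) •
      EuclideanSpace.basisFun (Fin n) ℝ i := funext fun y => gradient_eq_sum f y
    rw [this]
    refine DifferentiableAt.fun_sum fun i _ => DifferentiableAt.smul_const ?_ _
    exact hd.clm_apply (differentiableAt_const _)
  have h1 : HasFDerivAt (fun y => ⟪∇ f y, v⟫) ((innerSL ℝ v).comp (hess f y)) y := by
    have := (innerSL ℝ v).hasFDerivAt.comp y hg.hasFDerivAt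
    refine this.congr_of_eventuallyEq (Filter.Eventually.of_forall fun u => ?_)
    simp
  have h2 : HasFDerivAt (fun y => fderiv ℝ f y v)
      ((ContinuousLinearMap.apply ℝ ℝ v).comp (fderiv ℝ (fderiv ℝ f) y)) y :=
    (ContinuousLinearMap.apply ℝ ℝ v).hasFDerivAt.comp y hd.hasFDerivAt
  simp only [inner_gradient] at h1
  have := congrArg (fun L => L u) (h1.unique h2)
  simpa [real_inner_comm] using this

theorem hess_symm {f : E n → ℝ} {y : E n} (h : ContDiffAt ℝ 2 f y) (u v : E n) :
    ⟪hess f y u, v⟫ = ⟪u, hess f y v⟫ := by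
  rw [real_inner_comm (hess f y v) u, inner_hess h, inner_hess h]
  exact (h.isSymmSndFDerivAt (by simp)).eq u v

section HomExt

variable {z w : Sph n → ℝ}

theorem homExt_smul_coe (z : Sph n → ℝ) {r : ℝ} (hr : 0 < r) (x : Sph n) :
    homExt z (r • (x : E n)) = r * z x := by
  have h : ‖r • (x : E n)‖ = r := by rw [norm_smul, norm_sph x, mul_one, Real.norm_of_nonneg hr.le]
  rw [homExt, dif_neg (smul_ne_zero hr.ne' (sph_ne_zero x))]
  simp only [h]
  congr 2
  ext1
  simp [smul_smul, inv_mul_cancel₀ hr.ne']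

theorem homExt_coe (z : Sph n → ℝ) (x : Sph n) : homExt z (x : E n) = z x := by
  have := homExt_smul_coe z one_pos x
  rwa [one_smul, one_mul] at this

theorem homExt_smul (z : Sph n → ℝ) {r : ℝ} (hr : 0 < r) (y : E n) :
    homExt z (r • y) = r * homExt z y := by
  by_cases hy : y = 0
  · simp [homExt, hy]
  · obtain ⟨x, hx⟩ := exists_smul_sph hy
    have hy' := norm_pos_iff.2 hy
    rw [hx, smul_smul, homExt_smul_coe z hy', homExt_smul_coe z (mul_pos hr hy'), mul_assoc]

theorem IsC2.contDiffAt (hz : IsC2 z) {y : E n} (hy : y ≠ 0) : ContDiffAt ℝ 2 (homExt z) y :=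
  ContDiffOn.contDiffAt hz (isOpen_compl_singleton.mem_nhds hy)

theorem IsC2.differentiableAt (hz : IsC2 z) {y : E n} (hy : y ≠ 0) :
    DifferentiableAt ℝ (homExt z) y := (hz.contDiffAt hy).differentiableAt two_ne_zero

theorem IsC2.contDiffOn_gradient (hz : IsC2 z) : ContDiffOn ℝ 1 (∇ (homExt z)) {0}ᶜ :=
  ConvexStability.contDiffOn_gradient (k := 1) isOpen_compl_singleton hz

theorem IsC2.hasFDerivAt_gradient (hz : IsC2 z) {y : E n} (hy : y ≠ 0) :
    HasFDerivAt (∇ (homExt z)) (hess (homExt z) y) y :=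
  ((hz.contDiffOn_gradient.contDiffAt (isOpen_compl_singleton.mem_nhds hy)).differentiableAt
    one_ne_zero).hasFDerivAt

theorem IsC2.continuousOn_hess (hz : IsC2 z) : ContinuousOn (hess (homExt z)) {0}ᶜ :=
  hz.contDiffOn_gradient.continuousOn_fderiv_of_isOpen isOpen_compl_singleton le_rfl

theorem IsC2.gradient_smul (hz : IsC2 z) {r : ℝ} (hr : 0 < r) {y : E n} (hy : y ≠ 0) :
    ∇ (homExt z) (r • y) = ∇ (homExt z) y := by
  refine ext_inner_right ℝ fun v => ?_
  rw [inner_gradient, inner_gradient]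
  have h1 : HasFDerivAt (fun u => homExt z (r • u))
      ((fderiv ℝ (homExt z) (r • y)).comp (r • ContinuousLinearMap.id ℝ (E n))) y :=
    ((hz.differentiableAt (smul_ne_zero hr.ne' hy)).hasFDerivAt.comp y
      ((hasFDerivAt_id y).const_smul r))
  have h2 : HasFDerivAt (fun u => homExt z (r • u)) (r • fderiv ℝ (homExt z) y) y := by
    simp_rw [homExt_smul z hr]
    exact (hz.differentiableAt hy).hasFDerivAt.const_smul r
  have := congrArg (fun L => L v) (h1.unique h2)
  simp only [ContinuousLinearMap.comp_apply, smul_apply,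
    ContinuousLinearMap.id_apply, map_smul, smul_eq_mul] at this
  exact mul_left_cancel₀ hr.ne' this

/-- Euler's identity, from differentiating the homogeneity relation along the ray at `r = 1`. The
same computation for the `0`-homogeneous gradient shows below that the Hessian annihilates the
radial direction. -/
theorem IsC2.inner_gradient_self (hz : IsC2 z) {y : E n} (hy : y ≠ 0) :
    ⟪∇ (homExt z) y, y⟫ = homExt z y := by
  rw [inner_gradient]
  have h0 : HasDerivAt (fun r : ℝ => r • y) y 1 := by
    simpa using (hasDerivAt_id (1 : ℝ)).smul_const y
  have h1 : HasDerivAt (fun r : ℝ => homExt z (r • y)) (fderiv ℝ (homExt z) y y) 1 := by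
    have h2 : HasFDerivAt (homExt z) (fderiv ℝ (homExt z) y) ((1 : ℝ) • y) := by
      rw [one_smul]; exact (hz.differentiableAt hy).hasFDerivAt
    exact h2.comp_hasDerivAt (1 : ℝ) h0
  have h3 : HasDerivAt (fun r : ℝ => homExt z (r • y)) (homExt z y) 1 := by
    have : HasDerivAt (fun r : ℝ => r * homExt z y) (homExt z y) 1 := by
      simpa using (hasDerivAt_id (1 : ℝ)).mul_const (homExt z y)
    refine this.congr_of_eventuallyEq ?_
    filter_upwards [lt_mem_nhds (zero_lt_one' ℝ)] with r hr
    exact homExt_smul z hr y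
  exact h1.unique h3

theorem IsC2.hess_self (hz : IsC2 z) {y : E n} (hy : y ≠ 0) : hess (homExt z) y y = 0 := by
  have h0 : HasDerivAt (fun r : ℝ => r • y) y 1 := by
    simpa using (hasDerivAt_id (1 : ℝ)).smul_const y
  have h1 : HasDerivAt (fun r : ℝ => ∇ (homExt z) (r • y)) (hess (homExt z) y y) 1 := by
    have h2 : HasFDerivAt (∇ (homExt z)) (hess (homExt z) y) ((1 : ℝ) • y) := by
      rw [one_smul]; exact hz.hasFDerivAt_gradient hy
    exact h2.comp_hasDerivAt (1 : ℝ) h0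
  have h3 : HasDerivAt (fun r : ℝ => ∇ (homExt z) (r • y)) 0 1 := by
    refine (hasDerivAt_const (1 : ℝ) (∇ (homExt z) y)).congr_of_eventuallyEq ?_
    filter_upwards [lt_mem_nhds (zero_lt_one' ℝ)] with r hr
    exact hz.gradient_smul hr hy
  exact h1.unique h3

theorem IsC2.hess_symm (hz : IsC2 z) {y : E n} (hy : y ≠ 0) (u v : E n) :
    ⟪hess (homExt z) y u, v⟫ = ⟪u, hess (homExt z) y v⟫ :=
  ConvexStability.hess_symm (hz.contDiffAt hy) u v

theorem IsC2.inner_hess_self (hz : IsC2 z) {y : E n} (hy : y ≠ 0) (u : E n) :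
    ⟪y, hess (homExt z) y u⟫ = 0 := by
  rw [← hz.hess_symm hy, hz.hess_self hy, inner_zero_left]

theorem IsC2.hess_smul (hz : IsC2 z) {r : ℝ} (hr : 0 < r) {y : E n} (hy : y ≠ 0) :
    hess (homExt z) (r • y) = r⁻¹ • hess (homExt z) y := by
  have h1 : HasFDerivAt (fun u => ∇ (homExt z) (r • u))
      ((hess (homExt z) (r • y)).comp (r • ContinuousLinearMap.id ℝ (E n))) y :=
    ((hz.hasFDerivAt_gradient (smul_ne_zero hr.ne' hy)).comp y
      ((hasFDerivAt_id y).const_smul r))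
  have h2 : HasFDerivAt (fun u => ∇ (homExt z) (r • u)) (hess (homExt z) y) y := by
    refine (hz.hasFDerivAt_gradient hy).congr_of_eventuallyEq ?_
    filter_upwards [isOpen_compl_singleton.mem_nhds hy] with u hu
    exact hz.gradient_smul hr hu
  rw [← h1.unique h2]
  ext1 v
  simp [smul_smul, inv_mul_cancel₀ hr.ne']

end HomExt

end Homogeneous

end ConvexStability

end

open MeasureTheory Topology
open scoped Pointwise Gradient RealInnerProductSpace

noncomputable section

namespace ConvexStability

open InnerProductSpace (rankOne)

/-! ### Algebra of `C²` functions on the sphere -/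

section IsC2

variable {n : ℕ} {z w : Sph n → ℝ}

theorem homExt_zero (z : Sph n → ℝ) : homExt z 0 = 0 := by simp [homExt]

theorem homExt_ext {z : Sph n → ℝ} {F : E n → ℝ} (h0 : F 0 = 0)
    (h : ∀ r > 0, ∀ x : Sph n, F (r • (x : E n)) = r * z x) : homExt z = F := by
  funext y
  by_cases hy : y = 0
  · rw [hy, h0, homExt_zero]
  · obtain ⟨x, hx⟩ := exists_smul_sph hy
    have hy' := norm_pos_iff.2 hy
    rw [hx, homExt_smul_coe z hy', h _ hy']

theorem homExt_add (z w : Sph n → ℝ) :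
    homExt (fun x => z x + w x) = fun y => homExt z y + homExt w y :=
  homExt_ext (by simp [homExt_zero]) fun r hr x => by
    rw [homExt_smul_coe z hr, homExt_smul_coe w hr]; ring

theorem homExt_const_mul (c : ℝ) (z : Sph n → ℝ) :
    homExt (fun x => c * z x) = fun y => c * homExt z y :=
  homExt_ext (by simp [homExt_zero]) fun r hr x => by rw [homExt_smul_coe z hr]; ring

theorem homExt_inner (v : E n) : homExt (fun x : Sph n => ⟪(x : E n), v⟫) = fun y => ⟪y, v⟫ :=
  homExt_ext (by simp) fun r _ x => by rw [real_inner_smul_left]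

theorem homExt_one : homExt (fun _ : Sph n => (1 : ℝ)) = fun y => ‖y‖ :=
  homExt_ext (by simp) fun r hr x => by
    rw [norm_smul, norm_sph x, Real.norm_of_nonneg hr.le]

theorem homExt_mul (z w : Sph n → ℝ) :
    homExt (fun x => z x * w x) = fun y => ‖y‖⁻¹ * homExt z y * homExt w y :=
  homExt_ext (by simp) fun r hr x => by
    rw [homExt_smul_coe z hr, homExt_smul_coe w hr, norm_smul, norm_sph x,
      Real.norm_of_nonneg hr.le]
    field_simp

theorem homExt_div (z w : Sph n → ℝ) :
    homExt (fun x => z x / w x) = fun y => ‖y‖ * homExt z y / homExt w y :=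
  homExt_ext (by simp) fun r hr x => by
    rw [homExt_smul_coe z hr, homExt_smul_coe w hr, norm_smul, norm_sph x,
      Real.norm_of_nonneg hr.le]
    by_cases h : w x = 0
    · simp [h]
    · field_simp

theorem homExt_pos (hw : ∀ x, 0 < w x) {y : E n} (hy : y ≠ 0) : 0 < homExt w y := by
  obtain ⟨x, hx⟩ := exists_smul_sph hy
  rw [hx, homExt_smul_coe w (norm_pos_iff.2 hy)]
  exact mul_pos (norm_pos_iff.2 hy) (hw x)

theorem IsC2.add (hz : IsC2 z) (hw : IsC2 w) : IsC2 fun x => z x + w x := by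
  rw [IsC2, homExt_add]; exact ContDiffOn.add hz hw

theorem IsC2.const_mul (c : ℝ) (hz : IsC2 z) : IsC2 fun x => c * z x := by
  rw [IsC2, homExt_const_mul]; exact contDiffOn_const.mul hz

theorem IsC2.sub (hz : IsC2 z) (hw : IsC2 w) : IsC2 fun x => z x - w x := by
  have := hz.add (hw.const_mul (-1))
  simpa [sub_eq_add_neg] using this

theorem contDiffOn_norm_compl {k : WithTop ℕ∞} : ContDiffOn ℝ k (fun y : E n => ‖y‖) {0}ᶜ :=
  fun _ hy => (contDiffAt_norm ℝ hy).contDiffWithinAt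

theorem IsC2.mul (hz : IsC2 z) (hw : IsC2 w) : IsC2 fun x => z x * w x := by
  rw [IsC2, homExt_mul]
  exact ((contDiffOn_norm_compl.inv fun y hy => norm_ne_zero_iff.2 hy).mul hz).mul hw

theorem IsC2.div (hz : IsC2 z) (hw : IsC2 w) (h : ∀ x, 0 < w x) : IsC2 fun x => z x / w x := by
  rw [IsC2, homExt_div]
  exact (contDiffOn_norm_compl.mul hz).div hw fun y hy => (homExt_pos h hy).ne'

theorem isC2_inner (v : E n) : IsC2 fun x : Sph n => ⟪(x : E n), v⟫ := by
  rw [IsC2, homExt_inner]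
  exact (contDiff_id.inner ℝ contDiff_const).contDiffOn

theorem isC2_const (c : ℝ) : IsC2 fun _ : Sph n => c := by
  have : IsC2 fun _ : Sph n => (1 : ℝ) := by
    rw [IsC2, homExt_one]; exact contDiffOn_norm_compl
  simpa using this.const_mul c

theorem IsC2.continuous (hz : IsC2 z) : Continuous z := by
  have : z = fun x : Sph n => homExt z (x : E n) := funext fun x => (homExt_coe z x).symm
  rw [this]
  exact (ContDiffOn.continuousOn hz).comp_continuous continuous_subtype_val fun x => sph_ne_zero x

theorem continuousOn_homExt (hz : Continuous z) : ContinuousOn (homExt z) {0}ᶜ := by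
  rw [continuousOn_iff_continuous_domRestrict]
  have : Set.domRestrict {0}ᶜ (homExt z) = fun y : ({0}ᶜ : Set (E n)) =>
      ‖(y : E n)‖ * z (homeomorphUnitSphereProd (E n) y).1 := by
    funext y
    have hy : (y : E n) ≠ 0 := y.2
    simp only [Set.domRestrict_apply, homExt, dif_neg hy]
    congr 2
    ext1
    rw [homeomorphUnitSphereProd_apply_fst_coe]
  rw [this]
  exact (continuous_subtype_val.norm).mul (hz.comp
    (continuous_fst.comp (homeomorphUnitSphereProd (E n)).continuous))

theorem gradient_add {f g : E n → ℝ} {y : E n} (hf : DifferentiableAt ℝ f y)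
    (hg : DifferentiableAt ℝ g y) : ∇ (fun y => f y + g y) y = ∇ f y + ∇ g y := by
  refine ext_inner_right ℝ fun v => ?_
  rw [inner_add_left, inner_gradient, inner_gradient, inner_gradient, fderiv_fun_add hf hg]
  rfl

theorem gradient_const_mul (c : ℝ) {f : E n → ℝ} {y : E n} (hf : DifferentiableAt ℝ f y) :
    ∇ (fun y => c * f y) y = c • ∇ f y := by
  refine ext_inner_right ℝ fun v => ?_
  rw [real_inner_smul_left, inner_gradient, inner_gradient, fderiv_const_mul hf]
  rfl

theorem IsC2.gradient_add (hz : IsC2 z) (hw : IsC2 w) {y : E n} (hy : y ≠ 0) :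
    ∇ (homExt fun x => z x + w x) y = ∇ (homExt z) y + ∇ (homExt w) y := by
  rw [homExt_add]
  exact ConvexStability.gradient_add (hz.differentiableAt hy) (hw.differentiableAt hy)

theorem IsC2.gradient_const_mul (c : ℝ) (hz : IsC2 z) {y : E n} (hy : y ≠ 0) :
    ∇ (homExt fun x => c * z x) y = c • ∇ (homExt z) y := by
  rw [homExt_const_mul]
  exact ConvexStability.gradient_const_mul c (hz.differentiableAt hy)

theorem gradient_homExt_inner (v y : E n) :
    ∇ (homExt fun x : Sph n => ⟪(x : E n), v⟫) y = v := by
  refine ext_inner_right ℝ fun u => ?_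
  rw [inner_gradient, homExt_inner]
  have : HasFDerivAt (fun y : E n => ⟪y, v⟫) (innerSL ℝ v) y := by
    refine (innerSL ℝ v).hasFDerivAt.congr_of_eventuallyEq (.of_forall fun u => ?_)
    simp [real_inner_comm]
  rw [this.fderiv]
  simp

theorem IsC2.hess_add (hz : IsC2 z) (hw : IsC2 w) {y : E n} (hy : y ≠ 0) :
    hess (homExt fun x => z x + w x) y = hess (homExt z) y + hess (homExt w) y := by
  refine HasFDerivAt.fderiv ?_
  refine ((hz.hasFDerivAt_gradient hy).add (hw.hasFDerivAt_gradient hy)).congr_of_eventuallyEq ?_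
  filter_upwards [isOpen_compl_singleton.mem_nhds hy] with u hu
  exact hz.gradient_add hw hu

theorem IsC2.hess_const_mul (c : ℝ) (hz : IsC2 z) {y : E n} (hy : y ≠ 0) :
    hess (homExt fun x => c * z x) y = c • hess (homExt z) y := by
  refine HasFDerivAt.fderiv ?_
  refine ((hz.hasFDerivAt_gradient hy).const_smul c).congr_of_eventuallyEq ?_
  filter_upwards [isOpen_compl_singleton.mem_nhds hy] with u hu
  exact hz.gradient_const_mul c hu

theorem hess_homExt_inner (v y : E n) :
    hess (homExt fun x : Sph n => ⟪(x : E n), v⟫) y = 0 := by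
  have : ∇ (homExt fun x : Sph n => ⟪(x : E n), v⟫) = fun _ => v :=
    funext fun y => gradient_homExt_inner v y
  rw [hess, this]
  simp

theorem IsC2.continuous_gradient (hz : IsC2 z) :
    Continuous fun x : Sph n => ∇ (homExt z) (x : E n) :=
  hz.contDiffOn_gradient.continuousOn.comp_continuous continuous_subtype_val
    fun x => sph_ne_zero x

theorem IsC2.continuous_hess (hz : IsC2 z) :
    Continuous fun x : Sph n => hess (homExt z) (x : E n) :=
  hz.continuousOn_hess.comp_continuous continuous_subtype_val fun x => sph_ne_zero x

end IsC2

/-! ### The restricted Hessian as an operator on the ambient space -/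

section Operator

variable {n : ℕ}

/-- A positive `C²` function on the sphere with positive definite restricted Hessian. -/
structure IsPosC2 (h : Sph n → ℝ) : Prop where
  pos : ∀ x, 0 < h x
  isC2 : IsC2 h
  hess_pos : ∀ (x : Sph n) (u : E n), ⟪(x : E n), u⟫ = 0 → u ≠ 0 →
    0 < ⟪hess (homExt h) (x : E n) u, u⟫

/-- The restricted Hessian of `h` at `x`, extended by the identity on the line through `x`. -/
def extHess (h : Sph n → ℝ) (x : Sph n) : E n →L[ℝ] E n :=
  rankOne ℝ (x : E n) (x : E n) + hess (homExt h) (x : E n)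

theorem extHess_apply (h : Sph n → ℝ) (x : Sph n) (u : E n) :
    extHess h x u = ⟪(x : E n), u⟫ • (x : E n) + hess (homExt h) (x : E n) u := by
  simp [extHess]

/-- The inverse of the extended restricted Hessian. -/
def extHessInv (h : Sph n → ℝ) (x : Sph n) : E n →L[ℝ] E n := Ring.inverse (extHess h x)

/-- The density `det D²h`. -/
def detHess (h : Sph n → ℝ) (x : Sph n) : ℝ := LinearMap.det (extHess h x : E n →ₗ[ℝ] E n)

/-- The operator `(D²h)⁻¹ D²f`. -/
def relHess (h f : Sph n → ℝ) (x : Sph n) : E n →L[ℝ] E n :=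
  extHessInv h x * hess (homExt f) (x : E n)

/-- The trace of `(D²h)⁻¹ D²f`. -/
def relTrace (h f : Sph n → ℝ) (x : Sph n) : ℝ :=
  LinearMap.trace ℝ (E n) (relHess h f x : E n →ₗ[ℝ] E n)

variable {h f g : Sph n → ℝ}

/-- Split `u` into its component along `x` and its tangential part. The Hessian kills `x` and has
values in `x^⊥`, so the form is the sum of the square of the radial component and the positive
definite tangential form. -/
theorem IsPosC2.extHess_pos (hh : IsPosC2 h) (x : Sph n) {u : E n} (hu : u ≠ 0) :
    0 < ⟪extHess h x u, u⟫ := by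
  have hx := sph_ne_zero x
  set a := ⟪(x : E n), u⟫ with ha
  set v := u - a • (x : E n) with hv
  have hu' : u = v + a • (x : E n) := by rw [hv]; abel
  have hxv : ⟪(x : E n), v⟫ = 0 := by
    rw [hv, inner_sub_right, real_inner_smul_right, inner_sph_self]; ring
  have h1 : hess (homExt h) (x : E n) u = hess (homExt h) (x : E n) v := by
    rw [hu', map_add, map_smul, hh.isC2.hess_self hx, smul_zero, add_zero]
  have h2 : ⟪hess (homExt h) (x : E n) v, (x : E n)⟫ = 0 := by
    rw [real_inner_comm, hh.isC2.inner_hess_self hx]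
  have h3 : ⟪extHess h x u, u⟫ = a ^ 2 + ⟪hess (homExt h) (x : E n) v, v⟫ := by
    rw [extHess_apply, inner_add_left, real_inner_smul_left, ← ha, h1]
    conv_lhs => rw [hu', inner_add_right _ v, real_inner_smul_right, h2]
    ring
  rw [h3]
  by_cases hv0 : v = 0
  · have : a ≠ 0 := by
      intro h0
      rw [hv0, h0, zero_smul, add_zero] at hu'
      exact hu hu'
    rw [hv0, map_zero, inner_zero_left, add_zero]
    positivity
  · have := hh.hess_pos x v hxv hv0
    positivity

theorem IsPosC2.isUnit_extHess (hh : IsPosC2 h) (x : Sph n) : IsUnit (extHess h x) := by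
  rw [ContinuousLinearMap.isUnit_iff_bijective]
  have hinj : Function.Injective (extHess h x : E n →ₗ[ℝ] E n) := by
    rw [← LinearMap.ker_eq_bot, LinearMap.ker_eq_bot']
    intro u hu
    by_contra hne
    have := hh.extHess_pos x hne
    rw [show extHess h x u = 0 from hu, inner_zero_left] at this
    exact lt_irrefl _ this
  exact ⟨hinj, LinearMap.injective_iff_surjective.1 hinj⟩

theorem IsPosC2.mul_extHessInv (hh : IsPosC2 h) (x : Sph n) :
    extHess h x * extHessInv h x = 1 := Ring.mul_inverse_cancel _ (hh.isUnit_extHess x)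

theorem IsPosC2.extHessInv_mul (hh : IsPosC2 h) (x : Sph n) :
    extHessInv h x * extHess h x = 1 := Ring.inverse_mul_cancel _ (hh.isUnit_extHess x)

theorem IsPosC2.extHess_extHessInv (hh : IsPosC2 h) (x : Sph n) (u : E n) :
    extHess h x (extHessInv h x u) = u :=
  congrArg (fun T : E n →L[ℝ] E n => T u) (hh.mul_extHessInv x)

theorem IsPosC2.extHessInv_extHess (hh : IsPosC2 h) (x : Sph n) (u : E n) :
    extHessInv h x (extHess h x u) = u :=
  congrArg (fun T : E n →L[ℝ] E n => T u) (hh.extHessInv_mul x)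

theorem IsC2.extHess_symm (hh : IsC2 h) (x : Sph n) (u v : E n) :
    ⟪extHess h x u, v⟫ = ⟪u, extHess h x v⟫ := by
  rw [extHess_apply, extHess_apply, inner_add_left, inner_add_right, hh.hess_symm (sph_ne_zero x),
    real_inner_smul_left, real_inner_smul_right, real_inner_comm u (x : E n)]
  ring

theorem IsC2.extHess_self (hh : IsC2 h) (x : Sph n) : extHess h x (x : E n) = x := by
  rw [extHess_apply, hh.hess_self (sph_ne_zero x), inner_sph_self, one_smul, add_zero]

theorem IsPosC2.extHessInv_self (hh : IsPosC2 h) (x : Sph n) :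
    extHessInv h x (x : E n) = x := by
  conv_lhs => rw [← hh.isC2.extHess_self x, hh.extHessInv_extHess]

theorem IsPosC2.extHessInv_symm (hh : IsPosC2 h) (x : Sph n) (u v : E n) :
    ⟪extHessInv h x u, v⟫ = ⟪u, extHessInv h x v⟫ := by
  conv_lhs => rw [← hh.extHess_extHessInv x v, ← hh.isC2.extHess_symm, hh.extHess_extHessInv]

theorem IsPosC2.inner_extHessInv (hh : IsPosC2 h) (x : Sph n) (u : E n) :
    ⟪(x : E n), extHessInv h x u⟫ = ⟪(x : E n), u⟫ := by
  rw [← hh.extHessInv_symm, hh.extHessInv_self]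

theorem IsPosC2.extHessInv_pos (hh : IsPosC2 h) (x : Sph n) {u : E n} (hu : u ≠ 0) :
    0 < ⟪u, extHessInv h x u⟫ := by
  have h0 : extHessInv h x u ≠ 0 := by
    intro h0
    apply hu
    rw [← hh.extHess_extHessInv x u, h0, map_zero]
  have := hh.extHess_pos x h0
  rwa [hh.extHess_extHessInv] at this

theorem IsPosC2.continuous_extHess (hh : IsC2 h) : Continuous (extHess h) := by
  unfold extHess
  refine Continuous.add ?_ hh.continuous_hess
  simp_rw [InnerProductSpace.rankOne_def]
  fun_prop

theorem IsPosC2.continuous_extHessInv (hh : IsPosC2 h) : Continuous (extHessInv h) := by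
  rw [continuous_iff_continuousAt]
  intro x
  obtain ⟨U, hU⟩ := hh.isUnit_extHess x
  have h1 : ContinuousAt Ring.inverse (extHess h x) := by
    rw [← hU]; exact NormedRing.inverse_continuousAt U
  exact h1.comp (IsPosC2.continuous_extHess hh.isC2).continuousAt

theorem IsPosC2.continuous_relHess (hh : IsPosC2 h) (hf : IsC2 f) : Continuous (relHess h f) :=
  hh.continuous_extHessInv.mul hf.continuous_hess

theorem continuous_trace : Continuous fun T : E n →L[ℝ] E n =>
    LinearMap.trace ℝ (E n) (T : E n →ₗ[ℝ] E n) :=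
  LinearMap.continuous_of_finiteDimensional
    ((LinearMap.trace ℝ (E n)).comp (ContinuousLinearMap.coeLM ℝ))

theorem IsPosC2.continuous_relTrace (hh : IsPosC2 h) (hf : IsC2 f) : Continuous (relTrace h f) :=
  continuous_trace.comp (hh.continuous_relHess hf)

theorem continuous_detHess (hh : IsC2 h) : Continuous (detHess h) :=
  ContinuousLinearMap.continuous_det.comp (IsPosC2.continuous_extHess hh)

/-- An operator that preserves `x^⊥` is block triangular. -/
theorem det_rankOne_add_eq_det_restrictPerp (x : Sph n) (M : E n →L[ℝ] E n)
    (hM : ∀ u, ⟪(x : E n), M u⟫ = 0) :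
    LinearMap.det ((rankOne ℝ (x : E n) (x : E n) + M : E n →L[ℝ] E n) : E n →ₗ[ℝ] E n) =
      LinearMap.det (restrictPerp (x : E n) M) := by
  set T : E n →ₗ[ℝ] E n := ((rankOne ℝ (x : E n) (x : E n) + M : E n →L[ℝ] E n) : E n →ₗ[ℝ] E n)
    with hT
  have hTa : ∀ u, T u = ⟪(x : E n), u⟫ • (x : E n) + M u := fun u => by simp [hT]
  have hmem : ∀ u : E n, u ∈ (ℝ ∙ (x : E n))ᗮ ↔ ⟪(x : E n), u⟫ = 0 := fun u =>
    Submodule.mem_orthogonal_singleton_iff_inner_right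
  have hW : (ℝ ∙ (x : E n))ᗮ ≤ (ℝ ∙ (x : E n))ᗮ.comap T := by
    intro u hu
    rw [Submodule.mem_comap, hmem, hTa, (hmem u).1 hu, zero_smul, zero_add, hM]
  rw [LinearMap.det_eq_det_mul_det _ T hW]
  have h1 : (ℝ ∙ (x : E n))ᗮ.mapQ _ T hW = LinearMap.id := by
    refine Submodule.linearMap_qext _ (LinearMap.ext fun u => ?_)
    simp only [LinearMap.comp_apply, Submodule.mkQ_apply, Submodule.mapQ_apply, LinearMap.id_apply]
    rw [Submodule.Quotient.eq, hmem, hTa, inner_sub_right, inner_add_right, real_inner_smul_right,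
      inner_sph_self, hM]
    ring
  rw [h1, LinearMap.det_id, mul_one]
  congr 1
  ext u : 1
  apply Subtype.ext
  have hu := (hmem (u : E n)).1 u.2
  have h2 : M u ∈ (ℝ ∙ (x : E n))ᗮ := (hmem _).2 (hM _)
  simp only [LinearMap.restrict_apply, hTa, restrictPerp, ContinuousLinearMap.coe_coe,
    ContinuousLinearMap.comp_apply, Submodule.subtypeL_apply, hu, zero_smul, zero_add]
  exact (congrArg Subtype.val (Submodule.orthogonalProjectionOnto_mem_subspace_eq_self (⟨_, h2⟩ : (ℝ ∙ (x : E n))ᗮ))).symm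

end Operator

end ConvexStability

end

open MeasureTheory Topology
open scoped Pointwise Gradient RealInnerProductSpace

noncomputable section

namespace ConvexStability

open InnerProductSpace (rankOne)

/-! ### Determinants and mixed discriminants of restricted Hessians. -/

section Operator

variable {n : ℕ} {h f g : Sph n → ℝ}

theorem IsC2.det_D2 (hh : IsC2 h) (x : Sph n) : LinearMap.det (D2 h x) = detHess h x :=
  (det_rankOne_add_eq_det_restrictPerp x _ fun u => hh.inner_hess_self (sph_ne_zero x) u).symm

theorem restrictPerp_add_smul (ν : E n) (A B : E n →L[ℝ] E n) (t : ℝ) :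
    restrictPerp ν (A + t • B) = restrictPerp ν A + t • restrictPerp ν B := by
  ext u
  simp [restrictPerp]

theorem IsPosC2.det_extHess_add (hh : IsPosC2 h) (x : Sph n) (B : E n →L[ℝ] E n) (t : ℝ) :
    LinearMap.det ((extHess h x + t • B : E n →L[ℝ] E n) : E n →ₗ[ℝ] E n) =
      detHess h x * (detPoly ((extHessInv h x * B : E n →L[ℝ] E n) : E n →ₗ[ℝ] E n)).eval t := by
  rw [eval_detPoly, detHess, ← map_mul]
  congr 1
  have : extHess h x + t • B = extHess h x * (1 + t • (extHessInv h x * B)) := by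
    ext1 u
    simp [hh.extHess_extHessInv]
  rw [this]
  rfl

theorem IsPosC2.det_D2_add (hh : IsPosC2 h) (hf : IsC2 f) (x : Sph n) (t : ℝ) :
    LinearMap.det (D2 h x + t • D2 f x) =
      detHess h x * (detPoly (relHess h f x : E n →ₗ[ℝ] E n)).eval t := by
  rw [relHess, ← hh.det_extHess_add, D2, D2, ← restrictPerp_add_smul,
    ← det_rankOne_add_eq_det_restrictPerp, extHess, add_assoc]
  intro u
  rw [add_apply, smul_apply, inner_add_right, real_inner_smul_right,
    hh.isC2.inner_hess_self (sph_ne_zero x), hf.inner_hess_self (sph_ne_zero x)]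
  ring

/-- The segment from the identity to `extHess h x` consists of positive definite operators, so the
determinant keeps the sign it has at the identity. -/
theorem IsPosC2.detHess_pos (hh : IsPosC2 h) (x : Sph n) : 0 < detHess h x := by
  have hne : ∀ s ∈ Set.Icc (0 : ℝ) 1,
      LinearMap.det ((1 - s) • (1 : E n →ₗ[ℝ] E n) + s • (extHess h x : E n →ₗ[ℝ] E n)) ≠ 0 := by
    intro s hs h0
    obtain ⟨u, hu, hu0⟩ := Submodule.exists_mem_ne_zero_of_ne_bot
      (LinearMap.bot_lt_ker_of_det_eq_zero h0).ne'
    have h1 : (1 - s) • u + s • extHess h x u = 0 := by simpa using hu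
    have h2 := congrArg (fun v => ⟪v, u⟫) h1
    simp only [inner_add_left, real_inner_smul_left, inner_zero_left] at h2
    have h3 := hh.extHess_pos x hu0
    have h4 : 0 < ⟪u, u⟫ := real_inner_self_pos.2 hu0
    have := hs.1
    have := hs.2
    rcases eq_or_lt_of_le hs.1 with h5 | h5
    · rw [← h5] at h2
      linarith
    · nlinarith [mul_pos h5 h3, mul_nonneg (sub_nonneg.2 hs.2) h4.le]
  have hcont : Continuous fun s : ℝ =>
      LinearMap.det ((1 - s) • (1 : E n →ₗ[ℝ] E n) + s • (extHess h x : E n →ₗ[ℝ] E n)) := by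
    have : Continuous fun s : ℝ => ((1 - s) • (1 : E n →L[ℝ] E n) + s • extHess h x).det :=
      ContinuousLinearMap.continuous_det.comp (by fun_prop)
    exact this
  by_contra hneg
  have h01 : (0 : ℝ) ∈ Set.Icc
      (LinearMap.det ((1 - 1 : ℝ) • (1 : E n →ₗ[ℝ] E n) + (1 : ℝ) • (extHess h x : E n →ₗ[ℝ] E n)))
      (LinearMap.det ((1 - 0 : ℝ) • (1 : E n →ₗ[ℝ] E n) +
        (0 : ℝ) • (extHess h x : E n →ₗ[ℝ] E n))) := by
    simp only [one_smul, sub_self, zero_smul, zero_add, sub_zero, add_zero, Set.mem_Icc, map_one]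
    exact ⟨not_lt.1 hneg, zero_le_one⟩
  obtain ⟨s, hs, hs0⟩ := intermediate_value_Icc' zero_le_one hcont.continuousOn h01
  exact hne s hs hs0

theorem finrank_orthogonal_sph {m : ℕ} (x : Sph (m + 1)) :
    Module.finrank ℝ (ℝ ∙ (x : E (m + 1)))ᗮ = m := by
  have : Fact (Module.finrank ℝ (E (m + 1)) = m + 1) := ⟨by simp⟩
  exact Submodule.finrank_orthogonal_span_singleton (sph_ne_zero x)

/-- Mixed discriminants of copies of `D²f` and `D²h` are coefficients of
`det D²h * det (1 + t (D²h)⁻¹ D²f)`. -/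
theorem IsPosC2.choose_mul_mixedDiscTangent {m : ℕ} {h f : Sph (m + 1) → ℝ} (hh : IsPosC2 h)
    (hf : IsC2 f) (x : Sph (m + 1)) (s : Finset (Fin m)) :
    (m.choose s.card : ℝ) * mixedDiscTangent x (fun i => if i ∈ s then D2 f x else D2 h x) =
      detHess h x * (detPoly (relHess h f x : E (m + 1) →ₗ[ℝ] E (m + 1))).coeff s.card := by
  rw [← Polynomial.coeff_C_mul]
  set b := (stdOrthonormalBasis ℝ (ℝ ∙ (x : E (m + 1)))ᗮ).toBasis
  rw [coeff_eq_choose_mul_mixedDisc (m := m) (by rw [Fintype.card_fin, finrank_orthogonal_sph x])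
    (LinearMap.toMatrix b b (D2 f x)) (LinearMap.toMatrix b b (D2 h x)) _ _ s]
  · congr 1
    unfold mixedDiscTangent
    congr 1
    ext1 i
    by_cases hi : i ∈ s
    · simp only [hi, if_true]; rfl
    · simp only [hi, if_false]; rfl
  · intro t
    rw [Polynomial.eval_mul, Polynomial.eval_C, ← hh.det_D2_add hf, ← LinearMap.det_toMatrix b,
      map_add, map_smul]

theorem IsPosC2.mixedDiscTangent_const {m : ℕ} {h : Sph (m + 1) → ℝ} (hh : IsPosC2 h)
    (x : Sph (m + 1)) : mixedDiscTangent x (fun _ : Fin m => D2 h x) = detHess h x := by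
  have := hh.choose_mul_mixedDiscTangent hh.isC2 x ∅
  rw [Finset.card_empty, coeff_zero_detPoly] at this
  simpa using this

theorem IsPosC2.mixedDiscTangent_one {m : ℕ} {h f : Sph (m + 1) → ℝ} (hh : IsPosC2 h)
    (hf : IsC2 f) (x : Sph (m + 1)) {s : Finset (Fin m)} (hs : s.card = 1) (hm : m ≠ 0) :
    mixedDiscTangent x (fun i => if i ∈ s then D2 f x else D2 h x) =
      detHess h x * relTrace h f x / m := by
  have := hh.choose_mul_mixedDiscTangent hf x s
  rw [hs, coeff_one_detPoly, Nat.choose_one_right] at this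
  have hm' : (m : ℝ) ≠ 0 := Nat.cast_ne_zero.2 hm
  rw [relTrace, ← this]
  field_simp

/-! ### The radial field `y ↦ |y| ∇H(y)` -/

theorem hasFDerivAt_norm_smul {r : ℝ} (hr : 0 < r) (x : Sph n) :
    HasFDerivAt (fun y : E n => ‖y‖) (innerSL ℝ (x : E n)) (r • (x : E n)) := by
  have h1 : HasFDerivAt (fun y : E n => ‖y‖ ^ 2) (2 • innerSL ℝ (r • (x : E n)))
      (r • (x : E n)) := (hasStrictFDerivAt_norm_sq _).hasFDerivAt
  have hnr : ‖r • (x : E n)‖ = r := by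
    rw [norm_smul, norm_sph x, mul_one, Real.norm_of_nonneg hr.le]
  have h2 := h1.sqrt (by rw [hnr]; positivity)
  simp only [Real.sqrt_sq (norm_nonneg _), hnr] at h2
  have h3 : (1 / (2 * r)) • 2 • innerSL ℝ (r • (x : E n)) = innerSL ℝ (x : E n) := by
    ext v
    simp
    field_simp
  rw [Real.sqrt_sq hr.le, h3] at h2
  exact h2

/-- The shear `1 + (∇H - x) ⊗ x`. -/
def gradShear (h : Sph n → ℝ) (x : Sph n) : E n →L[ℝ] E n :=
  1 + rankOne ℝ (∇ (homExt h) (x : E n) - (x : E n)) (x : E n)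

/-- The inverse of the shear `1 + (∇H - x) ⊗ x`. -/
def gradShearInv (h : Sph n → ℝ) (x : Sph n) : E n →L[ℝ] E n :=
  1 - (h x)⁻¹ • rankOne ℝ (∇ (homExt h) (x : E n) - (x : E n)) (x : E n)

theorem IsC2.inner_gradient_sph (hh : IsC2 h) (x : Sph n) :
    ⟪(x : E n), ∇ (homExt h) (x : E n)⟫ = h x := by
  rw [real_inner_comm, hh.inner_gradient_self (sph_ne_zero x), homExt_coe]

/-- The shear is a transvection, with determinant `1 + ⟨x, ∇H - x⟩`, and `⟨x, ∇H⟩ = h` by Euler's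
identity. -/
theorem det_gradShear (hh : IsC2 h) (x : Sph n) :
    LinearMap.det (gradShear h x : E n →ₗ[ℝ] E n) = h x := by
  have : (gradShear h x : E n →ₗ[ℝ] E n) =
      LinearMap.transvection (innerₛₗ ℝ (x : E n)) (∇ (homExt h) (x : E n) - (x : E n)) := by
    ext1 u
    simp [gradShear, LinearMap.transvection, smul_sub]
  rw [this, LinearMap.transvection.det, innerₛₗ_apply_apply, inner_sub_right,
    hh.inner_gradient_sph, inner_sph_self]
  ring

theorem IsPosC2.gradShear_mul_inv (hh : IsPosC2 h) (x : Sph n) :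
    gradShear h x * gradShearInv h x = 1 := by
  have h0 := (hh.pos x).ne'
  ext1 u
  simp only [gradShear, gradShearInv, mul_apply_eq_comp, add_apply,
    one_apply_eq_self, sub_apply, smul_apply, InnerProductSpace.rankOne_apply,
    inner_sub_right, real_inner_smul_right, hh.isC2.inner_gradient_sph, inner_sph_self]
  match_scalars <;> field_simp <;> ring

/-- The radial field `y ↦ |y| ∇H(y)`. -/
def radialField (h : Sph n → ℝ) (y : E n) : E n := ‖y‖ • ∇ (homExt h) y

theorem IsC2.contDiffOn_radialField (hh : IsC2 h) : ContDiffOn ℝ 1 (radialField h) {0}ᶜ :=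
  contDiffOn_norm_compl.smul hh.contDiffOn_gradient

theorem IsC2.hasFDerivAt_radialField (hh : IsC2 h) {r : ℝ} (hr : 0 < r) (x : Sph n) :
    HasFDerivAt (radialField h)
      (rankOne ℝ (∇ (homExt h) (x : E n)) (x : E n) + hess (homExt h) (x : E n))
      (r • (x : E n)) := by
  have hne : r • (x : E n) ≠ 0 := smul_ne_zero hr.ne' (sph_ne_zero x)
  have h1 := (hasFDerivAt_norm_smul hr x).smul (hh.hasFDerivAt_gradient hne)
  rw [hh.hess_smul hr (sph_ne_zero x), hh.gradient_smul hr (sph_ne_zero x), norm_smul, norm_sph x,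
    Real.norm_of_nonneg hr.le, mul_one, smul_smul, mul_inv_cancel₀ hr.ne', one_smul, add_comm] at h1
  exact h1

/-- The factorization rests on `⟨x, Hess u⟩ = 0`. It makes the Jacobian of `|y| ∇H` equal to `h det
D²h`, the density of the cone-volume measure up to `1/n`, and gives its inverse explicitly. -/
theorem IsC2.rankOne_gradient_add_hess (hh : IsC2 h) (x : Sph n) :
    rankOne ℝ (∇ (homExt h) (x : E n)) (x : E n) + hess (homExt h) (x : E n) =
      gradShear h x * extHess h x := by
  ext1 u
  simp only [gradShear, mul_apply_eq_comp, add_apply,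
    one_apply_eq_self, InnerProductSpace.rankOne_apply, extHess_apply,
    inner_add_right, real_inner_smul_right, hh.inner_hess_self (sph_ne_zero x), inner_sph_self]
  match_scalars <;> ring

theorem IsC2.fderiv_radialField (hh : IsC2 h) {r : ℝ} (hr : 0 < r) (x : Sph n) :
    fderiv ℝ (radialField h) (r • (x : E n)) = gradShear h x * extHess h x := by
  rw [(hh.hasFDerivAt_radialField hr x).fderiv, hh.rankOne_gradient_add_hess]

theorem IsC2.det_fderiv_radialField (hh : IsC2 h) {r : ℝ} (hr : 0 < r) (x : Sph n) :
    LinearMap.det (fderiv ℝ (radialField h) (r • (x : E n)) : E n →ₗ[ℝ] E n) =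
      h x * detHess h x := by
  rw [hh.fderiv_radialField hr, detHess, ← det_gradShear hh, ← map_mul]
  rfl

theorem IsPosC2.inverse_fderiv_radialField (hh : IsPosC2 h) {r : ℝ} (hr : 0 < r) (x : Sph n) :
    fderiv ℝ (radialField h) (r • (x : E n)) * Ring.inverse
      (fderiv ℝ (radialField h) (r • (x : E n))) = 1 ∧
    Ring.inverse (fderiv ℝ (radialField h) (r • (x : E n))) =
      extHessInv h x * gradShearInv h x := by
  set T := fderiv ℝ (radialField h) (r • (x : E n)) with hT
  have h1 : T * (extHessInv h x * gradShearInv h x) = 1 := by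
    rw [hT, hh.isC2.fderiv_radialField hr, mul_assoc, ← mul_assoc (extHess h x),
      hh.mul_extHessInv, one_mul, hh.gradShear_mul_inv]
  have h3 : Function.Surjective T := fun u => ⟨(extHessInv h x * gradShearInv h x) u,
    congrArg (fun S : E n →L[ℝ] E n => S u) h1⟩
  have h4 : IsUnit T := by
    rw [ContinuousLinearMap.isUnit_iff_bijective]
    exact ⟨LinearMap.injective_iff_surjective (f := (T : E n →ₗ[ℝ] E n)) |>.2 h3, h3⟩
  refine ⟨Ring.mul_inverse_cancel _ h4, ?_⟩
  calc Ring.inverse T = Ring.inverse T * (T * (extHessInv h x * gradShearInv h x)) := by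
        rw [h1, mul_one]
    _ = _ := by rw [← mul_assoc, Ring.inverse_mul_cancel _ h4, one_mul]

/-- The component of `∇F` that is conormal to the boundary: `∇F - (f/h) ∇H`, tangent at `x`. -/
def relGrad (h f : Sph n → ℝ) (x : Sph n) : E n :=
  ∇ (homExt f) (x : E n) - (f x / h x) • ∇ (homExt h) (x : E n)

theorem IsPosC2.inner_relGrad (hh : IsPosC2 h) (hf : IsC2 f) (x : Sph n) :
    ⟪(x : E n), relGrad h f x⟫ = 0 := by
  rw [relGrad, inner_sub_right, real_inner_smul_right, hf.inner_gradient_sph,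
    hh.isC2.inner_gradient_sph]
  have := (hh.pos x).ne'
  field_simp
  ring

theorem IsPosC2.continuous_relGrad (hh : IsPosC2 h) (hf : IsC2 f) :
    Continuous (relGrad h f) :=
  hf.continuous_gradient.sub ((hf.continuous.div hh.isC2.continuous fun x => (hh.pos x).ne').smul
    hh.isC2.continuous_gradient)

theorem gradShearInv_apply_of_inner_eq_zero (x : Sph n) {u : E n} (hu : ⟪(x : E n), u⟫ = 0) :
    gradShearInv h x u = u := by
  simp [gradShearInv, hu]

theorem IsPosC2.inverse_apply_gradient (hh : IsPosC2 h) (x : Sph n) :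
    (extHessInv h x * gradShearInv h x) (∇ (homExt h) (x : E n)) = x := by
  have h1 : gradShearInv h x (∇ (homExt h) (x : E n)) = x := by
    simp only [gradShearInv, one_apply_eq_self, sub_apply,
      smul_apply, InnerProductSpace.rankOne_apply, hh.isC2.inner_gradient_sph, smul_smul]
    rw [inv_mul_cancel₀ (hh.pos x).ne', one_smul]
    abel
  rw [mul_apply_eq_comp, h1, hh.extHessInv_self]

theorem IsC2.gradShearInv_mul_hess (hf : IsC2 f) (h : Sph n → ℝ) (x : Sph n) :
    gradShearInv h x * hess (homExt f) (x : E n) = hess (homExt f) (x : E n) := by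
  ext1 u
  exact gradShearInv_apply_of_inner_eq_zero x (hf.inner_hess_self (sph_ne_zero x) u)

theorem mul_rankOne (T : E n →L[ℝ] E n) (u v : E n) : T * rankOne ℝ u v = rankOne ℝ (T u) v := by
  ext1 w
  simp

theorem trace_rankOne_coe (u v : E n) :
    LinearMap.trace ℝ (E n) (rankOne ℝ u v : E n →L[ℝ] E n) = ⟪v, u⟫ :=
  InnerProductSpace.trace_rankOne u v

theorem IsPosC2.relTrace_self (hh : IsPosC2 h) (x : Sph n) : relTrace h h x = n - 1 := by
  have : relHess h h x = 1 - rankOne ℝ (x : E n) (x : E n) := by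
    have h1 : hess (homExt h) (x : E n) = extHess h x - rankOne ℝ (x : E n) (x : E n) := by
      rw [extHess]; abel
    rw [relHess, h1, mul_sub, hh.extHessInv_mul, mul_rankOne, hh.extHessInv_self]
  rw [relTrace, this]
  have h2 : ((1 - rankOne ℝ (x : E n) (x : E n) : E n →L[ℝ] E n) : E n →ₗ[ℝ] E n) =
      (1 : E n →ₗ[ℝ] E n) - (rankOne ℝ (x : E n) (x : E n) : E n →L[ℝ] E n) := rfl
  rw [h2, map_sub, trace_rankOne_coe, inner_sph_self, LinearMap.trace_one]
  simp

end Operator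

end ConvexStability

end

open MeasureTheory Topology
open scoped Pointwise Gradient RealInnerProductSpace

noncomputable section

namespace ConvexStability

open InnerProductSpace (rankOne)

/-! ### Green's formula on the sphere from the first variation. -/

section Integrals

variable {n : ℕ}

theorem trace_smulRight_coe (φ : E n →L[ℝ] ℝ) (v : E n) :
    LinearMap.trace ℝ (E n) (φ.smulRight v : E n →L[ℝ] E n) = φ v := by
  have h1 : φ.smulRight v = rankOne ℝ v ((InnerProductSpace.toDual ℝ (E n)).symm φ) := by
    ext1 u
    simp
  rw [h1, trace_rankOne_coe, InnerProductSpace.toDual_symm_apply]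

theorem integral_pow_mul_bump_pos (n k : ℕ) (b : ContDiffBump (1 : ℝ)) (hb : b.rOut < 1 / 2)
    (hk : k ≠ 0) : 0 < ∫ r in Set.Ioi (0 : ℝ), r ^ (n - 1) * b r ^ k := by
  have hcont : Continuous fun r : ℝ => r ^ (n - 1) * b r ^ k :=
    (continuous_pow _).mul (b.continuous.pow k)
  have hcs : HasCompactSupport fun r : ℝ => r ^ (n - 1) * b r ^ k := by
    refine b.hasCompactSupport.mono fun r hr hr' => hr ?_
    simp only [hr', zero_pow hk, mul_zero]
  rw [setIntegral_pos_iff_support_of_nonneg_ae]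
  · refine lt_of_lt_of_le (Metric.measure_ball_pos volume (1 : ℝ) b.rOut_pos) (measure_mono ?_)
    intro r hr
    have h1 : b r ≠ 0 := by
      rw [← Function.mem_support, b.support_eq]; exact hr
    rw [Metric.mem_ball, Real.dist_eq, abs_lt] at hr
    have h2 : 0 < r := by linarith
    exact ⟨mul_ne_zero (pow_ne_zero _ h2.ne') (pow_ne_zero _ h1), h2⟩
  · refine (ae_restrict_mem measurableSet_Ioi).mono fun r hr => ?_
    exact mul_nonneg (pow_nonneg (le_of_lt hr) _) (pow_nonneg b.nonneg _)
  · exact (hcont.integrable_of_hasCompactSupport hcs).integrableOn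

/-- A fixed bump function around `1`. -/
def radialBump : ContDiffBump (1 : ℝ) := ⟨1 / 4, 1 / 3, by norm_num, by norm_num⟩

theorem radialBump_rOut_lt : radialBump.rOut < 1 / 2 := by norm_num [radialBump]

theorem radialBump_eq_zero {r : ℝ} (hr : r ≤ 1 / 2) : radialBump r = 0 := by
  refine radialBump.zero_of_le_dist ?_
  rw [Real.dist_eq, abs_sub_comm, abs_of_nonneg (by linarith)]
  norm_num [radialBump]
  linarith

theorem hasDerivAt_radialBump (r : ℝ) : HasDerivAt radialBump (deriv radialBump r) r :=
  ((radialBump.contDiff (n := 1)).differentiable one_ne_zero r).hasDerivAt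

theorem continuous_deriv_radialBump : Continuous (deriv radialBump) :=
  (radialBump.contDiff (n := 1)).continuous_deriv le_rfl

/-- The integral of the total derivative of `r^n b(r)²` vanishes, which trades `r b' b` for `-(n/2)
b²` under the weight `r^(n-1)`. The resulting factor `1 - n/2` becomes the `n - 2` of the Bochner
identity. -/
theorem integral_pow_mul_deriv_radialBump (hn : n ≠ 0) :
    ∫ r in Set.Ioi (0 : ℝ), r ^ (n - 1) * ((r * deriv radialBump r + radialBump r) * radialBump r) =
      (1 - n / 2) * ∫ r in Set.Ioi (0 : ℝ), r ^ (n - 1) * radialBump r ^ 2 := by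
  set b := radialBump with hbdef
  have hsub : ∀ q : ℝ → ℝ, (∀ r ≤ 0, q r = 0) → ∫ r in Set.Ioi (0 : ℝ), q r = ∫ r, q r :=
    fun q hq => setIntegral_eq_integral_of_forall_compl_eq_zero fun r hr =>
      hq r (not_lt.1 hr)
  have hb0 : ∀ r ≤ 0, b r = 0 := fun r hr => radialBump_eq_zero (by linarith)
  rw [hsub _ fun r hr => by rw [hb0 r hr]; ring, hsub _ fun r hr => by rw [hb0 r hr]; ring]
  have hcs : ∀ q : ℝ → ℝ, Continuous q → Integrable fun r => q r * b r := fun q hq =>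
    (hq.mul b.continuous).integrable_of_hasCompactSupport b.hasCompactSupport.mul_left
  have hder : ∀ r : ℝ, HasDerivAt (fun r => r ^ n * b r ^ 2)
      (((n : ℝ) * r ^ (n - 1) * b r + 2 * r ^ n * deriv b r) * b r) r := by
    intro r
    have := (hasDerivAt_pow n r).mul ((hasDerivAt_radialBump r).pow 2)
    refine this.congr_deriv ?_
    simp only [Pi.pow_apply, ← hbdef]
    push_cast
    ring
  have h0 := integral_eq_zero_of_hasDerivAt_of_integrable hder
    (hcs _ (by have := continuous_deriv_radialBump; have := b.continuous; fun_prop))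
    (by
      have := hcs (fun r => r ^ n * b r) (by have := b.continuous; fun_prop)
      refine this.congr (ae_of_all _ fun r => ?_)
      ring)
  have hi1 := hcs (fun r => r ^ (n - 1) * b r) (by have := b.continuous; fun_prop)
  have e1 : ∀ r, r ^ (n - 1) * ((r * deriv b r + b r) * b r) =
      (1 / 2) * (((n : ℝ) * r ^ (n - 1) * b r + 2 * r ^ n * deriv b r) * b r) +
        (1 - n / 2) * (r ^ (n - 1) * b r ^ 2) := by
    intro r
    have : r ^ n = r ^ (n - 1) * r := by rw [← pow_succ, Nat.sub_add_cancel (Nat.pos_of_ne_zero hn)]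
    rw [this]
    ring
  simp_rw [e1]
  rw [integral_add, integral_const_mul, h0, mul_zero, zero_add, integral_const_mul]
  · exact (hcs _ (by have := continuous_deriv_radialBump; have := b.continuous; fun_prop)).const_mul _
  · refine Integrable.const_mul (hi1.congr (ae_of_all _ fun r => ?_)) _
    ring

theorem integrable_radial_mul {k : ℝ → ℝ} (hk : Continuous k) (h0 : ∀ r ≤ 1 / 2, k r = 0)
    (hR : ∀ r ≥ 2, k r = 0) {w : Sph n → ℝ} (hw : Continuous w) :
    Integrable fun y : E n => k ‖y‖ * (‖y‖⁻¹ * homExt w y) := by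
  refine Continuous.integrable_of_hasCompactSupport ?_ ?_
  · rw [continuous_iff_continuousAt]
    intro y
    by_cases hy : y = 0
    · refine (continuousAt_const (y := (0 : ℝ))).congr ?_
      filter_upwards [Metric.ball_mem_nhds y (by norm_num : (0 : ℝ) < 1 / 2)] with u hu
      rw [hy, mem_ball_zero_iff] at hu
      rw [h0 _ hu.le, zero_mul]
    · exact (hk.comp continuous_norm).continuousAt.mul
        ((continuous_norm.continuousAt.inv₀ (norm_ne_zero_iff.2 hy)).mul
          ((continuousOn_homExt hw).continuousAt (isOpen_compl_singleton.mem_nhds hy)))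
  · refine HasCompactSupport.intro (isCompact_closedBall (0 : E n) 2) fun y hy => ?_
    rw [mem_closedBall_zero_iff, not_le] at hy
    rw [hR _ hy.le, zero_mul]

theorem integrable_sph {w : Sph n → ℝ} (hw : Continuous w) :
    Integrable w (sphMeasure n) :=
  hw.integrable_of_hasCompactSupport (HasCompactSupport.of_compactSpace w)

variable {h f g : Sph n → ℝ}

/-- Differentiate `|y| G = Q H`, where `G`, `Q`, `H` extend `g`, `g / h`, `h`; the derivative of
`|y|` drops out in tangential directions. -/
theorem IsPosC2.inner_gradient_div (hh : IsPosC2 h) (hg : IsC2 g) (x : Sph n) {v : E n}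
    (hv : ⟪(x : E n), v⟫ = 0) :
    ⟪∇ (homExt fun x => g x / h x) (x : E n), v⟫ = (h x)⁻¹ * ⟪relGrad h g x, v⟫ := by
  have hx := sph_ne_zero x
  have hq : IsC2 fun x => g x / h x := hg.div hh.isC2 hh.pos
  have hh0 := (hh.pos x).ne'
  have h0 := hasFDerivAt_norm_smul one_pos x
  rw [one_smul] at h0
  have h1 := h0.mul (hg.differentiableAt hx).hasFDerivAt
  have h2 := (hq.differentiableAt hx).hasFDerivAt.mul (hh.isC2.differentiableAt hx).hasFDerivAt
  have h3 : (norm * homExt g : E n → ℝ) =ᶠ[𝓝 (x : E n)]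
      (homExt (fun x => g x / h x) * homExt h : E n → ℝ) := by
    filter_upwards [isOpen_compl_singleton.mem_nhds hx] with y hy
    simp only [Pi.mul_apply]
    rw [homExt_div]
    have := (homExt_pos hh.pos hy).ne'
    field_simp
  have h4 := congrArg (fun L : E n →L[ℝ] ℝ => L v) (h1.unique (h2.congr_of_eventuallyEq h3))
  simp only [add_apply, smul_apply, ← inner_gradient, norm_sph, innerSL_apply_apply, hv,
    smul_eq_mul, one_mul, mul_zero, add_zero, homExt_coe] at h4
  rw [relGrad, inner_sub_left, real_inner_smul_left, h4]
  field_simp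
  ring

/-- The integration by parts formula for the operator `f ↦ det D²h tr ((D²h)⁻¹ D²f)`. -/
theorem IsPosC2.integral_green (hn : n ≠ 0) (hh : IsPosC2 h) (hf : IsC2 f) (hg : IsC2 g) :
    ∫ x, detHess h x * (g x * (relTrace h f x - (n - 1) * (f x / h x)) +
      ⟪relGrad h g x, extHessInv h x (relGrad h f x)⟫) ∂(sphMeasure n) = 0 := by
  have : Nontrivial (E n) := by
    have : Nonempty (Fin n) := ⟨⟨0, Nat.pos_of_ne_zero hn⟩⟩
    infer_instance
  set q : Sph n → ℝ := fun x => g x / h x with hqdef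
  have hq : IsC2 q := hg.div hh.isC2 hh.pos
  set G : E n → E n := fun y => ∇ (homExt f) y - (homExt f y / homExt h y) • ∇ (homExt h) y
  have hHne : ∀ y ∈ ({0}ᶜ : Set (E n)), homExt h y ≠ 0 := fun y hy => (homExt_pos hh.pos hy).ne'
  have hquot : ContDiffOn ℝ 1 (fun y => homExt f y / homExt h y) {0}ᶜ :=
    (ContDiffOn.div hf hh.isC2 hHne).of_le (by norm_num)
  have hG : ContDiffOn ℝ 1 G {0}ᶜ :=
    hf.contDiffOn_gradient.sub (hquot.smul hh.isC2.contDiffOn_gradient)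
  -- The variation field is `Q G`, with `Q` the `1`-homogeneous extension of `g / h` and `G = ∇F -
  -- (F/H) ∇H` homogeneous of degree 0 and tangential on the sphere.
  have hΨ : ContDiffOn ℝ 1 (fun y => homExt q y • G y) {0}ᶜ :=
    (ContDiffOn.of_le hq (by norm_num)).smul hG
  have key := integral_radial_variation_eq_zero hh.isC2.contDiffOn_radialField hΨ radialBump
    radialBump_rOut_lt
    (fun y => ((Ring.inverse (fderiv ℝ (radialField h) y) : E n →L[ℝ] E n) : E n →ₗ[ℝ] E n))
    (fun y hy => by
      obtain ⟨x, hx⟩ := exists_smul_sph hy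
      have := (hh.inverse_fderiv_radialField (norm_pos_iff.2 hy) x).1
      rw [← hx] at this
      exact congrArg (fun T : E n →L[ℝ] E n => (T : E n →ₗ[ℝ] E n)) this) 1 one_ne_zero
  rw [integral_polar hn radialBump (fun x => detHess h x *
    (g x * (relTrace h f x - (n - 1) * (f x / h x)) +
      ⟪relGrad h g x, extHessInv h x (relGrad h f x)⟫))] at key
  · refine (mul_eq_zero.1 key).resolve_left ?_
    have := integral_pow_mul_bump_pos n 1 radialBump radialBump_rOut_lt one_ne_zero
    simp only [pow_one] at this
    exact this.ne'
  intro r hr x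
  have hx := sph_ne_zero x
  have hrx : r • (x : E n) ≠ 0 := smul_ne_zero hr.ne' hx
  have hh0 := (hh.pos x).ne'
  set φ := fderiv ℝ (fun y => homExt f y / homExt h y) (r • (x : E n)) with hφ
  have hφd : HasFDerivAt (fun y => homExt f y / homExt h y) φ (r • (x : E n)) :=
    ((hquot.contDiffAt (isOpen_compl_singleton.mem_nhds hrx)).differentiableAt
      one_ne_zero).hasFDerivAt
  -- `F / H` is constant along rays, so its derivative has no radial component; this removes the
  -- trace of the term containing `∇H`.
  have hφx : φ x = 0 := by
    have h0 : HasDerivAt (fun s : ℝ => s • (x : E n)) x r := by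
      simpa using (hasDerivAt_id r).smul_const (x : E n)
    have h1 := hφd.comp_hasDerivAt r h0
    refine h1.unique ((hasDerivAt_const r (f x / h x)).congr_of_eventuallyEq ?_)
    filter_upwards [lt_mem_nhds hr] with s hs
    simp only [Function.comp_apply, homExt_smul_coe _ hs]
    rw [mul_div_mul_left _ _ hs.ne']
  have hGd : HasFDerivAt G (r⁻¹ • hess (homExt f) (x : E n) -
      ((f x / h x) • r⁻¹ • hess (homExt h) (x : E n) + φ.smulRight (∇ (homExt h) (x : E n))))
      (r • (x : E n)) := by
    have := (hf.hasFDerivAt_gradient hrx).sub (hφd.smul (hh.isC2.hasFDerivAt_gradient hrx))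
    rw [hf.hess_smul hr hx, hh.isC2.hess_smul hr hx, hh.isC2.gradient_smul hr hx,
      homExt_smul_coe _ hr, homExt_smul_coe _ hr, mul_div_mul_left _ _ hr.ne'] at this
    exact this
  have hGx : G (r • (x : E n)) = relGrad h f x := by
    simp only [G, relGrad]
    rw [hf.gradient_smul hr hx, hh.isC2.gradient_smul hr hx, homExt_smul_coe _ hr,
      homExt_smul_coe _ hr, mul_div_mul_left _ _ hr.ne']
  have hnr : ‖r • (x : E n)‖ = r := by
    rw [norm_smul, norm_sph x, mul_one, Real.norm_of_nonneg hr.le]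
  have hu : HasFDerivAt (fun y => radialBump ‖y‖ * homExt q y)
      (radialBump r • innerSL ℝ (∇ (homExt q) (x : E n)) +
        (r * q x) • (deriv radialBump r • innerSL ℝ (x : E n))) (r • (x : E n)) := by
    have h1 : HasDerivAt radialBump (deriv radialBump r) ‖r • (x : E n)‖ := by
      rw [hnr]; exact hasDerivAt_radialBump r
    have h2 := (h1.comp_hasFDerivAt (r • (x : E n)) (hasFDerivAt_norm_smul hr x)).mul
      (hq.differentiableAt hrx).hasFDerivAt
    have h3 : fderiv ℝ (homExt q) (r • (x : E n)) = innerSL ℝ (∇ (homExt q) (x : E n)) := by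
      ext1 v
      rw [← inner_gradient, hq.gradient_smul hr hx, innerSL_apply_apply]
    rw [h3, homExt_smul_coe _ hr] at h2
    simp only [Function.comp_apply, hnr] at h2
    exact h2
  have hΨe : (fun y => radialBump ‖y‖ • homExt q y • G y) =
      (fun y => radialBump ‖y‖ * homExt q y) • G := by
    funext y
    simp [mul_smul]
  have hΨd := (hu.smul hGd).fderiv
  rw [← hΨe] at hΨd
  obtain ⟨-, hinv⟩ := hh.inverse_fderiv_radialField hr x
  rw [coeff_one_detPoly, hh.isC2.det_fderiv_radialField hr, hΨd, hinv, hnr, homExt_smul_coe _ hr,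
    hGx]
  set B := extHessInv h x * gradShearInv h x with hB
  have hBf : B * hess (homExt f) (x : E n) = relHess h f x := by
    rw [hB, mul_assoc, hf.gradShearInv_mul_hess, relHess]
  have hBh : B * hess (homExt h) (x : E n) = relHess h h x := by
    rw [hB, mul_assoc, hh.isC2.gradShearInv_mul_hess, relHess]
  have hBG : B (relGrad h f x) = extHessInv h x (relGrad h f x) := by
    rw [hB, mul_apply_eq_comp, gradShearInv_apply_of_inner_eq_zero x (hh.inner_relGrad hf x)]
  have hBs : ∀ (ψ : E n →L[ℝ] ℝ) (v : E n), B * ψ.smulRight v = ψ.smulRight (B v) := by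
    intro ψ v
    ext1 u
    simp
  have hop : B * ((radialBump r * (r * q x)) • (r⁻¹ • hess (homExt f) (x : E n) -
      ((f x / h x) • r⁻¹ • hess (homExt h) (x : E n) + φ.smulRight (∇ (homExt h) (x : E n)))) +
      (radialBump r • innerSL ℝ (∇ (homExt q) (x : E n)) +
        (r * q x) • (deriv radialBump r • innerSL ℝ (x : E n))).smulRight (relGrad h f x)) =
      (radialBump r * (r * q x)) • (r⁻¹ • relHess h f x -
      ((f x / h x) • r⁻¹ • relHess h h x + φ.smulRight (x : E n))) +
      (radialBump r • innerSL ℝ (∇ (homExt q) (x : E n)) +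
        (r * q x) • (deriv radialBump r • innerSL ℝ (x : E n))).smulRight
          (extHessInv h x (relGrad h f x)) := by
    rw [mul_add, hBs, hBG, ← hBf, ← hBh]
    congr 1
    ext1 u
    simp only [mul_apply_eq_comp, smul_apply, sub_apply, add_apply, map_smul, map_sub, map_add,
      ContinuousLinearMap.smulRight_apply]
    rw [hB, hh.inverse_apply_gradient]
  have htr : ∀ T : E n →L[ℝ] E n, LinearMap.trace ℝ (E n) ((B : E n →ₗ[ℝ] E n) * (T : E n →ₗ[ℝ] E n))
      = LinearMap.trace ℝ (E n) ((B * T : E n →L[ℝ] E n) : E n →ₗ[ℝ] E n) := fun T => rfl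
  rw [htr, hop]
  simp only [ContinuousLinearMap.toLinearMap_add, ContinuousLinearMap.toLinearMap_smul,
    ContinuousLinearMap.toLinearMap_sub, map_add, map_smul, map_sub, trace_smulRight_coe, hφx]
  rw [← relTrace, ← relTrace, hh.relTrace_self]
  -- Tangentiality of the field eliminates the derivative of the cutoff, so that only `b` itself
  -- remains as radial factor.
  have hxG : ⟪(x : E n), extHessInv h x (relGrad h f x)⟫ = 0 := by
    rw [hh.inner_extHessInv, hh.inner_relGrad hf]
  simp only [add_apply, smul_apply, innerSL_apply_apply, hxG, hh.inner_gradient_div hg x hxG,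
    smul_eq_mul, hqdef]
  field_simp
  ring

end Integrals

end ConvexStability

end

open MeasureTheory Topology
open scoped Pointwise Gradient RealInnerProductSpace

noncomputable section

namespace ConvexStability

open InnerProductSpace (rankOne)

/-! ### The second variation, and inequalities between traces and norms. -/

section Bochner

variable {n : ℕ} {h f g : Sph n → ℝ}

/-- The trace of the square of the relative Hessian. -/
def relTraceSq (h f : Sph n → ℝ) (x : Sph n) : ℝ :=
  LinearMap.trace ℝ (E n) ((relHess h f x * relHess h f x : E n →L[ℝ] E n) : E n →ₗ[ℝ] E n)

theorem IsPosC2.continuous_relTraceSq (hh : IsPosC2 h) (hf : IsC2 f) :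
    Continuous (relTraceSq h f) :=
  continuous_trace.comp ((hh.continuous_relHess hf).mul (hh.continuous_relHess hf))

theorem IsPosC2.inner_relHess (hh : IsPosC2 h) (hf : IsC2 f) (x : Sph n) (u : E n) :
    ⟪(x : E n), relHess h f x u⟫ = 0 := by
  rw [relHess, mul_apply_eq_comp, hh.inner_extHessInv, hf.inner_hess_self (sph_ne_zero x)]

theorem IsC2.relHess_apply_self (hf : IsC2 f) (h : Sph n → ℝ) (x : Sph n) :
    relHess h f x (x : E n) = 0 := by
  rw [relHess, mul_apply_eq_comp, hf.hess_self (sph_ne_zero x), map_zero]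

theorem IsPosC2.relHess_self (hh : IsPosC2 h) (x : Sph n) :
    relHess h h x = 1 - rankOne ℝ (x : E n) (x : E n) := by
  have h1 : hess (homExt h) (x : E n) = extHess h x - rankOne ℝ (x : E n) (x : E n) := by
    rw [extHess]; abel
  rw [relHess, h1, mul_sub, hh.extHessInv_mul, mul_rankOne, hh.extHessInv_self]

/-- The second order integral identity for the relative Hessian. -/
theorem IsPosC2.integral_relTrace_sq_sub (hn : n ≠ 0) (hh : IsPosC2 h) (hf : IsC2 f) :
    ∫ x, h x * detHess h x * (relTrace h f x ^ 2 - relTraceSq h f x) ∂(sphMeasure n) =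
      (n - 2) * ∫ x, f x * detHess h x * relTrace h f x ∂(sphMeasure n) := by
  have : Nontrivial (E n) := by
    have : Nonempty (Fin n) := ⟨⟨0, Nat.pos_of_ne_zero hn⟩⟩
    infer_instance
  -- The second variation of the null Lagrangian at `|y| ∇H` in the direction of the cut-off field
  -- `b(|y|) |y| ∇F`.
  have key := integral_radial_variation_eq_zero hh.isC2.contDiffOn_radialField
    hf.contDiffOn_radialField radialBump radialBump_rOut_lt
    (fun y => ((Ring.inverse (fderiv ℝ (radialField h) y) : E n →L[ℝ] E n) : E n →ₗ[ℝ] E n))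
    (fun y hy => by
      obtain ⟨x, hx⟩ := exists_smul_sph hy
      have := (hh.inverse_fderiv_radialField (norm_pos_iff.2 hy) x).1
      rw [← hx] at this
      exact congrArg (fun T : E n →L[ℝ] E n => (T : E n →ₗ[ℝ] E n)) this) 2 two_ne_zero
  set c : ℝ → ℝ := fun r => (r * deriv radialBump r + radialBump r) * radialBump r with hc
  set w1 : Sph n → ℝ := fun x => f x * detHess h x * relTrace h f x with hw1
  set w2 : Sph n → ℝ := fun x => 1 / 2 *
    (h x * detHess h x * (relTrace h f x ^ 2 - relTraceSq h f x)) with hw2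
  have hpt : ∀ r > 0, ∀ x : Sph n,
      LinearMap.det (fderiv ℝ (radialField h) (r • (x : E n)) : E n →ₗ[ℝ] E n) *
        (detPoly (((Ring.inverse (fderiv ℝ (radialField h) (r • (x : E n))) : E n →L[ℝ] E n) :
            E n →ₗ[ℝ] E n) *
          (fderiv ℝ (fun y => radialBump ‖y‖ • radialField f y) (r • (x : E n)) :
            E n →ₗ[ℝ] E n))).coeff 2 =
        c r * w1 x + radialBump r ^ 2 * w2 x := by
    intro r hr x
    have hx := sph_ne_zero x
    have hh0 := (hh.pos x).ne'
    have hnr : ‖r • (x : E n)‖ = r := by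
      rw [norm_smul, norm_sph x, mul_one, Real.norm_of_nonneg hr.le]
    have h1 : HasDerivAt radialBump (deriv radialBump r) ‖r • (x : E n)‖ := by
      rw [hnr]; exact hasDerivAt_radialBump r
    have hd := ((h1.comp_hasFDerivAt (r • (x : E n)) (hasFDerivAt_norm_smul hr x)).smul
      (hf.hasFDerivAt_radialField hr x)).fderiv
    have he : (radialBump ∘ fun y : E n => ‖y‖) • radialField f =
      fun y => radialBump ‖y‖ • radialField f y := rfl
    rw [he] at hd
    obtain ⟨-, hinv⟩ := hh.inverse_fderiv_radialField hr x
    set S := relHess h f x with hS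
    set B := extHessInv h x * gradShearInv h x with hB
    set u := B (∇ (homExt f) (x : E n)) with hu
    set a := r * deriv radialBump r + radialBump r with ha
    have hBf : B * hess (homExt f) (x : E n) = S := by
      rw [hB, mul_assoc, hf.gradShearInv_mul_hess, hS, relHess]
    -- Relative to `DΦ`, the variation is a rank-one radial operator with factor `a = r b' + b` plus
    -- `b` times the relative Hessian. In `(tr² - tr of the square) / 2` the terms in `a²` cancel,
    -- leaving `a b (f/h) tr S + b² (tr² S - tr S²) / 2`.
    have hop : B * fderiv ℝ (fun y => radialBump ‖y‖ • radialField f y) (r • (x : E n)) =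
        a • rankOne ℝ u (x : E n) + radialBump r • S := by
      rw [hd, ← hBf]
      ext1 v
      simp only [Function.comp_apply, hnr, radialField, hf.gradient_smul hr hx, mul_apply_eq_comp,
        add_apply, smul_apply, ContinuousLinearMap.smulRight_apply, innerSL_apply_apply,
        InnerProductSpace.rankOne_apply, map_add, map_smul, ← hu, smul_add, smul_smul,
        smul_eq_mul, ha]
      module
    have hxu : ⟪(x : E n), u⟫ = f x / h x := by
      rw [hu, hB, mul_apply_eq_comp, hh.inner_extHessInv, gradShearInv, sub_apply, smul_apply,
        one_apply_eq_self, InnerProductSpace.rankOne_apply, inner_sub_right,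
        real_inner_smul_right, real_inner_smul_right, inner_sub_right, inner_sph_self,
        hf.inner_gradient_sph, hh.isC2.inner_gradient_sph]
      field_simp
      ring
    have htr : ∀ T : E n →L[ℝ] E n, ((B : E n →ₗ[ℝ] E n) * (T : E n →ₗ[ℝ] E n))
        = ((B * T : E n →L[ℝ] E n) : E n →ₗ[ℝ] E n) := fun T => rfl
    have hsq : (a • rankOne ℝ u (x : E n) + radialBump r • S) *
        (a • rankOne ℝ u (x : E n) + radialBump r • S) =
        (a ^ 2 * (f x / h x)) • rankOne ℝ u (x : E n) +
          (radialBump r * a) • rankOne ℝ (S u) (x : E n) + radialBump r ^ 2 • (S * S) := by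
      ext1 v
      simp only [mul_apply_eq_comp, add_apply, smul_apply, InnerProductSpace.rankOne_apply,
        hxu, map_add, map_smul, hS, hh.inner_relHess hf]
      module
    have hmul : ∀ T : E n →L[ℝ] E n, (T : E n →ₗ[ℝ] E n) * (T : E n →ₗ[ℝ] E n) =
      ((T * T : E n →L[ℝ] E n) : E n →ₗ[ℝ] E n) := fun T => rfl
    rw [hinv, htr, hop, coeff_two_detPoly, hmul, hsq, hh.isC2.det_fderiv_radialField hr]
    simp only [ContinuousLinearMap.toLinearMap_add, ContinuousLinearMap.toLinearMap_smul,
      map_add, map_smul, trace_rankOne_coe, hxu, hS, hh.inner_relHess hf, smul_eq_mul]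
    rw [← relTrace, ← relTraceSq, hw1, hw2, hc]
    simp only [← ha]
    field_simp
    ring
  have hb := radialBump.continuous
  have hb' := continuous_deriv_radialBump
  have hdet := continuous_detHess hh.isC2
  have hT := hh.continuous_relTrace hf
  have hU := hh.continuous_relTraceSq hf
  have hfc := hf.continuous
  have hhc := hh.isC2.continuous
  have hout : ∀ r ≥ 2, radialBump r = 0 := fun r hr => radialBump.zero_of_le_dist (by
    rw [Real.dist_eq, abs_of_nonneg (by linarith)]
    norm_num [radialBump]
    linarith)
  have i1 := integrable_radial_mul (k := c) (w := w1) (by fun_prop)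
    (fun r hr => by simp [hc, radialBump_eq_zero hr])
    (fun r hr => by simp [hc, hout r hr]) (by fun_prop)
  have i2 := integrable_radial_mul (k := fun r => radialBump r ^ 2) (w := w2) (by fun_prop)
    (fun r hr => by simp [radialBump_eq_zero hr])
    (fun r hr => by simp [hout r hr]) (by fun_prop)
  have hcoe : ∀ (w : Sph n → ℝ) (r : ℝ), 0 < r → ∀ x : Sph n,
      ‖r • (x : E n)‖⁻¹ * homExt w (r • (x : E n)) = w x := by
    intro w r hr x
    rw [homExt_smul_coe _ hr, norm_smul, norm_sph x, mul_one, Real.norm_of_nonneg hr.le,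
      inv_mul_cancel_left₀ hr.ne']
  have hnr : ∀ r : ℝ, 0 < r → ∀ x : Sph n, ‖r • (x : E n)‖ = r := fun r hr x => by
    rw [norm_smul, norm_sph x, mul_one, Real.norm_of_nonneg hr.le]
  have hsum := integral_add i1 i2
  have p1 := integral_polar hn c w1 (fun y => c ‖y‖ * (‖y‖⁻¹ * homExt w1 y))
    (fun r hr x => by rw [hcoe w1 r hr x, hnr r hr x])
  have p2 := integral_polar hn (fun r => radialBump r ^ 2) w2
    (fun y => radialBump ‖y‖ ^ 2 * (‖y‖⁻¹ * homExt w2 y))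
    (fun r hr x => by rw [hcoe w2 r hr x, hnr r hr x])
  -- Both radial integrals become multiples of the same positive integral of `r^(n-1) b²`, which can
  -- then be cancelled.
  have p3 := integral_pow_mul_deriv_radialBump hn
  have hz : ∫ y : E n, (c ‖y‖ * (‖y‖⁻¹ * homExt w1 y) +
      radialBump ‖y‖ ^ 2 * (‖y‖⁻¹ * homExt w2 y)) = 0 := by
    rw [← key]
    refine integral_congr_ae ?_
    filter_upwards [compl_mem_ae_iff.2 (measure_singleton (0 : E n))] with y hy
    obtain ⟨x, hx⟩ := exists_smul_sph (y := y) hy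
    have hr : 0 < ‖y‖ := norm_pos_iff.2 hy
    have h1 := hpt ‖y‖ hr x
    have h2 := hcoe w1 ‖y‖ hr x
    have h3 := hcoe w2 ‖y‖ hr x
    rw [← hx] at h1 h2 h3
    rw [h1, h2, h3]
  rw [hz, p1, p2, p3] at hsum
  have hpos := integral_pow_mul_bump_pos n 2 radialBump radialBump_rOut_lt two_ne_zero
  set J := ∫ r in Set.Ioi (0 : ℝ), r ^ (n - 1) * radialBump r ^ 2 with hJ
  have h4 : (1 - (n : ℝ) / 2) * ∫ x, w1 x ∂(sphMeasure n) + ∫ x, w2 x ∂(sphMeasure n) = 0 := by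
    have : J * ((1 - (n : ℝ) / 2) * ∫ x, w1 x ∂(sphMeasure n) + ∫ x, w2 x ∂(sphMeasure n)) = 0 := by
      rw [hsum]; ring
    exact (mul_eq_zero.1 this).resolve_left hpos.ne'
  rw [hw2, integral_const_mul] at h4
  linarith

theorem trace_eq_sum_inner_coe (b : OrthonormalBasis (Fin n) ℝ (E n)) (T : E n →L[ℝ] E n) :
    LinearMap.trace ℝ (E n) (T : E n →ₗ[ℝ] E n) = ∑ i, ⟪b i, T (b i)⟫ := by
  rw [LinearMap.trace_eq_sum_inner (T : E n →ₗ[ℝ] E n) b]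
  rfl

/-- The operator norm is at most the Hilbert-Schmidt norm, by Cauchy-Schwarz on the coordinates. -/
theorem norm_sq_le_sum_norm_sq (b : OrthonormalBasis (Fin n) ℝ (E n)) (T : E n →L[ℝ] E n) :
    ‖T‖ ^ 2 ≤ ∑ i, ‖T (b i)‖ ^ 2 := by
  have h0 : 0 ≤ ∑ i, ‖T (b i)‖ ^ 2 := Finset.sum_nonneg fun _ _ => sq_nonneg _
  have : ‖T‖ ≤ √(∑ i, ‖T (b i)‖ ^ 2) := by
    refine T.opNorm_le_bound (Real.sqrt_nonneg _) fun v => ?_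
    calc ‖T v‖ = ‖∑ i, ⟪b i, v⟫ • T (b i)‖ := by
          conv_lhs => rw [← b.sum_repr' v, map_sum]
          simp only [map_smul]
      _ ≤ ∑ i, ‖T (b i)‖ * ‖⟪b i, v⟫‖ :=
          (norm_sum_le _ _).trans (Finset.sum_le_sum fun i _ => by rw [norm_smul, mul_comm])
      _ ≤ √(∑ i, ‖T (b i)‖ ^ 2) * √(∑ i, ‖⟪b i, v⟫‖ ^ 2) :=
          Real.sum_mul_le_sqrt_mul_sqrt _ _ _
      _ = _ := by rw [b.sum_sq_norm_inner_right, Real.sqrt_sq (norm_nonneg _)]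
  calc ‖T‖ ^ 2 ≤ √(∑ i, ‖T (b i)‖ ^ 2) ^ 2 := by gcongr
    _ = _ := Real.sq_sqrt h0

/-- For a positive definite `P ≥ c` and symmetric `R`, `tr (P R P R) ≥ c² |R|²`. -/
theorem mul_norm_sq_le_trace {P R : E n →L[ℝ] E n} {c : ℝ} (hc : 0 ≤ c)
    (hPs : ∀ u v, ⟪P u, v⟫ = ⟪u, P v⟫) (hP : ∀ u, c * ‖u‖ ^ 2 ≤ ⟪u, P u⟫)
    (hR : ∀ u v, ⟪R u, v⟫ = ⟪u, R v⟫) :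
    c ^ 2 * ‖R‖ ^ 2 ≤
      LinearMap.trace ℝ (E n) ((P * R * (P * R) : E n →L[ℝ] E n) : E n →ₗ[ℝ] E n) := by
  have hsym : (P : E n →ₗ[ℝ] E n).IsSymmetric := hPs
  have hfr : Module.finrank ℝ (E n) = n := finrank_euclideanSpace_fin
  -- In an eigenbasis of `P` with eigenvalues `μ i` the trace is `∑ μ i ⟨R (b i), P R (b i)⟩`; each
  -- of the two occurrences of `P` contributes one factor `c`.
  set b := hsym.eigenvectorBasis hfr
  set μ := hsym.eigenvalues hfr
  have hb : ∀ i, P (b i) = μ i • b i := fun i => hsym.apply_eigenvectorBasis hfr i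
  have hμ : ∀ i, c ≤ μ i := by
    intro i
    have := hP (b i)
    rw [hb, real_inner_smul_right, real_inner_self_eq_norm_sq, b.orthonormal.1 i] at this
    simpa using this
  rw [trace_eq_sum_inner_coe b]
  calc c ^ 2 * ‖R‖ ^ 2 ≤ c ^ 2 * ∑ i, ‖R (b i)‖ ^ 2 := by
        gcongr; exact norm_sq_le_sum_norm_sq b R
    _ = ∑ i, c * (c * ‖R (b i)‖ ^ 2) := by rw [Finset.mul_sum]; exact Finset.sum_congr rfl fun _ _ => by ring
    _ ≤ ∑ i, μ i * ⟪R (b i), P (R (b i))⟫ := by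
        refine Finset.sum_le_sum fun i _ => ?_
        exact mul_le_mul (hμ i) (hP _) (by positivity) (hc.trans (hμ i))
    _ = _ := by
        refine Finset.sum_congr rfl fun i _ => ?_
        simp only [mul_apply_eq_comp]
        rw [← hPs (b i), hb, real_inner_smul_left, ← hR]

/-- Cauchy-Schwarz for the `n - 1` tangential eigenvalues of the relative Hessian: subtract the mean
`t` of the eigenvalues and use that `tr (P R P R) ≥ 0` for `R = D²f - t D²h` and `P = (D²h)⁻¹`. -/
theorem IsPosC2.relTrace_sq_le (hh : IsPosC2 h) (hf : IsC2 f) (hn : 2 ≤ n) (x : Sph n) :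
    relTrace h f x ^ 2 / (n - 1) ≤ relTraceSq h f x := by
  have hn' : (2 : ℝ) ≤ n := by exact_mod_cast hn
  set t := relTrace h f x / (n - 1) with ht
  set S := relHess h f x with hS
  have hR : ∀ u v, ⟪(hess (homExt f) (x : E n) - t • hess (homExt h) (x : E n)) u, v⟫ =
      ⟪u, (hess (homExt f) (x : E n) - t • hess (homExt h) (x : E n)) v⟫ := by
    intro u v
    simp only [sub_apply, smul_apply, inner_sub_left, inner_sub_right, real_inner_smul_left,
      real_inner_smul_right, hf.hess_symm (sph_ne_zero x), hh.isC2.hess_symm (sph_ne_zero x)]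
  have h1 := mul_norm_sq_le_trace (c := 0) le_rfl (hh.extHessInv_symm x) (fun u => by
    rw [zero_mul]
    rcases eq_or_ne u 0 with rfl | hu
    · simp
    · exact (hh.extHessInv_pos x hu).le) hR
  have h2 : extHessInv h x * (hess (homExt f) (x : E n) - t • hess (homExt h) (x : E n)) =
      S - t • (1 - rankOne ℝ (x : E n) (x : E n)) := by
    rw [← hh.relHess_self, hS, relHess, relHess]
    ext1 u
    simp only [mul_apply_eq_comp, sub_apply, smul_apply, map_sub, map_smul]
  have h3 : (S - t • (1 - rankOne ℝ (x : E n) (x : E n))) *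
      (S - t • (1 - rankOne ℝ (x : E n) (x : E n))) =
      S * S - (2 * t) • S + t ^ 2 • (1 - rankOne ℝ (x : E n) (x : E n)) := by
    ext1 u
    simp only [mul_apply_eq_comp, sub_apply, smul_apply, one_apply_eq_self, add_apply,
      InnerProductSpace.rankOne_apply, map_sub, map_smul, hS, hf.relHess_apply_self, hh.inner_relHess hf, inner_sph_self]
    module
  rw [h2, h3, ← hh.relHess_self] at h1
  simp only [ContinuousLinearMap.toLinearMap_add, ContinuousLinearMap.toLinearMap_smul,
    ContinuousLinearMap.toLinearMap_sub, map_add, map_smul, map_sub, smul_eq_mul] at h1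
  rw [hS, ← relTraceSq, ← relTrace, ← relTrace, hh.relTrace_self] at h1
  have h4 : (n : ℝ) - 1 ≠ 0 := by linarith
  have h5 : 2 * t * relTrace h f x - t ^ 2 * (n - 1) = relTrace h f x ^ 2 / (n - 1) := by
    rw [ht]; field_simp; ring
  linarith

theorem nonempty_sph (hn : n ≠ 0) : Nonempty (Sph n) := by
  have : Nonempty (Fin n) := ⟨⟨0, Nat.pos_of_ne_zero hn⟩⟩
  exact (NormedSpace.sphere_nonempty (E := E n) (x := 0) (r := 1)).2 zero_le_one |>.to_subtype

/-- `extHessInv` is uniformly positive definite. -/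
theorem IsPosC2.exists_extHessInv_ge (hh : IsPosC2 h) (hn : n ≠ 0) :
    ∃ c > 0, ∀ (x : Sph n) (u : E n), c * ‖u‖ ^ 2 ≤ ⟪u, extHessInv h x u⟫ := by
  have := nonempty_sph hn
  have hcont : Continuous fun p : Sph n × Sph n => ⟪(p.2 : E n), extHessInv h p.1 (p.2 : E n)⟫ :=
    Continuous.inner (by fun_prop)
      ((hh.continuous_extHessInv.comp continuous_fst).clm_apply (by fun_prop))
  obtain ⟨p, hp⟩ := (isCompact_univ.exists_isMinOn Set.univ_nonempty hcont.continuousOn)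
  refine ⟨⟪(p.2 : E n), extHessInv h p.1 (p.2 : E n)⟫, hh.extHessInv_pos _ (sph_ne_zero _),
    fun x u => ?_⟩
  rcases eq_or_ne u 0 with rfl | hu
  · simp
  obtain ⟨y, hy⟩ := exists_smul_sph hu
  have := isMinOn_iff.1 hp.2 (x, y) (Set.mem_univ _)
  rw [hy, map_smul, real_inner_smul_left, real_inner_smul_right, ← hy]
  have h1 : ‖‖u‖ • (y : E n)‖ ^ 2 = ‖u‖ ^ 2 := by rw [← hy]
  nlinarith [sq_nonneg ‖u‖, mul_le_mul_of_nonneg_left this (sq_nonneg ‖u‖)]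

/-- The Euclidean Hessian is controlled by the trace of the square of the relative Hessian. -/
theorem IsPosC2.exists_norm_hess_sq_le (hh : IsPosC2 h) (hn : n ≠ 0) :
    ∃ C > 0, ∀ f : Sph n → ℝ, IsC2 f → ∀ x : Sph n,
      ‖hess (homExt f) (x : E n)‖ ^ 2 ≤ C * relTraceSq h f x := by
  obtain ⟨c, hc, hle⟩ := hh.exists_extHessInv_ge hn
  refine ⟨(c ^ 2)⁻¹, by positivity, fun f hf x => ?_⟩
  rw [le_inv_mul_iff₀ (by positivity)]
  exact mul_norm_sq_le_trace hc.le (hh.extHessInv_symm x) (hle x) (hf.hess_symm (sph_ne_zero x))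

end Bochner

end ConvexStability

end

open MeasureTheory Topology
open scoped Pointwise Gradient RealInnerProductSpace

noncomputable section

namespace ConvexStability

open InnerProductSpace (rankOne)

/-! ### The operator `-L` on `C²` functions: symmetry, Dirichlet form, Bochner formula. -/

section Operator

variable {n : ℕ} {h f g z w : Sph n → ℝ}

/-- The operator `-L` in terms of the relative Hessian. -/
def hbmOp (h z : Sph n → ℝ) (x : Sph n) : ℝ :=
  z x - relTrace h (fun y => z y * h y) x / (n - 1)

/-- The Dirichlet form of `hbmOp`. -/
def dirichlet (h z w : Sph n → ℝ) (x : Sph n) : ℝ :=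
  detHess h x * ⟪relGrad h (fun y => w y * h y) x,
    extHessInv h x (relGrad h (fun y => z y * h y) x)⟫

theorem IsPosC2.continuous_hbmOp (hh : IsPosC2 h) (hz : IsC2 z) : Continuous (hbmOp h z) :=
  hz.continuous.sub ((hh.continuous_relTrace (hz.mul hh.isC2)).div_const _)

theorem IsPosC2.continuous_dirichlet (hh : IsPosC2 h) (hz : IsC2 z) (hw : IsC2 w) :
    Continuous (dirichlet h z w) :=
  (continuous_detHess hh.isC2).mul ((hh.continuous_relGrad (hw.mul hh.isC2)).inner
    (hh.continuous_extHessInv.clm_apply (hh.continuous_relGrad (hz.mul hh.isC2))))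

/-- Green's formula for the pair `zh`, `wh`: its zeroth-order term `(n-1) z` is what completes the
trace to `-(n-1)` times the operator. -/
theorem IsPosC2.integral_mul_hbmOp (hn : 2 ≤ n) (hh : IsPosC2 h) (hz : IsC2 z) (hw : IsC2 w) :
    ((n : ℝ) - 1) * ∫ x, h x * detHess h x * (w x * hbmOp h z x) ∂(sphMeasure n) =
      ∫ x, dirichlet h z w x ∂(sphMeasure n) := by
  have hn' : (2 : ℝ) ≤ n := by exact_mod_cast hn
  have h1 : (n : ℝ) - 1 ≠ 0 := by linarith
  have hg := hh.integral_green (by omega) (hz.mul hh.isC2) (hw.mul hh.isC2)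
  have c1 : Continuous fun x => h x * detHess h x * (w x * hbmOp h z x) :=
    (hh.isC2.continuous.mul (continuous_detHess hh.isC2)).mul
      (hw.continuous.mul (hh.continuous_hbmOp hz))
  rw [← integral_const_mul, ← sub_eq_zero, ← integral_sub ((integrable_sph c1).const_mul _)
    (integrable_sph (hh.continuous_dirichlet hz hw)), ← neg_eq_zero, ← integral_neg, ← hg]
  refine integral_congr_ae (ae_of_all _ fun x => ?_)
  have := (hh.pos x).ne'
  simp only [hbmOp, dirichlet]
  field_simp
  ring

theorem IsPosC2.integral_mul_hbmOp_comm (hn : 2 ≤ n) (hh : IsPosC2 h) (hz : IsC2 z)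
    (hw : IsC2 w) : ∫ x, h x * detHess h x * (w x * hbmOp h z x) ∂(sphMeasure n) =
      ∫ x, h x * detHess h x * (z x * hbmOp h w x) ∂(sphMeasure n) := by
  have hn' : (2 : ℝ) ≤ n := by exact_mod_cast hn
  have h1 : (n : ℝ) - 1 ≠ 0 := by linarith
  refine mul_left_cancel₀ h1 ?_
  rw [hh.integral_mul_hbmOp hn hz hw, hh.integral_mul_hbmOp hn hw hz]
  refine integral_congr_ae (ae_of_all _ fun x => ?_)
  simp only [dirichlet]
  rw [← hh.extHessInv_symm, real_inner_comm]

theorem IsPosC2.dirichlet_self_nonneg (hh : IsPosC2 h) (z : Sph n → ℝ) (x : Sph n) :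
    0 ≤ dirichlet h z z x := by
  refine mul_nonneg (hh.detHess_pos x).le ?_
  rcases eq_or_ne (relGrad h (fun y => z y * h y) x) 0 with h0 | h0
  · rw [h0, inner_zero_left]
  · exact (hh.extHessInv_pos x h0).le

theorem IsPosC2.integral_mul_hbmOp_self_nonneg (hn : 2 ≤ n) (hh : IsPosC2 h) (hz : IsC2 z) :
    0 ≤ ∫ x, h x * detHess h x * (z x * hbmOp h z x) ∂(sphMeasure n) := by
  have hn' : (2 : ℝ) ≤ n := by exact_mod_cast hn
  have h1 : 0 < (n : ℝ) - 1 := by linarith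
  refine nonneg_of_mul_nonneg_right ?_ h1
  rw [hh.integral_mul_hbmOp hn hz hz]
  exact integral_nonneg (hh.dirichlet_self_nonneg z)

/-- The Bochner formula for `hbmOp`. -/
theorem IsPosC2.integral_bochner (hn : 2 ≤ n) (hh : IsPosC2 h) (hz : IsC2 z) :
    ∫ x, h x * detHess h x * (relTraceSq h (fun y => z y * h y) x -
        relTrace h (fun y => z y * h y) x ^ 2 / (n - 1)) ∂(sphMeasure n) =
      (n - 1) * (n - 2) * ∫ x, h x * detHess h x *
        (hbmOp h z x * hbmOp h z x - z x * hbmOp h z x) ∂(sphMeasure n) := by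
  have hn' : (2 : ℝ) ≤ n := by exact_mod_cast hn
  have h1 : (n : ℝ) - 1 ≠ 0 := by linarith
  have hf := hz.mul hh.isC2
  -- For `f = zh` the trace is `T = (n-1)(z - Az)`, with `A` denoting `hbmOp h`. Substituting it in
  -- the second-order identity gives `(n-1)(n-2) ∫ (Az)(Az - z)` after subtracting `T²/(n-1)`.
  have h2 := hh.integral_relTrace_sq_sub (by omega) hf
  have cz := hz.continuous
  have ch := hh.isC2.continuous
  have cd := continuous_detHess hh.isC2
  have cT := hh.continuous_relTrace hf
  have cU := hh.continuous_relTraceSq hf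
  have cA := hh.continuous_hbmOp hz
  have c1 : Continuous fun x => h x * detHess h x * (relTraceSq h (fun y => z y * h y) x -
    relTrace h (fun y => z y * h y) x ^ 2 / (n - 1)) := by fun_prop
  have c2 : Continuous fun x => h x * detHess h x *
    (hbmOp h z x * hbmOp h z x - z x * hbmOp h z x) := by fun_prop
  have c3 : Continuous fun x => h x * detHess h x *
    (relTrace h (fun y => z y * h y) x ^ 2 - relTraceSq h (fun y => z y * h y) x) := by fun_prop
  have c4 : Continuous fun x =>
    z x * h x * detHess h x * relTrace h (fun y => z y * h y) x := by fun_prop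
  rw [← integral_const_mul, ← sub_eq_zero, ← integral_sub (integrable_sph c1)
    ((integrable_sph c2).const_mul _)]
  rw [← integral_const_mul, ← sub_eq_zero, ← integral_sub (integrable_sph c3)
    ((integrable_sph c4).const_mul _)] at h2
  rw [← neg_eq_zero, ← integral_neg, ← h2]
  refine integral_congr_ae (ae_of_all _ fun x => ?_)
  simp only [hbmOp]
  field_simp
  ring

end Operator

end ConvexStability

end

open MeasureTheory Topology
open scoped Pointwise Gradient RealInnerProductSpace

noncomputable section

namespace ConvexStability

open InnerProductSpace (rankOne)

/-! ### Regularity of the support function of a body of class `𝒦₊²`. -/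

section SupportFunction

variable {n : ℕ} {K : ConvexBody (E n)} {φ : E n → ℝ} {p q y : E n}

theorem inner_restrictPerp (ν : E n) (A : E n →L[ℝ] E n) (u v : (ℝ ∙ ν)ᗮ) :
    ⟪(restrictPerp ν A u : E n), (v : E n)⟫ = ⟪A u, (v : E n)⟫ := by
  simp only [restrictPerp, ContinuousLinearMap.coe_coe, ContinuousLinearMap.comp_apply,
    Submodule.subtypeL_apply]
  rw [← Submodule.coe_inner, Submodule.inner_orthogonalProjectionOnto_eq_of_mem_right]

theorem contDiffAt_gradient (h : ContDiffAt ℝ 2 φ p) : ContDiffAt ℝ 1 (∇ φ) p := by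
  have h1 : ContDiffAt ℝ 1 (fderiv ℝ φ) p := h.fderiv_right (by norm_num)
  exact ((InnerProductSpace.toDual ℝ (E n)).symm.toContinuousLinearEquiv.contDiff.contDiffAt).comp
    p h1

theorem hasFDerivAt_gradient (h : ContDiffAt ℝ 2 φ p) : HasFDerivAt (∇ φ) (hess φ p) p :=
  ((contDiffAt_gradient h).differentiableAt one_ne_zero).hasFDerivAt

theorem HasFDerivAt.eventually_neg {L : E n →L[ℝ] ℝ} (h : HasFDerivAt φ L p) (h0 : φ p = 0)
    {u : E n} (hu : L u < 0) : ∀ᶠ t in 𝓝[>] (0 : ℝ), φ (p + t • u) < 0 := by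
  have hc : HasDerivAt (fun t : ℝ => p + t • u) u 0 := by
    simpa using ((hasDerivAt_id (0 : ℝ)).smul_const u).const_add p
  have h1 : HasDerivAt (fun t : ℝ => φ (p + t • u)) (L u) 0 := by
    refine HasFDerivAt.comp_hasDerivAt (0 : ℝ) ?_ hc
    simpa using h
  filter_upwards [(h1.hasDerivWithinAt (s := Set.Ioi 0)).limsup_slope_le' (by simp) hu,
    self_mem_nhdsWithin] with t ht ht0
  simp only [slope_def_field, zero_smul, add_zero, h0, sub_zero] at ht
  exact (div_neg_iff.1 ht).elim (fun h => absurd h.2 (not_lt.2 (le_of_lt ht0))) fun h => h.1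

/-- At a maximizer of a linear functional on a body given locally by `φ ≤ 0`, the functional is a
positive multiple of the gradient of `φ`. -/
theorem eq_smul_gradient_of_isMaxOn (hd : DifferentiableAt ℝ φ q) (hg : ∇ φ q ≠ 0)
    (hK : ∀ᶠ z in 𝓝 q, z ∈ K ↔ φ z ≤ 0) (hy : y ≠ 0) (hq : q ∈ K)
    (hmax : ∀ z ∈ K, ⟪y, z⟫ ≤ ⟪y, q⟫) : φ q = 0 ∧ y = (‖y‖ / ‖∇ φ q‖) • ∇ φ q := by
  have hline : ∀ u : E n, Filter.Tendsto (fun t : ℝ => q + t • u) (𝓝[>] 0) (𝓝 q) := by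
    intro u
    have : Continuous fun t : ℝ => q + t • u := by fun_prop
    have h := this.tendsto 0
    rw [zero_smul, add_zero] at h
    exact h.mono_left nhdsWithin_le_nhds
  have hkey : ∀ u : E n, (∀ᶠ t in 𝓝[>] (0 : ℝ), φ (q + t • u) < 0) → ⟪y, u⟫ ≤ 0 := by
    intro u hu
    obtain ⟨t, ht1, ht2, ht3⟩ := (hu.and (((hline u).eventually hK).and self_mem_nhdsWithin)).exists
    have h1 := hmax _ (ht2.2 ht1.le)
    rw [inner_add_right, real_inner_smul_right] at h1
    have ht : 0 < t := ht3
    by_contra! h2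
    nlinarith [mul_pos ht h2]
  have h0 : φ q = 0 := by
    refine le_antisymm (hK.self_of_nhds.1 hq) ?_
    by_contra! hneg
    have h1 : ∀ᶠ z in 𝓝 q, φ z < 0 := hd.continuousAt.eventually_lt_const hneg
    have h2 := hkey y ((hline y).eventually h1)
    exact absurd h2 (not_le.2 (real_inner_self_pos.2 hy))
  refine ⟨h0, ?_⟩
  set g := ∇ φ q with hgdef
  have hgn : 0 < ‖g‖ := norm_pos_iff.2 hg
  have hyn : 0 < ‖y‖ := norm_pos_iff.2 hy
  have hle : ‖g‖ * ‖y‖ ≤ ⟪g, y⟫ := by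
    by_contra! hlt
    -- If `y` and `g` were not parallel, this `u` would satisfy `⟨g,u⟩ < 0`, hence point into the
    -- body, and `⟨y,u⟩ > 0`, against maximality.
    set u := ‖y‖⁻¹ • y - ‖g‖⁻¹ • g with hu
    have h1 : ⟪g, u⟫ < 0 := by
      rw [hu, inner_sub_right, real_inner_smul_right, real_inner_smul_right,
        real_inner_self_eq_norm_sq]
      have : ‖y‖⁻¹ * ⟪g, y⟫ < ‖y‖⁻¹ * (‖g‖ * ‖y‖) := by gcongr
      have e1 : ‖y‖⁻¹ * (‖g‖ * ‖y‖) = ‖g‖ := by field_simp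
      have e2 : ‖g‖⁻¹ * ‖g‖ ^ 2 = ‖g‖ := by field_simp
      linarith
    have h2 : ⟪y, u⟫ ≤ 0 := by
      refine hkey u (HasFDerivAt.eventually_neg hd.hasFDerivAt h0 ?_)
      rwa [← inner_gradient]
    rw [hu, inner_sub_right, real_inner_smul_right, real_inner_smul_right,
      real_inner_self_eq_norm_sq, real_inner_comm] at h2
    have : ‖g‖⁻¹ * ⟪g, y⟫ < ‖g‖⁻¹ * (‖g‖ * ‖y‖) := by gcongr
    have e1 : ‖g‖⁻¹ * (‖g‖ * ‖y‖) = ‖y‖ := by field_simp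
    have e2 : ‖y‖⁻¹ * ‖y‖ ^ 2 = ‖y‖ := by field_simp
    linarith
  have heq := inner_eq_norm_mul_iff_real.1 (le_antisymm (real_inner_le_norm g y) hle)
  rw [div_eq_inv_mul, mul_smul, heq, smul_smul, inv_mul_cancel₀ hgn.ne', one_smul]

/-- If the form were negative on a tangent vector `u`, the curve `p + t u + ε t² ∇φ` would stay in
the body for small `t`, although it crosses the supporting hyperplane outward. -/
theorem hess_nonneg_of_inner_gradient_eq_zero (hφ : ContDiffAt ℝ 2 φ p) (h0 : φ p = 0)
    (hg : ∇ φ p ≠ 0) (hK : ∀ᶠ z in 𝓝 p, z ∈ K ↔ φ z ≤ 0)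
    (hsup : ∀ z ∈ K, ⟪∇ φ p, z - p⟫ ≤ 0) {u : E n} (hu : ⟪∇ φ p, u⟫ = 0) :
    0 ≤ ⟪hess φ p u, u⟫ := by
  by_contra! hneg
  set g := ∇ φ p with hgdef
  have hgn : 0 < ‖g‖ ^ 2 := by positivity
  -- The second derivative of `φ` along that curve at 0 is `⟨hess φ p u, u⟩ + 2 ε ‖g‖²`; this `ε`
  -- keeps half of the negative term.
  obtain ⟨ε, hε, hε2⟩ : ∃ ε > 0, ⟪hess φ p u, u⟫ + 2 * ε * ‖g‖ ^ 2 < 0 := by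
    refine ⟨-⟪hess φ p u, u⟫ / (4 * ‖g‖ ^ 2), by apply div_pos <;> linarith, ?_⟩
    have : 2 * (-⟪hess φ p u, u⟫ / (4 * ‖g‖ ^ 2)) * ‖g‖ ^ 2 = -⟪hess φ p u, u⟫ / 2 := by
      field_simp; ring
    linarith
  set c : ℝ → E n := fun t => p + (t • u + (t ^ 2 * ε) • g) with hc
  have hcd : ∀ t, HasDerivAt c (u + (2 * t * ε) • g) t := by
    intro t
    have h1 := (((hasDerivAt_id t).smul_const u).add
      ((((hasDerivAt_id t).pow 2).mul_const ε).smul_const g)).const_add p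
    convert! h1 using 1
    simp
  have hc0 : c 0 = p := by simp [hc]
  have hcc : Filter.Tendsto c (𝓝 0) (𝓝 p) := by
    have := (hcd 0).continuousAt.tendsto
    rwa [hc0] at this
  have hder : ∀ᶠ t in 𝓝 (0 : ℝ), HasDerivAt (fun t => φ (c t))
      ⟪∇ φ (c t), u + (2 * t * ε) • g⟫ t := by
    have h1 : ∀ᶠ z in 𝓝 p, DifferentiableAt ℝ φ z :=
      (hφ.eventually (by simp)).mono fun z hz => hz.differentiableAt two_ne_zero
    filter_upwards [hcc.eventually h1] with t ht
    rw [inner_gradient]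
    exact ht.hasFDerivAt.comp_hasDerivAt t (hcd t)
  have hd0 : deriv (fun t => φ (c t)) 0 = 0 := by
    rw [hder.self_of_nhds.deriv, hc0]
    simp only [mul_zero, zero_mul, zero_smul, add_zero]
    exact hu
  have hd2 : deriv (deriv fun t => φ (c t)) 0 < 0 := by
    have h1 : deriv (fun t => φ (c t)) =ᶠ[𝓝 0] fun t => ⟪∇ φ (c t), u + (2 * t * ε) • g⟫ :=
      hder.mono fun t ht => ht.deriv
    rw [h1.deriv_eq]
    have h2 : HasDerivAt (fun t => ∇ φ (c t)) (hess φ p u) 0 := by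
      have h3 := HasFDerivAt.comp_hasDerivAt (x := (0 : ℝ)) (f := c) (l := ∇ φ)
        (l' := hess φ p) (by rw [hc0]; exact hasFDerivAt_gradient hφ) (hcd 0)
      simp only [mul_zero, zero_mul, zero_smul, add_zero] at h3
      exact h3
    have h4 : HasDerivAt (fun t : ℝ => u + (2 * t * ε) • g) ((2 * ε) • g) 0 := by
      have h1 := ((((hasDerivAt_id (0 : ℝ)).const_mul 2).mul_const ε).smul_const g).const_add u
      simpa using h1
    have h5 := (h2.inner ℝ h4).deriv
    rw [h5, hc0]
    simp only [mul_zero, zero_mul, zero_smul, add_zero]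
    rw [real_inner_smul_right, real_inner_self_eq_norm_sq]
    linarith
  have hmax := isLocalMax_of_deriv_deriv_neg hd2 hd0 hder.self_of_nhds.continuousAt
  have hev : ∀ᶠ t in 𝓝[>] (0 : ℝ), False := by
    filter_upwards [nhdsWithin_le_nhds hmax, nhdsWithin_le_nhds (hcc.eventually hK),
      self_mem_nhdsWithin] with t h1 h2 h3
    have h4 := hsup _ (h2.2 (by rw [hc0, h0] at h1; exact h1))
    have ht : 0 < t := h3
    have h5 : c t - p = t • u + (t ^ 2 * ε) • g := by simp [hc]
    rw [h5, inner_add_right, real_inner_smul_right, hu, mul_zero, zero_add,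
      real_inner_smul_right, real_inner_self_eq_norm_sq] at h4
    exact absurd h4 (not_le.2 (by positivity))
  exact (hev.exists).elim fun _ h => h

/-- A null vector of a positive semidefinite form lies in its kernel; a tangential null vector would
thus make the determinant defining the curvature vanish. -/
theorem hess_pos_of_gaussCurvature_pos (hφ : ContDiffAt ℝ 2 φ p) (h0 : φ p = 0)
    (hg : ∇ φ p ≠ 0) (hK : ∀ᶠ z in 𝓝 p, z ∈ K ↔ φ z ≤ 0)
    (hsup : ∀ z ∈ K, ⟪∇ φ p, z - p⟫ ≤ 0) (hcurv : 0 < gaussCurvature φ p) {u : E n}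
    (hu : ⟪∇ φ p, u⟫ = 0) (hu0 : u ≠ 0) : 0 < ⟪hess φ p u, u⟫ := by
  have hnn : ∀ u : E n, ⟪∇ φ p, u⟫ = 0 → 0 ≤ ⟪hess φ p u, u⟫ := fun u hu =>
    hess_nonneg_of_inner_gradient_eq_zero hφ h0 hg hK hsup hu
  refine lt_of_le_of_ne (hnn u hu) fun hzero => hu0 ?_
  have hv : ∀ v : E n, ⟪∇ φ p, v⟫ = 0 → ⟪hess φ p u, v⟫ = 0 := by
    intro v hv
    have hq : ∀ t : ℝ, 0 ≤ ⟪hess φ p v, v⟫ + 2 * t * ⟪hess φ p u, v⟫ := by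
      intro t
      have := hnn (v + t • u) (by rw [inner_add_right, real_inner_smul_right, hv, hu]; ring)
      rw [map_add, map_smul, inner_add_left, inner_add_right, inner_add_right,
        real_inner_smul_left, real_inner_smul_left, real_inner_smul_right, real_inner_smul_right,
        ← hzero, hess_symm hφ v u, real_inner_comm (hess φ p u) v] at this
      linarith
    by_contra hne
    have := hq (-(⟪hess φ p v, v⟫ + 1) / (2 * ⟪hess φ p u, v⟫))
    field_simp at this
    linarith
  have hmem : ∀ v : E n, v ∈ (ℝ ∙ ∇ φ p)ᗮ ↔ ⟪∇ φ p, v⟫ = 0 := fun v =>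
    Submodule.mem_orthogonal_singleton_iff_inner_right
  set T := restrictPerp (∇ φ p) (hess φ p)
  have hT : T ⟨u, (hmem u).2 hu⟩ = 0 := by
    rw [← inner_self_eq_zero (𝕜 := ℝ), Submodule.coe_inner, inner_restrictPerp]
    exact hv _ ((hmem _).1 (T _).2)
  have hker : LinearMap.ker (‖∇ φ p‖⁻¹ • T) = ⊥ := by
    by_contra hb
    have := LinearMap.det_eq_zero_iff_ker_ne_bot.2 hb
    exact hcurv.ne' this
  have h1 := LinearMap.ker_eq_bot'.1 hker ⟨u, (hmem u).2 hu⟩ (by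
    rw [LinearMap.smul_apply, hT, smul_zero])
  exact congrArg Subtype.val h1

/-- The derivative of `(p, t) ↦ (t ∇φ p, φ p)`. -/
def gaussDeriv (φ : E n → ℝ) (p : E n) (t : ℝ) : E n × ℝ →L[ℝ] E n × ℝ :=
  (t • (hess φ p ∘L ContinuousLinearMap.fst ℝ (E n) ℝ) +
    (ContinuousLinearMap.snd ℝ (E n) ℝ).smulRight (∇ φ p)).prod
    (fderiv ℝ φ p ∘L ContinuousLinearMap.fst ℝ (E n) ℝ)

theorem gaussDeriv_apply (φ : E n → ℝ) (p : E n) (t : ℝ) (w : E n × ℝ) :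
    gaussDeriv φ p t w = (t • hess φ p w.1 + w.2 • ∇ φ p, ⟪∇ φ p, w.1⟫) := by
  rw [inner_gradient]
  simp [gaussDeriv]

theorem hasFDerivAt_gauss (hφ : ContDiffAt ℝ 2 φ p) (t : ℝ) :
    HasFDerivAt (fun w : E n × ℝ => (w.2 • ∇ φ w.1, φ w.1)) (gaussDeriv φ p t) (p, t) := by
  have h1 : HasFDerivAt (fun w : E n × ℝ => ∇ φ w.1)
      (hess φ p ∘L ContinuousLinearMap.fst ℝ (E n) ℝ) (p, t) :=
    HasFDerivAt.comp (p, t) (hasFDerivAt_gradient hφ) hasFDerivAt_fst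
  have h2 : HasFDerivAt (fun w : E n × ℝ => φ w.1)
      (fderiv ℝ φ p ∘L ContinuousLinearMap.fst ℝ (E n) ℝ) (p, t) :=
    HasFDerivAt.comp (p, t) (hφ.differentiableAt two_ne_zero).hasFDerivAt hasFDerivAt_fst
  exact (hasFDerivAt_snd.smul h1).prodMk h2

theorem contDiffAt_gauss (hφ : ContDiffAt ℝ 2 φ p) (t : ℝ) :
    ContDiffAt ℝ 1 (fun w : E n × ℝ => (w.2 • ∇ φ w.1, φ w.1)) (p, t) := by
  have h1 : ContDiffAt ℝ 1 (fun w : E n × ℝ => ∇ φ w.1) (p, t) :=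
    ContDiffAt.comp (g := ∇ φ) (f := Prod.fst) (p, t) (contDiffAt_gradient hφ) contDiffAt_fst
  have h2 : ContDiffAt ℝ 1 (fun w : E n × ℝ => φ w.1) (p, t) :=
    ContDiffAt.comp (p, t) (hφ.of_le (by norm_num)) contDiffAt_fst
  exact (contDiffAt_snd.smul h1).prodMk h2

/-- The second component forces `u` to be tangential; pairing the first with `u` removes the
gradient term, so positivity gives `u = 0`, and then `s = 0`. This is the hypothesis of the inverse
function theorem. -/
theorem gaussDeriv_injective {t : ℝ} (ht : t ≠ 0) (hg : ∇ φ p ≠ 0)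
    (hpos : ∀ u, ⟪∇ φ p, u⟫ = 0 → u ≠ 0 → 0 < ⟪hess φ p u, u⟫) :
    Function.Injective (gaussDeriv φ p t) := by
  rw [injective_iff_map_eq_zero]
  rintro ⟨u, s⟩ h
  rw [gaussDeriv_apply, Prod.mk_eq_zero] at h
  obtain ⟨h1, h2⟩ := h
  have hu : u = 0 := by
    by_contra hu
    have h3 := congrArg (fun v => ⟪v, u⟫) h1
    simp only [inner_add_left, real_inner_smul_left, h2, mul_zero, add_zero, inner_zero_left] at h3
    exact (hpos u h2 hu).ne' ((mul_eq_zero.1 h3).resolve_left ht)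
  subst hu
  simp only [map_zero, smul_zero, zero_add] at h1
  rw [(smul_eq_zero.1 h1).resolve_right hg]
  rfl

/-- Near each nonzero direction the support point of a body of class `𝒦₊²` is unique and depends
in a `C¹` way on the direction, with positive derivative. -/
theorem MemKPlusTwo.exists_support_point (hK : MemKPlusTwo K) {y₀ : E n} (hy₀ : y₀ ≠ 0) :
    ∃ P : E n → E n, ContDiffAt ℝ 1 P y₀ ∧
      (∀ᶠ y in 𝓝 y₀, P y ∈ K ∧ ∀ z ∈ K, ⟪y, z⟫ ≤ ⟪y, P y⟫) ∧
      ∀ v, ⟪y₀, v⟫ = 0 → v ≠ 0 → 0 < ⟪fderiv ℝ P y₀ v, v⟫ := by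
  have hex : ∀ y : E n, ∃ q ∈ K, ∀ z ∈ K, ⟪y, z⟫ ≤ ⟪y, q⟫ := by
    intro y
    obtain ⟨q, hq, hq2⟩ := K.isCompact.exists_isMaxOn K.nonempty
      (f := fun z => ⟪y, z⟫) (by fun_prop)
    exact ⟨q, hq, fun z hz => hq2 hz⟩
  obtain ⟨p, hp, hpmax⟩ := hex y₀
  have hpf : p ∈ frontier (K : Set (E n)) := by
    refine ⟨subset_closure hp, fun hint => ?_⟩
    have h1 : Filter.Tendsto (fun t : ℝ => p + t • y₀) (𝓝[>] 0) (𝓝 p) := by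
      have : Continuous fun t : ℝ => p + t • y₀ := by fun_prop
      have h := this.tendsto 0
      rw [zero_smul, add_zero] at h
      exact h.mono_left nhdsWithin_le_nhds
    obtain ⟨t, ht, ht0⟩ := ((h1.eventually (mem_interior_iff_mem_nhds.1 hint)).and
      self_mem_nhdsWithin).exists
    have := hpmax _ ht
    rw [inner_add_right, real_inner_smul_right] at this
    have h3 : 0 < t * ⟪y₀, y₀⟫ := mul_pos ht0 (real_inner_self_pos.2 hy₀)
    linarith
  obtain ⟨φ, hφ, hg, hKφ, hcurv⟩ := hK.boundary p hpf
  have hev : ∀ᶠ q in 𝓝 p, DifferentiableAt ℝ φ q ∧ ∇ φ q ≠ 0 ∧ ∀ᶠ z in 𝓝 q, z ∈ K ↔ φ z ≤ 0 :=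
    ((hφ.eventually (by simp)).mono fun z hz => hz.differentiableAt two_ne_zero).and
      (((contDiffAt_gradient hφ).continuousAt.eventually_ne hg).and hKφ.eventually_nhds)
  have hstat : ∀ᶠ q in 𝓝 p, ∀ y ≠ 0, q ∈ K → (∀ z ∈ K, ⟪y, z⟫ ≤ ⟪y, q⟫) →
      φ q = 0 ∧ y = (‖y‖ / ‖∇ φ q‖) • ∇ φ q :=
    hev.mono fun q hq y hy hqK hmax => eq_smul_gradient_of_isMaxOn hq.1 hq.2.1 hq.2.2 hy hqK hmax
  obtain ⟨h0, hy₀g⟩ := hstat.self_of_nhds y₀ hy₀ hp hpmax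
  have hgn : 0 < ‖∇ φ p‖ := norm_pos_iff.2 hg
  have hyn : 0 < ‖y₀‖ := norm_pos_iff.2 hy₀
  set t₀ := ‖y₀‖ / ‖∇ φ p‖ with ht₀
  have ht₀pos : 0 < t₀ := div_pos hyn hgn
  have hsup : ∀ z ∈ K, ⟪∇ φ p, z - p⟫ ≤ 0 := by
    intro z hz
    have h1 := hpmax z hz
    rw [← sub_nonpos, ← inner_sub_right, hy₀g, real_inner_smul_left] at h1
    exact nonpos_of_mul_nonpos_right h1 ht₀pos
  have hpos : ∀ u, ⟪∇ φ p, u⟫ = 0 → u ≠ 0 → 0 < ⟪hess φ p u, u⟫ := fun u hu hu0 =>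
    hess_pos_of_gaussCurvature_pos hφ h0 hg hKφ hsup hcurv hu hu0
  have hinj := gaussDeriv_injective ht₀pos.ne' hg hpos
  -- A support point `q` for the direction `y` solves `F (q, t) = (y, 0)` with multiplier `t = ‖y‖ /
  -- ‖∇φ q‖`. Inverting `F` locally thus yields the candidate `P`.
  set F : E n × ℝ → E n × ℝ := fun w => (w.2 • ∇ φ w.1, φ w.1) with hF
  set e : (E n × ℝ) ≃L[ℝ] (E n × ℝ) := (LinearEquiv.ofInjectiveEndo
    (gaussDeriv φ p t₀ : E n × ℝ →ₗ[ℝ] E n × ℝ) hinj).toContinuousLinearEquiv with he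
  have hee : (e : E n × ℝ →L[ℝ] E n × ℝ) = gaussDeriv φ p t₀ := by
    refine ContinuousLinearMap.ext fun w => ?_
    rfl
  have hFd : HasFDerivAt F (e : E n × ℝ →L[ℝ] E n × ℝ) (p, t₀) := by
    rw [hee]; exact hasFDerivAt_gauss hφ t₀
  have hFc := contDiffAt_gauss hφ t₀
  set Φ := hFc.toOpenPartialHomeomorph F hFd one_ne_zero with hΦ
  have hsrc : (p, t₀) ∈ Φ.source := hFc.mem_toOpenPartialHomeomorph_source hFd one_ne_zero
  have hΦF : ∀ w, Φ w = F w := fun w => rfl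
  have hF0 : F (p, t₀) = (y₀, 0) := by
    simp only [hF, h0]
    rw [← hy₀g]
  have htgt : ((y₀, 0) : E n × ℝ) ∈ Φ.target := by
    rw [← hF0, ← hΦF]; exact Φ.map_source hsrc
  have hsymm0 : Φ.symm (y₀, 0) = (p, t₀) := by
    rw [← hF0, ← hΦF]; exact Φ.left_inv hsrc
  have hsc : ContDiffAt ℝ 1 Φ.symm (y₀, 0) :=
    Φ.contDiffAt_symm (f₀' := e) htgt (by rw [hsymm0]; exact hFd) (by rw [hsymm0]; exact hFc)
  have hsd : HasFDerivAt Φ.symm (e.symm : E n × ℝ →L[ℝ] E n × ℝ) (y₀, 0) :=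
    Φ.hasFDerivAt_symm htgt (by rw [hsymm0]; exact hFd)
  have hι : HasFDerivAt (fun y : E n => (y, (0 : ℝ))) (ContinuousLinearMap.inl ℝ (E n) ℝ) y₀ :=
    (ContinuousLinearMap.inl ℝ (E n) ℝ).hasFDerivAt
  set P : E n → E n := fun y => (Φ.symm (y, 0)).1 with hP
  have hPd : HasFDerivAt P (ContinuousLinearMap.fst ℝ (E n) ℝ ∘L
      (e.symm : E n × ℝ →L[ℝ] E n × ℝ) ∘L ContinuousLinearMap.inl ℝ (E n) ℝ) y₀ :=
    hasFDerivAt_fst.comp y₀ (HasFDerivAt.comp y₀ hsd hι)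
  refine ⟨P, ?_, ?_, ?_⟩
  · exact contDiffAt_fst.comp y₀ (ContDiffAt.comp y₀ hsc
      (ContinuousLinearMap.inl ℝ (E n) ℝ).contDiff.contDiffAt)
  · have hcw : ContinuousAt (fun w : E n × E n => (w.2, ‖w.1‖ / ‖∇ φ w.2‖)) (y₀, p) := by
      refine continuousAt_snd.prodMk ((continuousAt_fst.norm).div ?_ hgn.ne')
      exact ContinuousAt.norm (ContinuousAt.comp (x := (y₀, p)) (f := Prod.snd)
        (contDiffAt_gradient hφ).continuousAt continuousAt_snd)
    have hloc : ∀ᶠ w : E n × E n in 𝓝 (y₀, p), (w.2, ‖w.1‖ / ‖∇ φ w.2‖) ∈ Φ.source :=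
      hcw.eventually (Φ.open_source.mem_nhds hsrc)
    have hne : ∀ᶠ w : E n × E n in 𝓝 (y₀, p), w.1 ≠ 0 := continuousAt_fst.eventually_ne hy₀
    have hall : ∀ᶠ w : E n × E n in 𝓝 (y₀, p), w.2 ∈ K → (∀ z ∈ K, ⟪w.1, z⟫ ≤ ⟪w.1, w.2⟫) →
        w.2 = P w.1 := by
      filter_upwards [hloc, hne, continuousAt_snd.eventually hstat] with w h1 h2 h3 h4 h5
      obtain ⟨h6, h7⟩ := h3 w.1 h2 h4 h5
      have h8 : Φ (w.2, ‖w.1‖ / ‖∇ φ w.2‖) = (w.1, 0) := by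
        rw [hΦF]
        simp only [hF, h6]
        rw [← h7]
      have h9 := Φ.left_inv h1
      rw [h8] at h9
      simp only [hP, h9]
    obtain ⟨V, hV, U, hU, hUV⟩ := Filter.mem_prod_iff.1 (nhds_prod_eq (x := y₀) (y := p) ▸ hall)
    -- By convexity a second maximizer would give maximizers on the segment arbitrarily close to
    -- `p`, where the local inverse admits only `P y₀ = p`.
    have huniq : ∀ q ∈ K, (∀ z ∈ K, ⟪y₀, z⟫ ≤ ⟪y₀, q⟫) → q = p := by
      intro q hq hqmax
      by_contra hqp
      have h1 : Filter.Tendsto (fun t : ℝ => p + t • (q - p)) (𝓝[>] 0) (𝓝 p) := by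
        have : Continuous fun t : ℝ => p + t • (q - p) := by fun_prop
        have h := this.tendsto 0
        rw [zero_smul, add_zero] at h
        exact h.mono_left nhdsWithin_le_nhds
      have h2 : ∀ᶠ t in 𝓝[>] (0 : ℝ), t < 1 := nhdsWithin_le_nhds (Iio_mem_nhds zero_lt_one)
      have h3 : ∀ᶠ t in 𝓝[>] (0 : ℝ), 0 < t := self_mem_nhdsWithin
      obtain ⟨t, ht, ht0, ht1⟩ := ((h1.eventually hU).and (h3.and h2)).exists
      have ht0' : 0 < t := ht0
      have hmem : p + t • (q - p) ∈ K := K.convex.add_smul_sub_mem hp hq ⟨ht0'.le, le_of_lt ht1⟩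
      have hpq : ⟪y₀, q⟫ = ⟪y₀, p⟫ := le_antisymm (hpmax q hq) (hqmax p hp)
      have hval : ⟪y₀, p + t • (q - p)⟫ = ⟪y₀, p⟫ := by
        rw [inner_add_right, real_inner_smul_right, inner_sub_right, hpq, sub_self, mul_zero,
          add_zero]
      have h2 : p + t • (q - p) = P y₀ := hUV (Set.mk_mem_prod (mem_of_mem_nhds hV) ht) hmem
        (fun z hz => by rw [hval]; exact hpmax z hz)
      have h3 : P y₀ = p := by simp only [hP, hsymm0]
      rw [h3, add_eq_left, smul_eq_zero, sub_eq_zero] at h2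
      exact h2.elim ht0'.ne' hqp
    -- Off a neighbourhood of `p` the body is compact and the functional `y₀` stays strictly below
    -- its maximum; the same then holds for all directions near `y₀`, so their maximizers lie near
    -- `p`.
    have hUy : ∀ᶠ y in 𝓝 y₀, ∀ q ∈ K, (∀ z ∈ K, ⟪y, z⟫ ≤ ⟪y, q⟫) → q ∈ U := by
      obtain ⟨W, hWU, hWo, hpW⟩ := mem_nhds_iff.1 hU
      have hcomp : IsCompact ((K : Set (E n)) \ W) := K.isCompact.diff hWo
      have hlt : ∀ q ∈ (K : Set (E n)) \ W, ⟪y₀, q⟫ < ⟪y₀, p⟫ := by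
        intro q hq
        refine lt_of_le_of_ne (hpmax q hq.1) fun heq => hq.2 ?_
        rw [huniq q hq.1 fun z hz => by rw [heq]; exact hpmax z hz]
        exact hpW
      have hforall : ∀ᶠ y in 𝓝 y₀, ∀ q ∈ (K : Set (E n)) \ W, ⟪y, q⟫ < ⟪y, p⟫ := by
        refine hcomp.eventually_forall_of_forall_eventually fun q hq => ?_
        have hc1 : Continuous fun w : E n × E n => ⟪w.1, w.2⟫ := continuous_fst.inner continuous_snd
        have hc2 : Continuous fun w : E n × E n => ⟪w.1, p⟫ := continuous_fst.inner continuous_const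
        exact (hc1.tendsto _).eventually_lt (hc2.tendsto _) (hlt q hq)
      filter_upwards [hforall] with y hy q hq hqmax
      by_contra hqU
      exact absurd (hqmax p hp) (not_le.2 (hy q ⟨hq, fun h => hqU (hWU h)⟩))
    filter_upwards [hUy, hV] with y hy hyV
    obtain ⟨q, hq, hqmax⟩ := hex y
    have h1 : q = P y := hUV (Set.mk_mem_prod hyV (hy q hq hqmax)) hq hqmax
    rw [← h1]
    exact ⟨hq, hqmax⟩
  · intro v hv hv0
    rw [hPd.fderiv]
    simp only [ContinuousLinearMap.comp_apply, ContinuousLinearMap.inl_apply,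
      ContinuousLinearMap.coe_fst', ContinuousLinearEquiv.coe_coe]
    set w := e.symm (v, 0) with hw
    have h1 : gaussDeriv φ p t₀ w = (v, 0) := by
      rw [← hee, hw]; exact e.apply_symm_apply _
    rw [gaussDeriv_apply, Prod.mk.injEq] at h1
    obtain ⟨h1, h2⟩ := h1
    have hvg : ⟪∇ φ p, v⟫ = 0 := by
      rw [hy₀g, real_inner_smul_left] at hv
      exact (mul_eq_zero.1 hv).resolve_left ht₀pos.ne'
    have hw1 : w.1 ≠ 0 := by
      intro hw1
      rw [hw1, map_zero, smul_zero, zero_add] at h1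
      apply hv0
      rw [← inner_self_eq_zero (𝕜 := ℝ)]
      nth_rw 1 [← h1]
      rw [real_inner_smul_left, hvg, mul_zero]
    -- The derivative `w.1` of the support point in the direction `v` solves `t₀ Hess w.1 + w.2 ∇φ =
    -- v` and is tangential; pairing with `w.1` removes the multiplier.
    have h3 : ⟪w.1, v⟫ = t₀ * ⟪hess φ p w.1, w.1⟫ := by
      conv_lhs => rw [← h1]
      rw [inner_add_right, real_inner_smul_right, real_inner_smul_right, real_inner_comm,
        real_inner_comm (∇ φ p), h2, mul_zero, add_zero]
    rw [h3]
    exact mul_pos ht₀pos (hpos _ h2 hw1)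

theorem homExt_supportFn (K : ConvexBody (E n)) {y : E n} (hy : y ≠ 0) {q : E n} (hq : q ∈ K)
    (hmax : ∀ z ∈ K, ⟪y, z⟫ ≤ ⟪y, q⟫) : homExt (supportFn K) y = ⟪y, q⟫ := by
  obtain ⟨x, hx⟩ := exists_smul_sph hy
  have hr : 0 < ‖y‖ := norm_pos_iff.2 hy
  have h1 : ∀ z, ⟪y, z⟫ = ‖y‖ * ⟪(x : E n), z⟫ := fun z => by
    rw [← real_inner_smul_left, ← hx]
  conv_lhs => rw [hx, homExt_smul_coe _ hr]
  rw [h1, supportFn]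
  congr 1
  refine IsGreatest.csSup_eq ⟨⟨q, hq, rfl⟩, ?_⟩
  rintro _ ⟨z, hz, rfl⟩
  have := hmax z hz
  rw [h1, h1] at this
  exact le_of_mul_le_mul_left this hr

/-- Envelope argument: near `y₀` one has `H y' ≥ ⟨P y, y'⟩` with equality at `y' = y`, so `∇H = P`.
As `P` is `C¹`, `H` is `C²`, and its Hessian is the derivative of `P`. -/
theorem MemKPlusTwo.exists_gradient (hK : MemKPlusTwo K) {y₀ : E n} (hy₀ : y₀ ≠ 0) :
    ContDiffAt ℝ 2 (homExt (supportFn K)) y₀ ∧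
      ∀ v, ⟪y₀, v⟫ = 0 → v ≠ 0 → 0 < ⟪hess (homExt (supportFn K)) y₀ v, v⟫ := by
  obtain ⟨P, hPc, hPmax, hPpos⟩ := hK.exists_support_point hy₀
  set H := homExt (supportFn K) with hH
  have hne : ∀ᶠ y in 𝓝 y₀, y ≠ 0 := isOpen_compl_singleton.mem_nhds hy₀
  have hHP : ∀ᶠ y in 𝓝 y₀, H y = ⟪y, P y⟫ := by
    filter_upwards [hPmax, hne] with y hy hy0
    exact homExt_supportFn K hy0 hy.1 hy.2
  have hPd : ∀ᶠ y in 𝓝 y₀, DifferentiableAt ℝ P y :=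
    (hPc.eventually (by simp)).mono fun y hy => hy.differentiableAt one_ne_zero
  have hHd : ∀ᶠ y in 𝓝 y₀, HasFDerivAt H (innerSL ℝ (P y)) y := by
    filter_upwards [hPd, hHP.eventually_nhds, hPmax.eventually_nhds, hne] with y h1 h2 h3 hy0
    have hd : DifferentiableAt ℝ H y :=
      (differentiableAt_id.inner ℝ h1).congr_of_eventuallyEq h2
    have hmin : IsLocalMin (fun y' => H y' - ⟪P y, y'⟫) y := by
      filter_upwards [h3, h2] with y' h4 h5
      have e1 : H y = ⟪P y, y⟫ := by rw [h2.self_of_nhds, real_inner_comm]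
      rw [e1, sub_self, h5, real_inner_comm y']
      have := h4.2 (P y) h3.self_of_nhds.1
      linarith
    have h6 : HasFDerivAt (fun y' => H y' - ⟪P y, y'⟫) (fderiv ℝ H y - innerSL ℝ (P y)) y :=
      hd.hasFDerivAt.sub (innerSL ℝ (P y)).hasFDerivAt
    have h7 := hmin.hasFDerivAt_eq_zero h6
    rw [sub_eq_zero] at h7
    rw [← h7]
    exact hd.hasFDerivAt
  have hgrad : ∇ H =ᶠ[𝓝 y₀] P := by
    filter_upwards [hHd] with y hy
    refine ext_inner_right ℝ fun v => ?_
    rw [inner_gradient, hy.fderiv, innerSL_apply_apply]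
  refine ⟨?_, fun v hv hv0 => ?_⟩
  · have h1 : ContDiffAt ℝ ((1 : ℕ) + 1) H y₀ := by
      rw [contDiffAt_succ_iff_hasFDerivAt]
      refine ⟨fun y => innerSL ℝ (P y), ⟨_, hHd, fun y hy => hy⟩, ?_⟩
      exact (innerSL ℝ).contDiff.contDiffAt.comp y₀ (by exact_mod_cast hPc)
    exact h1.of_le (by norm_num)
  · rw [hess, hgrad.fderiv_eq]
    exact hPpos v hv hv0

theorem MemKPlusTwo.isPosC2 (hK : MemKPlusTwo K) : IsPosC2 (supportFn K) where
  pos x := by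
    obtain ⟨q, hq, hq2⟩ := K.isCompact.exists_isMaxOn K.nonempty
      (f := fun z => ⟪(x : E n), z⟫) (by fun_prop)
    have h1 := homExt_supportFn K (sph_ne_zero x) hq fun z hz => hq2 hz
    rw [homExt_coe] at h1
    have h2 : Filter.Tendsto (fun t : ℝ => t • (x : E n)) (𝓝[>] 0) (𝓝 0) := by
      have : Continuous fun t : ℝ => t • (x : E n) := by fun_prop
      have h := this.tendsto 0
      rw [zero_smul] at h
      exact h.mono_left nhdsWithin_le_nhds
    obtain ⟨t, ht, ht0⟩ := ((h2.eventually (mem_interior_iff_mem_nhds.1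
      hK.zero_mem_interior)).and self_mem_nhdsWithin).exists
    have h3 : ⟪(x : E n), t • (x : E n)⟫ ≤ ⟪(x : E n), q⟫ := hq2 ht
    rw [real_inner_smul_right, inner_sph_self, mul_one] at h3
    rw [h1]
    exact lt_of_lt_of_le ht0 h3
  isC2 := fun _ hy => (hK.exists_gradient hy).1.contDiffWithinAt
  hess_pos x _ := (hK.exists_gradient (sph_ne_zero x)).2 _

end SupportFunction

end ConvexStability

end

open MeasureTheory Topology
open scoped Pointwise Gradient RealInnerProductSpace

noncomputable section

namespace ConvexStability

open InnerProductSpace (rankOne)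

/-! ### A Poincaré inequality for `0`-homogeneous functions. -/

section Poincare

open scoped ENNReal

variable {n : ℕ} {F : Type*} [NormedAddCommGroup F] [NormedSpace ℝ F] [CompleteSpace F]
  {Z : E n → F}

/-- Integration of nonnegative functions in polar coordinates. -/
theorem lintegral_polar (hn : n ≠ 0) {k : ℝ → ℝ≥0∞} (hk : Measurable k) {w : Sph n → ℝ≥0∞}
    (hw : Measurable w) (g : E n → ℝ≥0∞) (hg : ∀ r > 0, ∀ x : Sph n, g (r • (x : E n)) = k r * w x) :
    ∫⁻ y, g y = (∫⁻ r in Set.Ioi (0 : ℝ), ENNReal.ofReal (r ^ (n - 1)) * k r) *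
      ∫⁻ x, w x ∂(sphMeasure n) := by
  have : Nonempty (Fin n) := ⟨⟨0, Nat.pos_of_ne_zero hn⟩⟩
  have hd : Module.finrank ℝ (E n) - 1 = n - 1 := by simp
  calc ∫⁻ y, g y = ∫⁻ y : ({(0)}ᶜ : Set (E n)), g y.1 ∂((volume : Measure (E n)).comap (↑)) := by
        rw [lintegral_subtype_comap (measurableSet_singleton _).compl fun x => g x,
          restrict_compl_singleton]
    _ = ∫⁻ p : Sph n × Set.Ioi (0 : ℝ), w p.1 * k p.2.1
          ∂((sphMeasure n).prod (.volumeIoiPow (n - 1))) := by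
        rw [← hd]
        unfold sphMeasure
        rw [← (volume : Measure (E n)).measurePreserving_homeomorphUnitSphereProd.lintegral_comp_emb
          (Homeomorph.measurableEmbedding _)]
        refine lintegral_congr fun y => ?_
        have hy : (y : E n) ≠ 0 := y.2
        have h1 := hg ‖(y : E n)‖ (norm_pos_iff.2 hy) (homeomorphUnitSphereProd (E n) y).1
        rw [homeomorphUnitSphereProd_apply_fst_coe, smul_smul,
          mul_inv_cancel₀ (norm_ne_zero_iff.2 hy), one_smul] at h1
        simp only [homeomorphUnitSphereProd_apply_snd_coe]
        rw [h1, mul_comm]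
    _ = (∫⁻ x, w x ∂(sphMeasure n)) * ∫⁻ r : Set.Ioi (0 : ℝ), k r ∂(.volumeIoiPow (n - 1)) :=
        lintegral_prod_mul hw.aemeasurable (hk.comp measurable_subtype_coe).aemeasurable
    _ = _ := by
        rw [mul_comm]
        congr 1
        have hk' : Measurable fun r : Set.Ioi (0 : ℝ) => k r := hk.comp measurable_subtype_coe
        rw [Measure.volumeIoiPow, lintegral_withDensity_eq_lintegral_mul _ (by fun_prop) hk']
        exact lintegral_subtype_comap measurableSet_Ioi
          fun r => ENNReal.ofReal (r ^ (n - 1)) * k r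

theorem lintegral_add_smul (g : E n → ℝ≥0∞) (hg : Measurable g) (a : E n) {t : ℝ} (ht : 0 < t) :
    ∫⁻ y, g (a + t • y) = ENNReal.ofReal (t ^ n)⁻¹ * ∫⁻ y, g y := by
  have h1 : ∫⁻ y, g (a + t • y) = ∫⁻ y, g (a + y) ∂(Measure.map (t • ·) (volume : Measure (E n))) := by
    rw [lintegral_map (f := fun y => g (a + y)) (hg.comp (measurable_const_add a))
      (measurable_const_smul t)]
  rw [h1, Measure.map_addHaar_smul _ ht.ne', lintegral_smul_measure, lintegral_add_left_eq_self]
  rw [finrank_euclideanSpace_fin, abs_of_pos (by positivity), smul_eq_mul]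

/-- The fundamental theorem of calculus on a segment avoiding the origin; the factor 2 bounds the
length of a segment in the unit ball. -/
theorem enorm_sub_le_lintegral_fderiv (hZ : ContDiffOn ℝ 1 Z {0}ᶜ) {x y : E n}
    (hx : ‖x‖ < 1) (hy : ‖y‖ < 1) (hxy : ∀ t ∈ Set.Icc (0 : ℝ) 1, x + t • (y - x) ≠ 0) :
    ‖Z x - Z y‖ₑ ≤ 2 * ∫⁻ t in Set.Icc (0 : ℝ) 1, ‖fderiv ℝ Z (x + t • (y - x))‖ₑ := by
  have hc : Continuous fun t : ℝ => x + t • (y - x) := by fun_prop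
  have hcd : ∀ t, HasDerivAt (fun t : ℝ => x + t • (y - x)) (y - x) t := fun t => by
    simpa using ((hasDerivAt_id t).smul_const (y - x)).const_add x
  have hd : ∀ t ∈ Set.uIcc (0 : ℝ) 1, HasDerivAt (fun t : ℝ => Z (x + t • (y - x)))
      (fderiv ℝ Z (x + t • (y - x)) (y - x)) t := by
    intro t ht
    rw [Set.uIcc_of_le zero_le_one] at ht
    have h1 := ((hZ.contDiffAt (isOpen_compl_singleton.mem_nhds (hxy t ht))).differentiableAt
      one_ne_zero).hasFDerivAt
    exact h1.comp_hasDerivAt t (hcd t)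
  have hcont : ContinuousOn (fun t : ℝ => fderiv ℝ Z (x + t • (y - x)) (y - x))
      (Set.uIcc (0 : ℝ) 1) := by
    rw [Set.uIcc_of_le zero_le_one]
    have h1 := hZ.continuousOn_fderiv_of_isOpen isOpen_compl_singleton le_rfl
    exact (h1.comp hc.continuousOn hxy).clm_apply continuousOn_const
  have h2 := intervalIntegral.integral_eq_sub_of_hasDerivAt hd hcont.intervalIntegrable
  rw [zero_smul, add_zero, one_smul, add_sub_cancel] at h2
  rw [← enorm_neg, neg_sub, ← h2, intervalIntegral.integral_of_le zero_le_one,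
    ← lintegral_const_mul' _ _ ENNReal.ofNat_ne_top]
  refine (enorm_integral_le_lintegral_enorm _).trans
    ((lintegral_mono' (Measure.restrict_mono Set.Ioc_subset_Icc_self le_rfl) ?_))
  intro t
  have h3 := (fderiv ℝ Z (x + t • (y - x))).le_opENorm (y - x)
  refine h3.trans ?_
  rw [mul_comm]
  refine mul_le_mul_left ?_ _
  rw [← ofReal_norm]
  refine (ENNReal.ofReal_le_ofReal (q := 2) ((norm_sub_le _ _).trans ?_)).trans_eq
    (ENNReal.ofReal_ofNat 2)
  linarith

/-- The Poincaré inequality in the ball, for functions that may be singular at the center. -/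
theorem lintegral_enorm_sub_le (hn : 2 ≤ n) (hZ : ContDiffOn ℝ 1 Z {0}ᶜ) :
    ∫⁻ x in Metric.ball (0 : E n) 1, ∫⁻ y in Metric.ball (0 : E n) 1, ‖Z x - Z y‖ₑ ≤
      2 * (2 ^ n * volume (Metric.ball (0 : E n) 1) *
        ∫⁻ u in Metric.ball (0 : E n) 1, ‖fderiv ℝ Z u‖ₑ) := by
  have : Nonempty (Fin n) := ⟨⟨0, by omega⟩⟩
  set B := Metric.ball (0 : E n) 1 with hB
  have hBm : MeasurableSet B := measurableSet_ball
  set g : E n → ℝ≥0∞ := fun u => ‖fderiv ℝ Z u‖ₑ with hg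
  have hgm : Measurable g := (measurable_fderiv ℝ Z).enorm
  set I := ∫⁻ u in B, g u with hI
  have hconv : Convex ℝ B := convex_ball _ _
  -- The substitution `u = (1-s)x + sy` costs the Jacobian factor `s^(-n)`, at most `2^n` when `s ≥
  -- 1/2`, and convexity keeps `u` in the ball.
  have hstep : ∀ x ∈ B, ∀ s : ℝ, 1 / 2 ≤ s → s ≤ 1 →
      ∫⁻ y in B, g ((1 - s) • x + s • y) ≤ 2 ^ n * I := by
    intro x hx s hs hs1
    have hs0 : 0 < s := by linarith
    calc ∫⁻ y in B, g ((1 - s) • x + s • y)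
        = ∫⁻ y in B, B.indicator g ((1 - s) • x + s • y) := by
          refine setLIntegral_congr_fun hBm fun y hy => ?_
          rw [Set.indicator_of_mem (hconv hx hy (by linarith) hs0.le (by ring))]
      _ ≤ ∫⁻ y, B.indicator g ((1 - s) • x + s • y) := setLIntegral_le_lintegral _ _
      _ = ENNReal.ofReal (s ^ n)⁻¹ * I := by
          rw [lintegral_add_smul _ (hgm.indicator hBm) _ hs0, lintegral_indicator hBm]
      _ ≤ 2 ^ n * I := by
          gcongr
          rw [← ENNReal.ofReal_ofNat, ← ENNReal.ofReal_pow (by norm_num)]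
          refine ENNReal.ofReal_le_ofReal ?_
          rw [← inv_pow]
          gcongr
          rw [inv_le_comm₀ hs0 two_pos]
          linarith
  have hγm : Measurable fun w : E n × E n × ℝ => g (w.1 + w.2.2 • (w.2.1 - w.1)) :=
    hgm.comp (by fun_prop)
  have hinner : ∀ t ∈ Set.Icc (0 : ℝ) 1,
      ∫⁻ x in B, ∫⁻ y in B, g (x + t • (y - x)) ≤ 2 ^ n * volume B * I := by
    intro t ht
    -- At the point `x + t(y - x)` one of the weights `t`, `1 - t` is at least `1/2`; the variable
    -- carrying that weight is integrated first.
    rcases le_total (1 / 2) t with h | h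
    · calc ∫⁻ x in B, ∫⁻ y in B, g (x + t • (y - x)) ≤ ∫⁻ x in B, 2 ^ n * I := by
            refine setLIntegral_mono' hBm fun x hx => ?_
            have := hstep x hx t h ht.2
            refine le_of_eq_of_le (lintegral_congr fun y => ?_) this
            congr 1
            module
        _ = _ := by rw [setLIntegral_const]; ring
    · rw [lintegral_lintegral_swap]
      · calc ∫⁻ y in B, ∫⁻ x in B, g (x + t • (y - x)) ≤ ∫⁻ y in B, 2 ^ n * I := by
              refine setLIntegral_mono' hBm fun y hy => ?_
              have := hstep y hy (1 - t) (by linarith) (by linarith [ht.1])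
              refine le_of_eq_of_le (lintegral_congr fun x => ?_) this
              congr 1
              module
          _ = _ := by rw [setLIntegral_const]; ring
      · exact (hgm.comp (by fun_prop :
          Measurable fun w : E n × E n => w.1 + t • (w.2 - w.1))).aemeasurable
  have hne : ∀ x ∈ B, x ≠ 0 → ∀ᵐ y ∂(volume.restrict B), ‖Z x - Z y‖ₑ ≤
      2 * ∫⁻ t in Set.Icc (0 : ℝ) 1, g (x + t • (y - x)) := by
    intro x hx hx0
    -- The segment from `x` to `y` can meet the origin only if `y` lies on the line through `x`, a
    -- null set because `n ≥ 2`.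
    have hspan : volume ((ℝ ∙ x : Submodule ℝ (E n)) : Set (E n)) = 0 := by
      refine Measure.addHaar_submodule _ _ fun htop => ?_
      have h1 : Module.finrank ℝ (ℝ ∙ x) = n := by
        rw [htop, finrank_top, finrank_euclideanSpace_fin]
      rw [finrank_span_singleton hx0] at h1
      omega
    filter_upwards [ae_restrict_mem hBm, ae_restrict_of_ae (compl_mem_ae_iff.2 hspan)]
      with y hy hyx
    refine enorm_sub_le_lintegral_fderiv hZ (mem_ball_zero_iff.1 hx) (mem_ball_zero_iff.1 hy) ?_
    intro t _ h0
    have hyx' : y ∉ (ℝ ∙ x : Submodule ℝ (E n)) := hyx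
    have ht : t ≠ 0 := by
      rintro rfl
      rw [zero_smul, add_zero] at h0
      exact hx0 h0
    refine hyx' (Submodule.mem_span_singleton.2 ⟨t⁻¹ * (t - 1), ?_⟩)
    have h1 : t • y = (t - 1) • x := by
      rw [smul_sub] at h0
      rw [sub_smul, one_smul, eq_sub_iff_add_eq, ← sub_eq_zero, ← h0]
      abel
    rw [mul_smul, ← h1, smul_smul, inv_mul_cancel₀ ht, one_smul]
  calc ∫⁻ x in B, ∫⁻ y in B, ‖Z x - Z y‖ₑ
      ≤ ∫⁻ x in B, ∫⁻ y in B, 2 * ∫⁻ t in Set.Icc (0 : ℝ) 1, g (x + t • (y - x)) := by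
        refine lintegral_mono_ae ?_
        filter_upwards [ae_restrict_mem hBm,
          ae_restrict_of_ae (compl_mem_ae_iff.2 (measure_singleton (0 : E n)))] with x hx hx0
        exact lintegral_mono_ae (hne x hx hx0)
    _ = 2 * ∫⁻ x in B, ∫⁻ y in B, ∫⁻ t in Set.Icc (0 : ℝ) 1, g (x + t • (y - x)) := by
        simp_rw [lintegral_const_mul' _ _ (ENNReal.ofNat_ne_top (n := 2))]
    _ = 2 * ∫⁻ x in B, ∫⁻ t in Set.Icc (0 : ℝ) 1, ∫⁻ y in B, g (x + t • (y - x)) := by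
        congr 1
        refine lintegral_congr fun x => ?_
        rw [lintegral_lintegral_swap]
        exact (hgm.comp (by fun_prop :
          Measurable fun w : E n × ℝ => x + w.2 • (w.1 - x))).aemeasurable
    _ = 2 * ∫⁻ t in Set.Icc (0 : ℝ) 1, ∫⁻ x in B, ∫⁻ y in B, g (x + t • (y - x)) := by
        congr 1
        rw [lintegral_lintegral_swap]
        have : Measurable fun w : (E n × ℝ) × E n => g (w.1.1 + w.1.2 • (w.2 - w.1.1)) :=
          hgm.comp (by fun_prop)
        exact this.lintegral_prod_right'.aemeasurable
    _ ≤ 2 * ∫⁻ t in Set.Icc (0 : ℝ) 1, 2 ^ n * volume B * I := by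
        refine mul_le_mul_right ?_ _
        exact setLIntegral_mono' measurableSet_Icc hinner
    _ = _ := by
        rw [setLIntegral_const, Real.volume_Icc]
        simp

/-- A Poincaré inequality on the sphere for `0`-homogeneous functions. -/
theorem exists_poincare_sph (hn : 2 ≤ n) (F : Type*) [NormedAddCommGroup F] [NormedSpace ℝ F]
    [CompleteSpace F] : ∃ C : ℝ≥0∞, C ≠ ∞ ∧ ∀ Z : E n → F, ContDiffOn ℝ 1 Z {0}ᶜ →
      (∀ r : ℝ, 0 < r → ∀ x : Sph n, Z (r • (x : E n)) = Z x) → ∃ c : F,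
        ∫⁻ x : Sph n, ‖Z x - c‖ₑ ∂(sphMeasure n) ≤
          C * ∫⁻ x : Sph n, ‖fderiv ℝ Z x‖ₑ ∂(sphMeasure n) := by
  have hn0 : n ≠ 0 := by omega
  have : Nonempty (Fin n) := ⟨⟨0, by omega⟩⟩
  have hSne : Nonempty (Sph n) :=
    ((NormedSpace.sphere_nonempty (E := E n) (x := 0) (r := 1)).2 zero_le_one).to_subtype
  set B := Metric.ball (0 : E n) 1 with hB
  set a := ∫⁻ r in Set.Ioi (0 : ℝ), ENNReal.ofReal (r ^ (n - 1)) *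
    (Set.Iio (1 : ℝ)).indicator (fun _ => 1) r with ha
  set b := ∫⁻ r in Set.Ioi (0 : ℝ), ENNReal.ofReal (r ^ (n - 1)) *
    (Set.Iio (1 : ℝ)).indicator (fun r => ENNReal.ofReal r⁻¹) r with hb
  set m := sphMeasure n Set.univ with hm
  have hm0 : m ≠ 0 := (isOpen_univ.measure_pos _ Set.univ_nonempty).ne'
  have hmt : m ≠ ∞ := measure_ne_top _ _
  have hk1 : Measurable ((Set.Iio (1 : ℝ)).indicator fun _ => (1 : ℝ≥0∞)) :=
    measurable_const.indicator measurableSet_Iio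
  have hk2 : Measurable ((Set.Iio (1 : ℝ)).indicator fun r : ℝ => ENNReal.ofReal r⁻¹) :=
    (by fun_prop : Measurable fun r : ℝ => ENNReal.ofReal r⁻¹).indicator measurableSet_Iio
  have hmem : ∀ r : ℝ, 0 < r → ∀ x : Sph n, r • (x : E n) ∈ B ↔ r < 1 := by
    intro r hr x
    rw [hB, mem_ball_zero_iff, norm_smul, norm_sph x, mul_one, Real.norm_of_nonneg hr.le]
  have hpol : ∀ (w : Sph n → ℝ≥0∞), Measurable w → ∀ G : E n → ℝ≥0∞,
      (∀ r : ℝ, 0 < r → ∀ x : Sph n, G (r • (x : E n)) = w x) →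
      ∫⁻ y in B, G y = a * ∫⁻ x, w x ∂(sphMeasure n) := by
    intro w hw G hG
    rw [← lintegral_indicator measurableSet_ball]
    refine lintegral_polar hn0 hk1 hw _ fun r hr x => ?_
    by_cases h : r < 1
    · rw [Set.indicator_of_mem ((hmem r hr x).2 h), Set.indicator_of_mem (Set.mem_Iio.2 h), hG r hr,
        one_mul]
    · rw [Set.indicator_of_notMem (fun h' => h ((hmem r hr x).1 h')),
        Set.indicator_of_notMem (fun h' => h (Set.mem_Iio.1 h')), zero_mul]
  have hvolB : volume B = a * m := by
    have := hpol (fun _ => 1) measurable_const (fun _ => 1) fun _ _ _ => rfl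
    simpa [hm] using this
  have ha0 : a ≠ 0 := by
    intro h
    rw [h, zero_mul] at hvolB
    exact (Metric.measure_ball_pos volume (0 : E n) one_pos).ne' hvolB
  have hat : a ≠ ∞ := by
    intro h
    rw [h, ENNReal.top_mul hm0] at hvolB
    exact measure_ball_lt_top.ne hvolB
  -- The derivative of a `0`-homogeneous function grows like `1/r`; its radial integrand `r^(n-2)`
  -- is bounded on `(0,1)` because `n ≥ 2`.
  have hbt : b ≠ ∞ := by
    refine ne_top_of_le_ne_top (b := volume (Set.Ioo (0 : ℝ) 1)) (by simp) ?_
    rw [hb, ← lintegral_indicator measurableSet_Ioi, ← lintegral_indicator_one measurableSet_Ioo]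
    refine lintegral_mono fun r => ?_
    by_cases h0 : 0 < r
    · by_cases h1 : r < 1
      · rw [Set.indicator_of_mem (Set.mem_Ioi.2 h0), Set.indicator_of_mem (Set.mem_Iio.2 h1),
          Set.indicator_of_mem (Set.mem_Ioo.2 ⟨h0, h1⟩), ← ENNReal.ofReal_mul (by positivity),
          Pi.one_apply, ENNReal.ofReal_le_one]
        have e1 : r ^ (n - 1) * r⁻¹ = r ^ (n - 2) := by
          rw [show n - 1 = (n - 2) + 1 by omega, pow_succ, mul_assoc, mul_inv_cancel₀ h0.ne',
            mul_one]
        rw [e1]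
        exact pow_le_one₀ h0.le h1.le
      · rw [Set.indicator_of_mem (Set.mem_Ioi.2 h0),
          Set.indicator_of_notMem (fun h' => h1 (Set.mem_Iio.1 h')), mul_zero]
        exact zero_le
    · rw [Set.indicator_of_notMem (fun h' => h0 (Set.mem_Ioi.1 h'))]
      exact zero_le
  refine ⟨m⁻¹ * (a⁻¹ * (a⁻¹ * (2 * (2 ^ n * volume B * b)))), ?_, fun Z hZ hZ0 => ?_⟩
  · have hB2 : volume B ≠ ∞ := measure_ball_lt_top.ne
    refine ENNReal.mul_ne_top (ENNReal.inv_ne_top.2 hm0) (ENNReal.mul_ne_top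
      (ENNReal.inv_ne_top.2 ha0) (ENNReal.mul_ne_top (ENNReal.inv_ne_top.2 ha0)
      (ENNReal.mul_ne_top (by simp) (ENNReal.mul_ne_top (ENNReal.mul_ne_top (by simp) hB2) hbt))))
  have hZS : Continuous fun x : Sph n => Z x :=
    hZ.continuousOn.comp_continuous continuous_subtype_val fun x => sph_ne_zero x
  have hgm : Measurable fun u : E n => ‖fderiv ℝ Z u‖ₑ := (measurable_fderiv ℝ Z).enorm
  have hder : ∀ r : ℝ, 0 < r → ∀ x : Sph n,
      ‖fderiv ℝ Z (r • (x : E n))‖ₑ = ENNReal.ofReal r⁻¹ * ‖fderiv ℝ Z x‖ₑ := by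
    intro r hr x
    have hev : (fun y : E n => Z (r • y)) =ᶠ[𝓝 (x : E n)] Z := by
      filter_upwards [isOpen_compl_singleton.mem_nhds (sph_ne_zero x)] with y hy
      obtain ⟨s, hs⟩ := exists_smul_sph (y := y) hy
      have hyn : 0 < ‖y‖ := norm_pos_iff.2 hy
      rw [hs, smul_smul, hZ0 _ (mul_pos hr hyn), hZ0 _ hyn]
    have h1 : r • fderiv ℝ Z (r • (x : E n)) = fderiv ℝ Z (x : E n) := by
      rw [← hev.fderiv_eq (𝕜 := ℝ), fderiv_comp_smul]
    rw [← h1, enorm_smul, ← mul_assoc, Real.enorm_eq_ofReal hr.le,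
      ← ENNReal.ofReal_mul (by positivity), inv_mul_cancel₀ hr.ne', ENNReal.ofReal_one, one_mul]
  have hgrad : ∫⁻ u in B, ‖fderiv ℝ Z u‖ₑ = b * ∫⁻ x : Sph n, ‖fderiv ℝ Z x‖ₑ ∂(sphMeasure n) := by
    rw [← lintegral_indicator measurableSet_ball]
    refine lintegral_polar hn0 hk2 (hgm.comp measurable_subtype_coe) _ fun r hr x => ?_
    by_cases h : r < 1
    · rw [Set.indicator_of_mem ((hmem r hr x).2 h), Set.indicator_of_mem (Set.mem_Iio.2 h),
        hder r hr]
      rfl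
    · rw [Set.indicator_of_notMem (fun h' => h ((hmem r hr x).1 h')),
        Set.indicator_of_notMem (fun h' => h (Set.mem_Iio.1 h')), zero_mul]
  have hjoint : Continuous fun p : Sph n × Sph n => ‖Z p.1 - Z p.2‖ₑ :=
    ((hZS.comp continuous_fst).sub (hZS.comp continuous_snd)).enorm
  set J : Sph n → ℝ≥0∞ := fun x => ∫⁻ y : Sph n, ‖Z x - Z y‖ₑ ∂(sphMeasure n) with hJ
  have hJm : Measurable J := hjoint.measurable.lintegral_prod_right'
  have hdouble : ∫⁻ x in B, ∫⁻ y in B, ‖Z x - Z y‖ₑ = a * (a * ∫⁻ x, J x ∂(sphMeasure n)) := by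
    rw [hpol (fun x => a * J x) (hJm.const_mul a), lintegral_const_mul _ hJm]
    intro r hr x
    rw [hpol (fun y => ‖Z x - Z y‖ₑ) (hjoint.comp (Continuous.prodMk_right x)).measurable]
    intro s hs y
    rw [hZ0 r hr, hZ0 s hs]
  have hmain := lintegral_enorm_sub_le hn hZ
  rw [hdouble, hgrad] at hmain
  -- The constant is the value of `Z` at a point where the mean deviation `J` does not exceed its
  -- average.
  obtain ⟨x, hx⟩ := exists_le_laverage (μ := sphMeasure n) (f := J)
    (fun h => hm0 (by rw [hm, h]; simp)) hJm.aemeasurable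
  refine ⟨Z x, ?_⟩
  have h1 : ∫⁻ y : Sph n, ‖Z y - Z x‖ₑ ∂(sphMeasure n) = J x := by
    refine lintegral_congr fun y => ?_
    rw [← enorm_neg, neg_sub]
  rw [h1]
  refine hx.trans ?_
  rw [laverage_eq, div_eq_mul_inv, mul_comm, ← hm]
  rw [mul_assoc m⁻¹]
  gcongr
  rw [mul_assoc a⁻¹, mul_assoc a⁻¹]
  have hcancel : ∀ X : ℝ≥0∞, a⁻¹ * (a * X) = X := fun X => by
    rw [← mul_assoc, ENNReal.inv_mul_cancel ha0 hat, one_mul]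
  rw [← hcancel (∫⁻ x, J x ∂(sphMeasure n)), ← hcancel (a * ∫⁻ x, J x ∂(sphMeasure n))]
  refine mul_le_mul_right (mul_le_mul_right ?_ _) _
  refine hmain.trans (le_of_eq ?_)
  ring

end Poincare

end ConvexStability

end

open MeasureTheory Topology
open scoped Pointwise Gradient RealInnerProductSpace

noncomputable section

namespace ConvexStability

/-! ### Symmetric operators and gaps in their real spectrum. -/

section Spectral

variable {H : Type*} [NormedAddCommGroup H] [InnerProductSpace ℝ H] [CompleteSpace H]

/-- A symmetric contraction `C` with `C + C² ≥ 0` satisfies `C ≥ C²` on the orthogonal complement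
of the kernel of `1 + C`. -/
theorem norm_sq_le_inner_of_contraction {C : H →L[ℝ] H} (hs : ∀ u v, ⟪C u, v⟫ = ⟪u, C v⟫)
    (hc : ∀ u, ‖C u‖ ≤ ‖u‖) (hp : ∀ u, 0 ≤ ⟪C u, u⟫ + ‖C u‖ ^ 2) {w : H}
    (hw : ∀ v, C v = -v → ⟪w, v⟫ = 0) : ‖C w‖ ^ 2 ≤ ⟪C w, w⟫ := by
  have hcs : ∀ u, |⟪C u, u⟫| ≤ ‖u‖ ^ 2 := fun u =>
    (abs_real_inner_le_norm _ _).trans (by nlinarith [hc u, norm_nonneg u])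
  -- On the range of `1 + C` the form of `C` is nonnegative: it equals `⟨Cu,u⟩ + 2‖Cu‖² +
  -- ⟨C(Cu),Cu⟩`, and the last term is at least `-‖Cu‖²`.
  have hrange : ∀ u, 0 ≤ ⟪C (u + C u), u + C u⟫ := by
    intro u
    have h1 := (abs_le.1 (hcs (C u))).1
    have h2 := hp u
    rw [map_add, inner_add_left, inner_add_right, inner_add_right, hs (C u) u,
      real_inner_self_eq_norm_sq]
    linarith
  -- The orthogonal complement of the kernel of `1 + C` is the closure of its range, to which
  -- positivity extends by continuity.
  have hclosure : ∀ y, (∀ v, C v = -v → ⟪y, v⟫ = 0) → 0 ≤ ⟪C y, y⟫ := by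
    intro y hy
    set R : Submodule ℝ H := LinearMap.range ((1 + C : H →L[ℝ] H) : H →ₗ[ℝ] H) with hR
    have hmem : y ∈ R.topologicalClosure := by
      rw [← Submodule.orthogonal_orthogonal_eq_closure, Submodule.mem_orthogonal]
      intro v hv
      rw [real_inner_comm]
      refine hy v ?_
      have h1 : ∀ u, ⟪v + C v, u⟫ = 0 := by
        intro u
        have h2 := (Submodule.mem_orthogonal R v).1 hv (u + C u) ⟨u, by simp⟩
        rw [inner_add_left, hs, ← inner_add_right, real_inner_comm] at h2
        exact h2
      exact eq_neg_of_add_eq_zero_right (inner_self_eq_zero.1 (h1 _))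
    have hcl : IsClosed {y : H | 0 ≤ ⟪C y, y⟫} :=
      isClosed_le continuous_const (C.continuous.inner continuous_id)
    refine (closure_minimal ?_ hcl) hmem
    rintro _ ⟨u, rfl⟩
    exact hrange u
  -- For `w - Cw` the form equals `⟨Cw,w⟩ - 2‖Cw‖² + ⟨C(Cw),Cw⟩`, which is at most `⟨Cw,w⟩ - ‖Cw‖²`.
  have h1 := hclosure (w - C w) fun v hv => by
    rw [inner_sub_left, hs, hv, inner_neg_right, hw v hv]
    simp
  rw [map_sub, inner_sub_left, inner_sub_right, inner_sub_right, hs (C w) w,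
    real_inner_self_eq_norm_sq] at h1
  have h2 : ⟪C (C w), C w⟫ ≤ ‖C w‖ ^ 2 := (abs_le.1 (hcs (C w))).2
  linarith

variable {A : H →ₗ.[ℝ] H}

/-- The resolvent of a symmetric operator. -/
theorem exists_resolvent (hs : ∀ u v : A.domain, ⟪A u, (v : H)⟫ = ⟪(u : H), A v⟫) {t : ℝ}
    (ht : t ∉ pSpectrum A) : ∃ G : H →L[ℝ] H, (∀ u v, ⟪G u, v⟫ = ⟪u, G v⟫) ∧
      (∀ w, ∃ u : A.domain, G w = u ∧ A u - t • (u : H) = w) ∧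
      ∀ u : A.domain, G (A u - t • (u : H)) = u := by
  have hbij : Function.Bijective fun u : A.domain => A u - t • (u : H) := not_not.1 ht
  set T : A.domain →ₗ[ℝ] H := A.toFun - t • A.domain.subtype with hT
  have hTa : ∀ u, T u = A u - t • (u : H) := fun u => rfl
  set e := LinearEquiv.ofBijective T hbij with he
  set G₀ : H →ₗ[ℝ] H := A.domain.subtype ∘ₗ (e.symm : H →ₗ[ℝ] A.domain) with hG
  have hG₀ : ∀ u : A.domain, G₀ (A u - t • (u : H)) = u := fun u => by
    rw [← hTa]
    exact congrArg Subtype.val (e.symm_apply_apply u)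
  have hsymm : G₀.IsSymmetric := by
    intro w w'
    obtain ⟨u, rfl⟩ := hbij.2 w
    obtain ⟨v, rfl⟩ := hbij.2 w'
    simp only [hG₀]
    rw [inner_sub_right, inner_sub_left, hs, real_inner_smul_left, real_inner_smul_right]
  -- Boundedness comes from the Hellinger-Toeplitz theorem: the inverse is symmetric and defined
  -- everywhere.
  refine ⟨⟨G₀, hsymm.continuous⟩, hsymm, fun w => ⟨e.symm w, rfl, ?_⟩, hG₀⟩
  rw [← hTa]
  exact e.apply_symm_apply w

/-- A symmetric operator with a regular point is regular wherever it is bounded below. -/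
theorem notMem_pSpectrum_of_bounded_below
    (hs : ∀ u v : A.domain, ⟪A u, (v : H)⟫ = ⟪(u : H), A v⟫) {t₀ : ℝ} (ht₀ : t₀ ∉ pSpectrum A)
    {t ε : ℝ} (hε : 0 < ε) (hb : ∀ u : A.domain, ε * ‖(u : H)‖ ≤ ‖A u - t • (u : H)‖) :
    t ∉ pSpectrum A := by
  obtain ⟨G, hGs, hG1, hG2⟩ := exists_resolvent hs ht₀
  set s := t - t₀ with hst
  -- Since `A - t = S (A - t₀)`, it suffices to invert the bounded symmetric `S`. The lower bound
  -- makes its range closed and its kernel trivial, and by symmetry the range is dense.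
  set S : H →L[ℝ] H := 1 - s • G with hS
  have hSa : ∀ y, S y = y - s • G y := fun y => by simp [hS]
  have hSA : ∀ u : A.domain, S (A u - t₀ • (u : H)) = A u - t • (u : H) := by
    intro u
    rw [hSa, hG2, hst]
    module
  have hlow : ∀ y, ‖y‖ ≤ (1 + |s| / ε) * ‖S y‖ := by
    intro y
    obtain ⟨u, hu1, hu2⟩ := hG1 y
    have h1 := hb u
    rw [← hSA, hu2, ← hu1] at h1
    have h2 : ‖y‖ ≤ ‖S y‖ + |s| * ‖G y‖ := by
      have : y = S y + s • G y := by rw [hSa]; abel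
      calc ‖y‖ = ‖S y + s • G y‖ := by rw [← this]
        _ ≤ _ := (norm_add_le _ _).trans (by rw [norm_smul, Real.norm_eq_abs])
    have h3 : |s| * ‖G y‖ ≤ |s| / ε * ‖S y‖ := by
      rw [div_mul_eq_mul_div, mul_div_assoc]
      refine mul_le_mul_of_nonneg_left ?_ (abs_nonneg s)
      rw [le_div_iff₀ hε, mul_comm]
      exact h1
    linarith
  have hant : AntilipschitzWith ⟨1 + |s| / ε, by positivity⟩ S :=
    AddMonoidHomClass.antilipschitz_of_bound S hlow
  have hclosed : IsClosed (LinearMap.range (S : H →ₗ[ℝ] H) : Set H) := by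
    have := hant.isClosed_range S.uniformContinuous
    exact this
  have hbot : (LinearMap.range (S : H →ₗ[ℝ] H))ᗮ = ⊥ := by
    rw [Submodule.eq_bot_iff]
    intro v hv
    have h1 : S v = 0 := by
      rw [← inner_self_eq_zero (𝕜 := ℝ)]
      have h2 := (Submodule.mem_orthogonal _ v).1 hv (S (S v)) ⟨_, rfl⟩
      rw [hSa (S v), inner_sub_left, real_inner_smul_left, hGs, ← real_inner_smul_right,
        ← inner_sub_right, ← hSa] at h2
      exact h2
    have h2 := hlow v
    rw [h1, norm_zero, mul_zero] at h2
    exact norm_le_zero_iff.1 h2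
  have hsurj : Function.Surjective S := by
    have : (LinearMap.range (S : H →ₗ[ℝ] H)) = ⊤ := by
      have h1 := Submodule.orthogonal_orthogonal_eq_closure (LinearMap.range (S : H →ₗ[ℝ] H))
      rw [hbot, Submodule.bot_orthogonal_eq_top, hclosed.submodule_topologicalClosure_eq] at h1
      exact h1.symm
    exact LinearMap.range_eq_top.1 this
  refine not_not.2 ⟨fun u v huv => ?_, fun w => ?_⟩
  · simp only at huv
    have h1 := hb (u - v)
    have h2 : A (u - v) - t • ((u - v : A.domain) : H) = 0 := by
      rw [A.map_sub, Submodule.coe_sub, smul_sub, ← sub_eq_zero.2 huv]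
      abel
    rw [h2, norm_zero] at h1
    have h3 : ‖((u - v : A.domain) : H)‖ ≤ 0 := by
      by_contra! h
      nlinarith [mul_pos hε h]
    rw [← sub_eq_zero]
    exact Subtype.ext (norm_le_zero_iff.1 h3)
  · obtain ⟨y, rfl⟩ := hsurj w
    obtain ⟨u, -, hu⟩ := hG1 y
    exact ⟨u, by simp only; rw [← hSA, hu]⟩

/-- A symmetric operator is bounded below by the distance to the spectrum. -/
theorem mul_norm_le_of_gap (hs : ∀ u v : A.domain, ⟪A u, (v : H)⟫ = ⟪(u : H), A v⟫) {c r : ℝ}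
    (hr : 0 < r) (hgap : ∀ t, |t - c| < r → t ∉ pSpectrum A) (u : A.domain) :
    r * ‖(u : H)‖ ≤ ‖A u - c • (u : H)‖ := by
  obtain ⟨G, hGs, hG1, hG2⟩ := exists_resolvent hs (hgap c (by simpa using hr))
  suffices hM : ‖G‖ ≤ r⁻¹ by
    have h1 := G.le_opNorm (A u - c • (u : H))
    rw [hG2] at h1
    calc r * ‖(u : H)‖ ≤ r * (r⁻¹ * ‖A u - c • (u : H)‖) := by
          gcongr
          exact h1.trans (by gcongr)
      _ = _ := by rw [← mul_assoc, mul_inv_cancel₀ hr.ne', one_mul]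
  -- If `M = ‖G‖ > 1/r`, the points `c ± 1/M` are regular, so `1 ∓ M⁻¹ G` are both bounded below,
  -- and so is their product `1 - M⁻² G²`. This pushes `‖G‖` strictly below `M`.
  by_contra! hM
  set M := ‖G‖ with hMdef
  have hM0 : 0 < M := lt_trans (inv_pos.2 hr) hM
  have hMr : M⁻¹ < r := inv_lt_of_inv_lt₀ hr hM
  have hkey : ∀ σ : ℝ, |σ| = M⁻¹ → ∃ κ > 0, ∀ w, ‖w‖ ≤ κ * ‖w - σ • G w‖ := by
    intro σ hσ
    obtain ⟨G', -, -, hG'⟩ := exists_resolvent hs (hgap (c + σ) (by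
      rw [add_sub_cancel_left, hσ]; exact hMr))
    refine ⟨1 + |σ| * ‖G'‖, by positivity, fun w => ?_⟩
    obtain ⟨u, hu1, hu2⟩ := hG1 w
    have h1 : A u - (c + σ) • (u : H) = w - σ • G w := by
      rw [← hu2, hG2]; module
    have h2 : G' (w - σ • G w) = G w := by rw [← h1, hG', hu1]
    have h3 := G'.le_opNorm (w - σ • G w)
    rw [h2] at h3
    calc ‖w‖ = ‖(w - σ • G w) + σ • G w‖ := by rw [sub_add_cancel]
      _ ≤ ‖w - σ • G w‖ + |σ| * ‖G w‖ := (norm_add_le _ _).trans (by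
          rw [norm_smul, Real.norm_eq_abs])
      _ ≤ ‖w - σ • G w‖ + |σ| * (‖G'‖ * ‖w - σ • G w‖) := by gcongr
      _ = _ := by ring
  obtain ⟨κ, hκ, h1⟩ := hkey M⁻¹ (abs_of_pos (inv_pos.2 hM0))
  obtain ⟨κ', hκ', h2⟩ := hkey (-M⁻¹) (by rw [abs_neg, abs_of_pos (inv_pos.2 hM0)])
  set q := (κ * κ') ^ 2 with hq
  have hq0 : 0 < q := by positivity
  have h3 : ∀ w, ‖w‖ ^ 2 ≤ q * (‖w‖ ^ 2 - M⁻¹ ^ 2 * ‖G w‖ ^ 2) := by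
    intro w
    have e1 : ‖w‖ ≤ κ * κ' * ‖w - M⁻¹ ^ 2 • G (G w)‖ := by
      have e2 := h2 (w - M⁻¹ • G w)
      have e3 : w - M⁻¹ • G w - -M⁻¹ • G (w - M⁻¹ • G w) = w - M⁻¹ ^ 2 • G (G w) := by
        rw [map_sub, map_smul]; module
      rw [e3] at e2
      calc ‖w‖ ≤ κ * ‖w - M⁻¹ • G w‖ := h1 w
        _ ≤ κ * (κ' * ‖w - M⁻¹ ^ 2 • G (G w)‖) := by gcongr
        _ = _ := by ring
    have e4 : ‖w - M⁻¹ ^ 2 • G (G w)‖ ^ 2 ≤ ‖w‖ ^ 2 - M⁻¹ ^ 2 * ‖G w‖ ^ 2 := by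
      rw [norm_sub_sq_real, real_inner_smul_right, ← hGs, real_inner_self_eq_norm_sq, norm_smul,
        Real.norm_of_nonneg (by positivity)]
      have e5 : M⁻¹ * ‖G (G w)‖ ≤ ‖G w‖ := by
        rw [inv_mul_le_iff₀ hM0]; exact G.le_opNorm _
      have e6 : (M⁻¹ * ‖G (G w)‖) ^ 2 ≤ ‖G w‖ ^ 2 := by gcongr
      have e7 : (M⁻¹ ^ 2 * ‖G (G w)‖) ^ 2 = M⁻¹ ^ 2 * (M⁻¹ * ‖G (G w)‖) ^ 2 := by ring
      rw [e7]
      nlinarith [mul_le_mul_of_nonneg_left e6 (sq_nonneg M⁻¹)]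
    calc ‖w‖ ^ 2 ≤ (κ * κ' * ‖w - M⁻¹ ^ 2 • G (G w)‖) ^ 2 := by gcongr
      _ = q * ‖w - M⁻¹ ^ 2 • G (G w)‖ ^ 2 := by rw [hq]; ring
      _ ≤ _ := by gcongr
  have h4 : ∀ w, ‖G w‖ ^ 2 ≤ M ^ 2 * (1 - q⁻¹) * ‖w‖ ^ 2 := by
    intro w
    have h5 := h3 w
    rw [← inv_mul_le_iff₀ hq0] at h5
    have h6 : M⁻¹ ^ 2 * ‖G w‖ ^ 2 ≤ (1 - q⁻¹) * ‖w‖ ^ 2 := by linarith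
    rw [inv_pow, inv_mul_le_iff₀ (by positivity)] at h6
    linarith
  have h5 : ‖G‖ ≤ √(M ^ 2 * (1 - q⁻¹)) := by
    refine G.opNorm_le_bound (Real.sqrt_nonneg _) fun w => ?_
    refine Real.le_sqrt_of_sq_le (h4 w) |>.trans (le_of_eq ?_)
    rw [Real.sqrt_mul' _ (sq_nonneg _), Real.sqrt_sq (norm_nonneg _)]
  rw [← hMdef] at h5
  rw [Real.le_sqrt' hM0] at h5
  have : 0 < M ^ 2 * q⁻¹ := by positivity
  linarith

/-- If `A` has no spectrum within distance `r` of `c`, and `A ≥ c - r` on `e^⊥` where `A e = 0`, then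
`A ≥ c + r` on the complement of `e` and of the kernel of `A - (c - r)`. -/
theorem le_inner_of_gap (hs : ∀ u v : A.domain, ⟪A u, (v : H)⟫ = ⟪(u : H), A v⟫) {c r : ℝ}
    (hr : 0 < r) (hc0 : c ≠ 0) (hc : c ∉ pSpectrum A)
    (hgap : ∀ u : A.domain, r * ‖(u : H)‖ ≤ ‖A u - c • (u : H)‖) {e : A.domain}
    (he : A e = 0) (hee : ⟪(e : H), (e : H)⟫ • (e : H) = e)
    (hpos : ∀ u : A.domain, ⟪(e : H), (u : H)⟫ = 0 → (c - r) * ‖(u : H)‖ ^ 2 ≤ ⟪A u, (u : H)⟫)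
    {z : A.domain} (hez : ⟪(e : H), (z : H)⟫ = 0)
    (hz : ∀ v : A.domain, A v = (c - r) • (v : H) → ⟪(z : H), v⟫ = 0) :
    (c + r) * ‖(z : H)‖ ^ 2 ≤ ⟪A z, (z : H)⟫ := by
  obtain ⟨G, hGs, hG1, hG2⟩ := exists_resolvent hs hc
  -- The hypothesis on `e` holds both for a unit vector and for `e = 0`; both cases occur in the
  -- applications.
  have hee' : ∀ u : H, ⟪(e : H), (e : H)⟫ * ⟪(e : H), u⟫ = ⟪(e : H), u⟫ := fun u => by
    rw [← real_inner_smul_left, hee]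
  have heG : ∀ v, ⟪(e : H), v⟫ = 0 → ⟪(e : H), G v⟫ = 0 := by
    intro v hv
    obtain ⟨u, hu1, hu2⟩ := hG1 v
    rw [← hu2, inner_sub_right, ← hs, he, inner_zero_left, real_inner_smul_right, zero_sub,
      neg_eq_zero, ← hu1] at hv
    exact (mul_eq_zero.1 hv).resolve_left hc0
  set Q : H →L[ℝ] H := 1 - InnerProductSpace.rankOne ℝ (e : H) (e : H) with hQ
  have hQa : ∀ u, Q u = u - ⟪(e : H), u⟫ • (e : H) := fun u => by simp [hQ]
  have heQ : ∀ u, ⟪(e : H), Q u⟫ = 0 := fun u => by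
    rw [hQa, inner_sub_right, real_inner_smul_right, mul_comm, hee', sub_self]
  have hQ0 : ∀ u, ⟪(e : H), u⟫ = 0 → Q u = u := fun u hu => by rw [hQa, hu, zero_smul, sub_zero]
  have hQr : ∀ u v, ⟪(e : H), v⟫ = 0 → ⟪v, Q u⟫ = ⟪v, u⟫ := fun u v hv => by
    rw [hQa, inner_sub_right, real_inner_smul_right, real_inner_comm (e : H) v, hv, mul_zero, sub_zero]
  have hQn : ∀ u, ‖Q u‖ ≤ ‖u‖ := fun u => by
    have h1 : ‖Q u‖ ^ 2 = ⟪Q u, u⟫ := by rw [← real_inner_self_eq_norm_sq, hQr _ _ (heQ u)]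
    have h2 := real_inner_le_norm (Q u) u
    by_contra! h
    nlinarith [norm_nonneg u]
  have hGn : ∀ y, r * ‖G y‖ ≤ ‖y‖ := fun y => by
    obtain ⟨u, hu1, hu2⟩ := hG1 y
    rw [hu1, ← hu2]
    exact hgap u
  -- The rescaled resolvent cut down to `e^⊥` is a contraction by the gap; there `A ≥ c - r` becomes
  -- `C + C² ≥ 0`, and `-1`-eigenvectors of `C` correspond to eigenvectors of `A` for `c - r`.
  set C : H →L[ℝ] H := r • (G * Q) with hC
  have hCa : ∀ u, C u = r • G (Q u) := fun u => rfl
  have hCs : ∀ u v, ⟪C u, v⟫ = ⟪u, C v⟫ := by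
    intro u v
    rw [hCa, hCa, real_inner_smul_left, real_inner_smul_right, ← hQr v _ (heG _ (heQ u)),
      real_inner_comm (G (Q v)) u, ← hQr u _ (heG _ (heQ v)), hGs,
      real_inner_comm (Q u) (G (Q v))]
  have key := norm_sq_le_inner_of_contraction (C := C) hCs
    (fun u => by
      rw [hCa, norm_smul, Real.norm_of_nonneg hr.le]
      exact (hGn _).trans (hQn u))
    (fun u => by
      obtain ⟨x, hx1, hx2⟩ := hG1 (Q u)
      have hex : ⟪(e : H), (x : H)⟫ = 0 := by rw [← hx1]; exact heG _ (heQ u)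
      have h1 := hpos x hex
      rw [hCa, hx1, norm_smul, Real.norm_of_nonneg hr.le, real_inner_smul_left, ← hQr u _ hex,
        ← hx2, inner_sub_right, real_inner_smul_right, real_inner_self_eq_norm_sq,
        real_inner_comm]
      nlinarith [mul_nonneg hr.le (sub_nonneg.2 h1)])
    -- With this `w` one has `C w = z`, so the contraction lemma reads `‖z‖² ≤ r⁻¹ ⟨(A - c) z, z⟩`.
    (w := r⁻¹ • (A z - c • (z : H)))
    (fun v hv => by
      have hev : ⟪(e : H), v⟫ = 0 := by
        have h1 : v = -C v := by rw [hv, neg_neg]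
        rw [h1, hCa, inner_neg_right, real_inner_smul_right, heG _ (heQ v), mul_zero, neg_zero]
      rw [hCa, hQ0 v hev] at hv
      obtain ⟨x, hx1, hx2⟩ := hG1 v
      have hvx : v = ((-r) • x : A.domain) := by
        rw [Submodule.coe_smul, neg_smul, ← hx1, hv, neg_neg]
      have hAv : A ((-r) • x) = (c - r) • (((-r) • x : A.domain) : H) := by
        have h2 : A x = v + c • (x : H) := by rw [← hx2, sub_add_cancel]
        rw [A.map_smul, h2, hvx, Submodule.coe_smul]
        module
      have h3 := hz _ hAv
      rw [← hvx] at h3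
      rw [real_inner_smul_left, inner_sub_left, real_inner_smul_left, h3]
      have h4 : ⟪A z, v⟫ = 0 := by
        rw [hvx, hs, hAv, real_inner_smul_right, ← hvx, h3, mul_zero]
      rw [h4]
      simp)
  have heA : ⟪(e : H), A z - c • (z : H)⟫ = 0 := by
    rw [inner_sub_right, ← hs, he, inner_zero_left, real_inner_smul_right, hez, mul_zero, sub_zero]
  have hCw : C (r⁻¹ • (A z - c • (z : H))) = z := by
    rw [map_smul, hCa, hQ0 _ heA, hG2, smul_smul, inv_mul_cancel₀ hr.ne', one_smul]
  rw [hCw, real_inner_smul_right, le_inv_mul_iff₀ hr, inner_sub_right, real_inner_smul_right,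
    real_inner_self_eq_norm_sq, real_inner_comm] at key
  linarith

/-- If `A` is nowhere regular, then all the terms of the list of its spectrum vanish. -/
theorem increasingList_univ (i : ℕ) : increasingList Set.univ i = 0 := by
  induction i with
  -- The infimum of a set of reals unbounded below is 0 by convention.
  | zero => simp [increasingList]
  | succ i ih =>
    rw [increasingList, ih]
    have : {t : ℝ | t ∈ Set.univ ∧ (0 : ℝ) < t} = Set.Ioi 0 := by ext; simp
    rw [this, csInf_Ioi]

/-- The bound by the third element of the spectrum, on the complement of the first two
eigenspaces. -/
theorem increasingList_two_mul_le (hs : ∀ u v : A.domain, ⟪A u, (v : H)⟫ = ⟪(u : H), A v⟫)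
    (hpos : ∀ u : A.domain, 0 ≤ ⟪A u, (u : H)⟫) {e : A.domain} (he1 : ‖(e : H)‖ = 1)
    (he : A e = 0) (hker : ∀ u : A.domain, A u = 0 → ∃ a : ℝ, (u : H) = a • (e : H))
    (hone : ∃ v : A.domain, (v : H) ≠ 0 ∧ A v = v)
    (hB : (∀ u : A.domain, ⟪A u, (u : H)⟫ ≤ ‖A u‖ ^ 2) ∨
      ∀ u : A.domain, ‖(u : H)‖ ^ 2 - ⟪(e : H), (u : H)⟫ ^ 2 ≤ ⟪A u, (u : H)⟫)
    {z : A.domain} (hez : ⟪(e : H), (z : H)⟫ = 0)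
    (hz : ∀ v : A.domain, A v = v → ⟪(z : H), v⟫ = 0) :
    increasingList (pSpectrum A) 2 * ‖(z : H)‖ ^ 2 ≤ ⟪A z, (z : H)⟫ := by
  -- Without any regular point the listed value is 0, and the claim reduces to nonnegativity of `A`.
  by_cases hreg : ∃ t₀, t₀ ∉ pSpectrum A
  swap
  · have huniv : pSpectrum A = Set.univ := Set.eq_univ_of_forall fun t => by
      by_contra h
      exact hreg ⟨t, h⟩
    rw [huniv, increasingList_univ, zero_mul]
    exact hpos z
  obtain ⟨t₀, ht₀⟩ := hreg
  have heself : ⟪(e : H), (e : H)⟫ = 1 := by rw [real_inner_self_eq_norm_sq, he1, one_pow]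
  have hmink : ∀ u : A.domain, ⟪(e : H), (u : H)⟫ = 0 → ‖(u : H)‖ ^ 2 ≤ ⟪A u, (u : H)⟫ := by
    intro u hu
    rcases hB with hB | hB
    -- The inequality `⟨Au,u⟩ ≤ ‖Au‖²` says that `‖(A - 1/2)u‖ ≥ ‖u‖/2`, which excludes spectrum in
    -- `(0,1)`. The gap lemma with `c = r = 1/2` and `e = 0` then gives `A ≥ 1` off the kernel.
    · have hhalf : ∀ u : A.domain, (1 / 2 : ℝ) * ‖(u : H)‖ ≤ ‖A u - (1 / 2 : ℝ) • (u : H)‖ := by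
        intro u
        refine le_of_sq_le_sq ?_ (norm_nonneg _)
        rw [norm_sub_sq_real, real_inner_smul_right, norm_smul, Real.norm_of_nonneg (by norm_num)]
        nlinarith [hB u]
      have h1 := le_inner_of_gap hs (c := 1 / 2) (r := 1 / 2) (by norm_num) (by norm_num)
        (notMem_pSpectrum_of_bounded_below hs ht₀ (by norm_num) hhalf) hhalf (e := 0)
        A.map_zero (by simp) (fun u _ => by simpa using hpos u) (z := u) (by simp)
        (fun v hv => by
          rw [sub_self, zero_smul] at hv
          obtain ⟨a, ha⟩ := hker v hv
          rw [ha, real_inner_smul_right, real_inner_comm, hu, mul_zero])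
      linarith
    · have := hB u
      rw [hu] at this
      linarith
  have hnonneg : ∀ t < 0, t ∉ pSpectrum A := by
    intro t ht
    refine notMem_pSpectrum_of_bounded_below hs ht₀ (ε := -t) (by linarith) fun u => ?_
    rcases eq_or_ne (u : H) 0 with h0 | h0
    · rw [h0, norm_zero, mul_zero]; exact norm_nonneg _
    have h1 := real_inner_le_norm (A u - t • (u : H)) (u : H)
    rw [inner_sub_left, real_inner_smul_left, real_inner_self_eq_norm_sq] at h1
    have h2 := hpos u
    refine le_of_mul_le_mul_right ?_ (norm_pos_iff.2 h0)
    linarith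
  have hdec : ∀ u : A.domain, ∃ (a : ℝ) (u' : A.domain), u = a • e + u' ∧
      ⟪(e : H), (u' : H)⟫ = 0 := by
    intro u
    refine ⟨⟪(e : H), (u : H)⟫, u - ⟪(e : H), (u : H)⟫ • e, by abel, ?_⟩
    rw [Submodule.coe_sub, Submodule.coe_smul, inner_sub_right, real_inner_smul_right, heself,
      mul_one, sub_self]
  -- `A - t` preserves the orthogonal splitting into `e` and `e^⊥`: it is `-t` on the former and at
  -- least `1 - t` on the latter.
  have hgap01 : ∀ t, 0 < t → t < 1 → t ∉ pSpectrum A := by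
    intro t h0 h1
    refine notMem_pSpectrum_of_bounded_below hs ht₀ (ε := min t (1 - t))
      (lt_min h0 (by linarith)) fun u => ?_
    obtain ⟨a, u', rfl, hu'⟩ := hdec u
    set ε := min t (1 - t) with hε
    have hε0 : 0 < ε := lt_min h0 (by linarith)
    have e1 : A (a • e + u') - t • ((a • e + u' : A.domain) : H) =
        (-(t * a)) • (e : H) + (A u' - t • (u' : H)) := by
      rw [A.map_add, A.map_smul, he, Submodule.coe_add, Submodule.coe_smul]
      module
    have e2 : ⟪(e : H), A u' - t • (u' : H)⟫ = 0 := by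
      rw [inner_sub_right, ← hs, he, inner_zero_left, real_inner_smul_right, hu', mul_zero,
        sub_zero]
    have e3 : (1 - t) * ‖(u' : H)‖ ≤ ‖A u' - t • (u' : H)‖ := by
      rcases eq_or_ne (u' : H) 0 with h0 | h0
      · rw [h0, norm_zero, mul_zero]; exact norm_nonneg _
      have h1 := real_inner_le_norm (A u' - t • (u' : H)) (u' : H)
      rw [inner_sub_left, real_inner_smul_left, real_inner_self_eq_norm_sq] at h1
      have h2 := hmink u' hu'
      refine le_of_mul_le_mul_right ?_ (norm_pos_iff.2 h0)
      linarith
    refine le_of_sq_le_sq ?_ (norm_nonneg _)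
    rw [e1, Submodule.coe_add, Submodule.coe_smul, mul_pow, norm_add_sq_real, norm_add_sq_real,
      real_inner_smul_left, real_inner_smul_left, hu', e2, norm_smul, norm_smul, he1,
      Real.norm_eq_abs, Real.norm_eq_abs, abs_neg, abs_mul, abs_of_pos h0]
    have e4 : (ε * ‖(u' : H)‖) ^ 2 ≤ ‖A u' - t • (u' : H)‖ ^ 2 := by
      gcongr
      exact (mul_le_mul_of_nonneg_right (min_le_right _ _) (norm_nonneg _)).trans e3
    have e5 : (ε * |a|) ^ 2 ≤ (t * |a|) ^ 2 := by
      gcongr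
      exact min_le_left _ _
    linarith
  have hmem : ∀ t, (∃ v : A.domain, (v : H) ≠ 0 ∧ A v = t • (v : H)) → t ∈ pSpectrum A := by
    rintro t ⟨v, hv0, hv⟩ hbij
    have : v = 0 := hbij.1 (by simp [hv])
    exact hv0 (by rw [this]; rfl)
  have h0mem : (0 : ℝ) ∈ pSpectrum A := hmem 0 ⟨e, fun h => by
    rw [h, norm_zero] at he1; exact zero_ne_one he1, by rw [he, zero_smul]⟩
  have h1mem : (1 : ℝ) ∈ pSpectrum A := hmem 1 (by simpa using hone)
  have hl0 : increasingList (pSpectrum A) 0 = 0 := by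
    rw [increasingList]
    exact IsLeast.csInf_eq ⟨h0mem, fun t ht => by
      by_contra! h
      exact hnonneg t h ht⟩
  have hl1 : increasingList (pSpectrum A) 1 = 1 := by
    rw [increasingList, hl0]
    exact IsLeast.csInf_eq ⟨⟨h1mem, zero_lt_one⟩, fun t ht => by
      by_contra! h
      exact hgap01 t ht.2 h ht.1⟩
  set l := increasingList (pSpectrum A) 2 with hl
  rw [increasingList, hl1] at hl
  rcases le_or_gt l 1 with hle | hgt
  -- This case includes an empty set of spectral points above 1, whose infimum is 0 by convention.
  · refine le_trans ?_ (hmink z hez)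
    nlinarith [sq_nonneg ‖(z : H)‖]
  -- The interval between 1 and `l` is free of spectrum; the gap lemma is applied at its midpoint
  -- with half its length as radius, so that `c - r = 1` and `c + r = l`.
  · have hgap : ∀ t, |t - (1 + l) / 2| < (l - 1) / 2 → t ∉ pSpectrum A := by
      intro t ht hmem
      rw [abs_lt] at ht
      have h1 : l ≤ t := by
        rw [hl]
        exact csInf_le ⟨1, fun s hs => hs.2.le⟩ ⟨hmem, by linarith⟩
      linarith
    have h2 := le_inner_of_gap hs (c := (1 + l) / 2) (r := (l - 1) / 2) (by linarith)
      (by linarith) (hgap _ (by rw [sub_self, abs_zero]; linarith))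
      (mul_norm_le_of_gap hs (by linarith) hgap) he (by rw [heself, one_smul])
      (fun u hu => by
        have e1 : (1 + l) / 2 - (l - 1) / 2 = 1 := by ring
        rw [e1, one_mul]
        exact hmink u hu) hez (fun v hv => hz v (by
        have e1 : (1 + l) / 2 - (l - 1) / 2 = 1 := by ring
        rw [hv, e1, one_smul]))
    have e1 : (1 + l) / 2 + (l - 1) / 2 = l := by ring
    rwa [e1] at h2

end Spectral

end ConvexStability

end

open MeasureTheory Topology
open scoped Pointwise Gradient RealInnerProductSpace

noncomputable section

namespace ConvexStability

open InnerProductSpace (rankOne)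

instance (n : ℕ) : (sphMeasure n).IsOpenPosMeasure :=
  inferInstanceAs (volume : Measure (E n)).toSphere.IsOpenPosMeasure

theorem integral_pos_of_continuous {n : ℕ} (hn : n ≠ 0) {f : Sph n → ℝ} (hf : Continuous f)
    (hpos : ∀ x, 0 < f x) : 0 < ∫ x, f x ∂(sphMeasure n) := by
  have := nonempty_sph hn
  rw [integral_pos_iff_support_of_nonneg (fun x => (hpos x).le) (integrable_sph hf),
    Set.eq_univ_of_forall fun x => Function.mem_support.2 (hpos x).ne']
  exact isOpen_univ.measure_pos _ Set.univ_nonempty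

theorem IsPosC2.integral_mul_detHess_pos {n : ℕ} {h : Sph n → ℝ} (hh : IsPosC2 h) (hn : n ≠ 0) :
    0 < ∫ x, h x * detHess h x ∂(sphMeasure n) :=
  integral_pos_of_continuous hn (hh.isC2.continuous.mul (continuous_detHess hh.isC2)) fun x =>
    mul_pos (hh.pos x) (hh.detHess_pos x)

/-! ### Support functions of ellipsoids. -/

section Ellipsoid

variable {n : ℕ}

/-- The support function of an ellipsoid. -/
def ellipsoidFn (Q : E n →L[ℝ] E n) (x : Sph n) : ℝ := √⟪Q (x : E n), (x : E n)⟫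

variable {Q : E n →L[ℝ] E n}

theorem homExt_ellipsoidFn (Q : E n →L[ℝ] E n) :
    homExt (ellipsoidFn Q) = fun y => √⟪Q y, y⟫ :=
  homExt_ext (by simp) fun r hr x => by
    rw [map_smul, real_inner_smul_left, real_inner_smul_right, ← mul_assoc, ← sq,
      Real.sqrt_mul (sq_nonneg r), Real.sqrt_sq hr.le, ellipsoidFn]

theorem isC2_ellipsoidFn (hpos : ∀ u ≠ 0, 0 < ⟪Q u, u⟫) : IsC2 (ellipsoidFn Q) := by
  rw [IsC2, homExt_ellipsoidFn]
  refine ContDiffOn.sqrt ?_ fun y hy => (hpos y hy).ne'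
  exact (Q.contDiff.inner ℝ contDiff_id).contDiffOn

theorem gradient_ellipsoidFn (hs : ∀ u v, ⟪Q u, v⟫ = ⟪u, Q v⟫) (hpos : ∀ u ≠ 0, 0 < ⟪Q u, u⟫)
    {y : E n} (hy : y ≠ 0) : ∇ (homExt (ellipsoidFn Q)) y = (√⟪Q y, y⟫)⁻¹ • Q y := by
  refine ext_inner_right ℝ fun u => ?_
  rw [inner_gradient, homExt_ellipsoidFn]
  have h1 := (Q.hasFDerivAt (x := y)).inner ℝ (hasFDerivAt_id y)
  have h2 := (h1.sqrt (hpos y hy).ne').fderiv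
  simp only [id_eq] at h2
  rw [h2]
  simp only [smul_apply, ContinuousLinearMap.comp_apply, ContinuousLinearMap.prod_apply,
    fderivInnerCLM_apply, smul_eq_mul, ContinuousLinearMap.id_apply, real_inner_smul_left]
  rw [hs u y, real_inner_comm (Q y) u]
  field_simp
  ring

theorem hess_ellipsoidFn (hs : ∀ u v, ⟪Q u, v⟫ = ⟪u, Q v⟫) (hpos : ∀ u ≠ 0, 0 < ⟪Q u, u⟫)
    (x : Sph n) : hess (homExt (ellipsoidFn Q)) (x : E n) =
      (ellipsoidFn Q x)⁻¹ • Q - (ellipsoidFn Q x ^ 3)⁻¹ • rankOne ℝ (Q x) (Q x) := by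
  have hx := sph_ne_zero x
  have hH : 0 < ellipsoidFn Q x := Real.sqrt_pos.2 (hpos _ hx)
  have hev : ∇ (homExt (ellipsoidFn Q)) =ᶠ[𝓝 (x : E n)] fun y => (√⟪Q y, y⟫)⁻¹ • Q y := by
    filter_upwards [isOpen_compl_singleton.mem_nhds hx] with y hy
    exact gradient_ellipsoidFn hs hpos hy
  have h0 := ((isC2_ellipsoidFn hpos).differentiableAt hx).hasFDerivAt
  rw [homExt_ellipsoidFn] at h0
  have h1 := ((hasDerivAt_inv hH.ne').comp_hasFDerivAt (x : E n) h0).smul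
    (Q.hasFDerivAt (x := (x : E n)))
  rw [hess, hev.fderiv_eq]
  refine h1.fderiv.trans ?_
  have h2 : ∀ u, fderiv ℝ (fun y => √⟪Q y, y⟫) (x : E n) u =
      (ellipsoidFn Q x)⁻¹ * ⟪Q (x : E n), u⟫ := by
    intro u
    rw [← homExt_ellipsoidFn, ← inner_gradient, gradient_ellipsoidFn hs hpos hx,
      real_inner_smul_left, ellipsoidFn]
  have h3 : √⟪Q (x : E n), (x : E n)⟫ = ellipsoidFn Q x := rfl
  ext1 u
  simp only [add_apply, sub_apply, smul_apply, ContinuousLinearMap.smulRight_apply,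
    h2, InnerProductSpace.rankOne_apply, smul_eq_mul, h3, Function.comp_apply]
  rw [sub_eq_add_neg]
  congr 1
  rw [smul_smul, ← neg_smul]
  congr 1
  field_simp

theorem isPosC2_ellipsoidFn (hs : ∀ u v, ⟪Q u, v⟫ = ⟪u, Q v⟫) (hpos : ∀ u ≠ 0, 0 < ⟪Q u, u⟫) :
    IsPosC2 (ellipsoidFn Q) where
  pos x := Real.sqrt_pos.2 (hpos _ (sph_ne_zero x))
  isC2 := isC2_ellipsoidFn hpos
  hess_pos x u hu hu0 := by
    set a := ⟪Q (x : E n), (x : E n)⟫ with ha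
    have ha0 : 0 < a := hpos _ (sph_ne_zero x)
    have hH : 0 < ellipsoidFn Q x := Real.sqrt_pos.2 ha0
    have hH2 : ellipsoidFn Q x ^ 2 = a := Real.sq_sqrt ha0.le
    set b := ⟪Q (x : E n), u⟫ with hb
    have hb' : ⟪Q u, (x : E n)⟫ = b := by rw [hs, real_inner_comm]
    -- Positivity of `Q` on this vector is the strict Cauchy-Schwarz inequality `b² < a ⟨Qu,u⟩`;
    -- orthogonality of `u` and `x` makes the vector nonzero.
    have hw0 : a • u - b • (x : E n) ≠ 0 := by
      intro h0
      have h1 := congrArg (fun w => ⟪w, u⟫) h0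
      simp only [inner_sub_left, real_inner_smul_left, hu, mul_zero, sub_zero,
        inner_zero_left] at h1
      exact (mul_pos ha0 (real_inner_self_pos.2 hu0)).ne' h1
    have h1 := hpos _ hw0
    simp only [map_sub, map_smul, inner_sub_left, inner_sub_right, real_inner_smul_left,
      real_inner_smul_right, hb', ← hb, ← ha] at h1
    have h2 : 0 < a * ⟪Q u, u⟫ - b ^ 2 := by
      have : 0 < a * (a * ⟪Q u, u⟫ - b ^ 2) := by linarith
      exact pos_of_mul_pos_right this ha0.le
    rw [hess_ellipsoidFn hs hpos]
    simp only [sub_apply, smul_apply, InnerProductSpace.rankOne_apply, inner_sub_left,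
      real_inner_smul_left, ← hb]
    have h3 : (ellipsoidFn Q x)⁻¹ * ⟪Q u, u⟫ - (ellipsoidFn Q x ^ 3)⁻¹ * (b * b) =
        (ellipsoidFn Q x ^ 3)⁻¹ * (a * ⟪Q u, u⟫ - b ^ 2) := by
      rw [← hH2]
      field_simp
    rw [h3]
    positivity

end Ellipsoid

/-! ### The planar case: Minkowski's inequality on the circle. -/

section Plane

variable {h f z : Sph 2 → ℝ}

/-- In the plane, `det D²h tr ((D²h)⁻¹ D²f)` is the Laplacian of the extension of `f`. -/
theorem IsPosC2.detHess_mul_relTrace (hh : IsPosC2 h) (hf : IsC2 f) (x : Sph 2) :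
    detHess h x * relTrace h f x =
      LinearMap.trace ℝ (E 2) (hess (homExt f) (x : E 2) : E 2 →ₗ[ℝ] E 2) := by
  -- In dimension two the mixed discriminant has `D²f` as its only argument, so the left side does
  -- not depend on `h`; it can be evaluated at the disc, where `extHess` is the identity.
  have key : ∀ {g : Sph 2 → ℝ}, IsPosC2 g → detHess g x * relTrace g f x =
      mixedDiscTangent x (fun _ : Fin 1 => D2 f x) := by
    intro g hg
    have := hg.choose_mul_mixedDiscTangent (m := 1) hf x Finset.univ
    simp only [Finset.card_univ, Fintype.card_fin, Nat.choose_self, Nat.cast_one, one_mul,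
      Finset.mem_univ, if_true] at this
    rw [this, coeff_one_detPoly, relTrace]
  have hs : ∀ u v : E 2, ⟪(1 : E 2 →L[ℝ] E 2) u, v⟫ = ⟪u, (1 : E 2 →L[ℝ] E 2) v⟫ :=
    fun u v => rfl
  have hpos : ∀ u : E 2, u ≠ 0 → 0 < ⟪(1 : E 2 →L[ℝ] E 2) u, u⟫ := fun u hu =>
    real_inner_self_pos.2 hu
  have h1 : ellipsoidFn (1 : E 2 →L[ℝ] E 2) x = 1 := by
    rw [ellipsoidFn, one_apply_eq_self, inner_sph_self, Real.sqrt_one]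
  have h2 : extHess (ellipsoidFn (1 : E 2 →L[ℝ] E 2)) x = 1 := by
    rw [extHess, hess_ellipsoidFn hs hpos, h1]
    simp
  rw [key hh, ← key (isPosC2_ellipsoidFn hs hpos), relTrace, relHess, extHessInv, detHess, h2,
    Ring.inverse_one, one_mul]
  have h3 : LinearMap.det ((1 : E 2 →L[ℝ] E 2) : E 2 →ₗ[ℝ] E 2) = 1 := LinearMap.det_id
  rw [h3, one_mul]

/-- The trace of the Hessian of the `1`-homogeneous extension. -/
def lap {n : ℕ} (f : Sph n → ℝ) (x : Sph n) : ℝ :=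
  LinearMap.trace ℝ (E n) (hess (homExt f) (x : E n) : E n →ₗ[ℝ] E n)

theorem IsC2.continuous_lap {n : ℕ} {f : Sph n → ℝ} (hf : IsC2 f) : Continuous (lap f) :=
  continuous_trace.comp hf.continuous_hess

theorem IsPosC2.lap_eq_detHess (hh : IsPosC2 h) (x : Sph 2) : lap h x = detHess h x := by
  rw [lap, ← hh.detHess_mul_relTrace hh.isC2, hh.relTrace_self]
  norm_num

/-- A quadratic bound for a function that vanishes at two antipodal points of the circle. -/
theorem IsC2.exists_sq_le (hf : IsC2 f) (b : OrthonormalBasis (Fin 2) ℝ (E 2))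
    (h0 : homExt f (b 0) = 0) (h1 : homExt f (-b 0) = 0) :
    ∃ C, 0 ≤ C ∧ ∀ x : Sph 2, f x ^ 2 ≤ C * ⟪b 1, (x : E 2)⟫ ^ 2 := by
  obtain ⟨L, hL⟩ := isCompact_univ.exists_bound_of_continuousOn hf.continuous_gradient.continuousOn
  obtain ⟨M, hM⟩ := isCompact_univ.exists_bound_of_continuousOn hf.continuous.continuousOn
  have hgrad : ∀ y : E 2, y ≠ 0 → ‖fderiv ℝ (homExt f) y‖ ≤ L := by
    intro y hy
    obtain ⟨x, hx⟩ := exists_smul_sph hy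
    have e1 : fderiv ℝ (homExt f) y = innerSL ℝ (∇ (homExt f) y) := by
      ext1 v
      rw [← inner_gradient, innerSL_apply_apply]
    rw [e1, innerSL_apply_norm, hx, hf.gradient_smul (norm_pos_iff.2 hy) (sph_ne_zero x)]
    exact hL x (Set.mem_univ x)
  refine ⟨L ^ 2 + M ^ 2, by positivity, fun x => ?_⟩
  set t := ⟪b 0, (x : E 2)⟫ with ht
  set s := ⟪b 1, (x : E 2)⟫ with hs
  have hx : (x : E 2) = t • b 0 + s • b 1 := by
    rw [← b.sum_repr' (x : E 2), Fin.sum_univ_two]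
  have hb00 : ⟪b 0, b 0⟫ = 1 := by
    rw [real_inner_self_eq_norm_sq, b.orthonormal.1 0, one_pow]
  have hb1n : ‖b 1‖ = 1 := b.orthonormal.1 1
  by_cases ht0 : t = 0
  · have hs1 : s ^ 2 = 1 := by
      have := norm_sph x
      rw [hx, ht0, zero_smul, zero_add, norm_smul, hb1n, mul_one, Real.norm_eq_abs] at this
      rw [← sq_abs, this, one_pow]
    rw [hs1, mul_one]
    have h2 := hM x (Set.mem_univ x)
    rw [Real.norm_eq_abs] at h2
    have h3 : |f x| ^ 2 ≤ M ^ 2 := by gcongr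
    rw [sq_abs] at h3
    nlinarith [sq_nonneg L]
  · have hF0 : homExt f (t • b 0) = 0 := by
      rcases lt_or_gt_of_ne ht0 with h | h
      · have e1 : t • b 0 = (-t) • (-b 0) := by rw [neg_smul_neg]
        rw [e1, homExt_smul _ (neg_pos.2 h), h1, mul_zero]
      · rw [homExt_smul _ h, h0, mul_zero]
    -- An open half-plane is convex, avoids the origin and contains both `t • b 0`, where the
    -- extension vanishes, and `x`; the mean value inequality there bounds `f x` by `L |s|`.
    set U : Set (E 2) := {y | 0 < ⟪t • b 0, y⟫} with hU
    have hUc : Convex ℝ U := convex_halfSpace_gt (innerSL ℝ (t • b 0)).isLinear 0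
    have hUne : ∀ y ∈ U, y ≠ 0 := by
      rintro y hy rfl
      rw [hU, Set.mem_ofPred_eq, inner_zero_right] at hy
      exact lt_irrefl _ hy
    have hb : ∀ y ∈ U, ‖fderiv ℝ (homExt f) y‖ ≤ L := fun y hy => hgrad y (hUne y hy)
    have hm1 : t • b 0 ∈ U := by
      rw [hU, Set.mem_ofPred_eq, real_inner_smul_left, real_inner_smul_right, hb00, mul_one]
      exact mul_self_pos.2 ht0
    have hm2 : (x : E 2) ∈ U := by
      rw [hU, Set.mem_ofPred_eq, real_inner_smul_left, ← ht]
      exact mul_self_pos.2 ht0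
    have h2 := hUc.norm_image_sub_le_of_norm_fderiv_le
      (fun y hy => hf.differentiableAt (hUne y hy)) hb hm1 hm2
    have e2 : (x : E 2) - t • b 0 = s • b 1 := by
      conv_lhs => rw [hx, add_sub_cancel_left]
    rw [hF0, sub_zero, homExt_coe, e2, norm_smul, hb1n, mul_one, Real.norm_eq_abs,
      Real.norm_eq_abs] at h2
    have h3 : |f x| ^ 2 ≤ (L * |s|) ^ 2 := by gcongr
    rw [sq_abs, mul_pow, sq_abs] at h3
    nlinarith [mul_nonneg (sq_nonneg M) (sq_nonneg s)]

/-- A Wirtinger type inequality on the circle. -/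
theorem IsC2.integral_mul_lap_nonpos (hf : IsC2 f) (b : OrthonormalBasis (Fin 2) ℝ (E 2))
    (h0 : homExt f (b 0) = 0) (h1 : homExt f (-b 0) = 0) :
    ∫ x, f x * lap f x ∂(sphMeasure 2) ≤ 0 := by
  obtain ⟨C, hC0, hC⟩ := hf.exists_sq_le b h0 h1
  have hb11 : ⟪b 1, b 1⟫ = 1 := by
    rw [real_inner_self_eq_norm_sq, b.orthonormal.1 1, one_pow]
  -- The ellipses with `h² = ε² + ⟨b 1, x⟩²` degenerate to a segment as `ε → 0`. Green's formula
  -- with such an `h` and `f = g` gives `∫ f lap f ≤ ∫ f² det D²h / h`, and the integrand on the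
  -- right is `G ε`.
  set Q : ℝ → E 2 →L[ℝ] E 2 := fun ε => ε ^ 2 • 1 + rankOne ℝ (b 1) (b 1) with hQ
  have hQa : ∀ ε u, Q ε u = ε ^ 2 • u + ⟪b 1, u⟫ • b 1 := fun ε u => by simp [hQ]
  have hQs : ∀ ε u v, ⟪Q ε u, v⟫ = ⟪u, Q ε v⟫ := fun ε u v => by
    rw [hQa, hQa, inner_add_left, inner_add_right, real_inner_smul_left, real_inner_smul_left,
      real_inner_smul_right, real_inner_smul_right, real_inner_comm (b 1) u]
    ring
  have hQq : ∀ ε u, ⟪Q ε u, u⟫ = ε ^ 2 * ‖u‖ ^ 2 + ⟪b 1, u⟫ ^ 2 := fun ε u => by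
    rw [hQa, inner_add_left, real_inner_smul_left, real_inner_smul_left,
      real_inner_self_eq_norm_sq, sq ⟪b 1, u⟫]
  have hQp : ∀ ε, 0 < ε → ∀ u ≠ 0, 0 < ⟪Q ε u, u⟫ := fun ε hε u hu => by
    rw [hQq]
    have := norm_pos_iff.2 hu
    positivity
  set G : ℝ → Sph 2 → ℝ := fun ε x =>
    ε ^ 2 * (1 + ε ^ 2) * f x ^ 2 / (ε ^ 2 + ⟪b 1, (x : E 2)⟫ ^ 2) ^ 2 with hG
  have hstep : ∀ ε, 0 < ε → ∫ x, f x * lap f x ∂(sphMeasure 2) ≤ ∫ x, G ε x ∂(sphMeasure 2) := by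
    intro ε hε
    set h := ellipsoidFn (Q ε) with hh
    have hp : IsPosC2 h := isPosC2_ellipsoidFn (hQs ε) (hQp ε hε)
    have hh2 : ∀ x : Sph 2, h x ^ 2 = ε ^ 2 + ⟪b 1, (x : E 2)⟫ ^ 2 := fun x => by
      rw [hh, ellipsoidFn, Real.sq_sqrt (hQp ε hε _ (sph_ne_zero x)).le, hQq, norm_sph x, one_pow,
        mul_one]
    have hdet : ∀ x : Sph 2, detHess h x = ε ^ 2 * (1 + ε ^ 2) / h x ^ 3 := by
      intro x
      have hx0 := hp.pos x
      have htr1 : LinearMap.trace ℝ (E 2) ((1 : E 2 →L[ℝ] E 2) : E 2 →ₗ[ℝ] E 2) = 2 := by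
        have : ((1 : E 2 →L[ℝ] E 2) : E 2 →ₗ[ℝ] E 2) = LinearMap.id := rfl
        rw [this, LinearMap.trace_id, finrank_euclideanSpace_fin]
        norm_num
      have hQQ : ⟪Q ε x, Q ε x⟫ = ε ^ 4 + 2 * ε ^ 2 * ⟪b 1, (x : E 2)⟫ ^ 2 +
          ⟪b 1, (x : E 2)⟫ ^ 2 := by
        rw [hQa, inner_add_left, inner_add_right, inner_add_right, real_inner_smul_left,
          real_inner_smul_left, real_inner_smul_left, real_inner_smul_left, real_inner_smul_right,
          real_inner_smul_right, real_inner_smul_right, real_inner_smul_right, inner_sph_self, hb11,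
          real_inner_comm (b 1) (x : E 2)]
        ring
      rw [← hp.lap_eq_detHess, lap, hess_ellipsoidFn (hQs ε) (hQp ε hε), ← hh]
      simp only [ContinuousLinearMap.toLinearMap_smul, ContinuousLinearMap.toLinearMap_sub, map_smul,
        map_sub, trace_rankOne_coe, hQQ, smul_eq_mul]
      simp only [hQ, ContinuousLinearMap.toLinearMap_smul, ContinuousLinearMap.toLinearMap_add,
        map_smul, map_add, trace_rankOne_coe, htr1, smul_eq_mul, hb11]
      have h2 := hh2 x
      field_simp
      rw [h2]
      ring
    have hgreen := hp.integral_green two_ne_zero hf hf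
    have cdet := continuous_detHess hp.isC2
    have cf := hf.continuous
    have cl := hf.continuous_lap
    have ch := hp.isC2.continuous
    have cr := hp.continuous_relGrad hf
    have ci := hp.continuous_extHessInv
    have cG : Continuous (G ε) := by
      refine Continuous.div (by fun_prop) (by fun_prop) fun x => ?_
      positivity
    have cI : Continuous fun x => detHess h x *
        ⟪relGrad h f x, extHessInv h x (relGrad h f x)⟫ :=
      cdet.mul (cr.inner (ci.clm_apply cr))
    have e1 : ∀ x, detHess h x * (f x * (relTrace h f x - (((2 : ℕ) : ℝ) - 1) * (f x / h x)) +
        ⟪relGrad h f x, extHessInv h x (relGrad h f x)⟫) = f x * lap f x - G ε x +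
        detHess h x * ⟪relGrad h f x, extHessInv h x (relGrad h f x)⟫ := by
      intro x
      have hx0 := hp.pos x
      have e2 : f x * lap f x = detHess h x * (f x * relTrace h f x) := by
        rw [lap, ← hp.detHess_mul_relTrace hf]; ring
      have e3 : G ε x = detHess h x * (f x ^ 2 / h x) := by
        rw [hdet]
        simp only [hG, ← hh2]
        field_simp
      rw [e2, e3]
      push_cast
      ring
    simp_rw [e1] at hgreen
    rw [integral_add, integral_sub] at hgreen
    · have hnn : 0 ≤ ∫ x, detHess h x * ⟪relGrad h f x, extHessInv h x (relGrad h f x)⟫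
          ∂(sphMeasure 2) := by
        refine integral_nonneg fun x => mul_nonneg (hp.detHess_pos x).le ?_
        rcases eq_or_ne (relGrad h f x) 0 with h3 | h3
        · rw [h3, inner_zero_left]
        · exact (hp.extHessInv_pos x h3).le
      linarith
    · exact integrable_sph (cf.mul cl)
    · exact integrable_sph cG
    · exact integrable_sph ((cf.mul cl).sub cG)
    · exact integrable_sph cI
  have hlim : Filter.Tendsto (fun ε => ∫ x, G ε x ∂(sphMeasure 2)) (𝓝[>] 0)
      (𝓝 (∫ _, (0 : ℝ) ∂(sphMeasure 2))) := by
    have h01 : ∀ᶠ ε in 𝓝[>] (0 : ℝ), 0 < ε ∧ ε < 1 := by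
      filter_upwards [self_mem_nhdsWithin, nhdsWithin_le_nhds (Iio_mem_nhds zero_lt_one)] with ε h1 h2
      exact ⟨h1, h2⟩
    -- The bound `f² ≤ C ⟨b 1, x⟩²` dominates `G ε` by `2C`; it also makes `f` vanish where the
    -- denominator degenerates.
    refine tendsto_integral_filter_of_dominated_convergence (fun _ => 2 * C) ?_ ?_
      (integrable_const _) ?_
    · filter_upwards [h01] with ε hε
      have cf := hf.continuous
      refine Continuous.aestronglyMeasurable (Continuous.div (by fun_prop) (by fun_prop) fun x => ?_)
      have := hε.1
      positivity
    · filter_upwards [h01] with ε hε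
      refine ae_of_all _ fun x => ?_
      have hε0 := hε.1
      have hε1 : ε ^ 2 ≤ 1 := pow_le_one₀ hε0.le hε.2.le
      rw [Real.norm_of_nonneg (by positivity)]
      simp only [hG]
      rw [div_le_iff₀ (by positivity)]
      set s := ⟪b 1, (x : E 2)⟫ ^ 2 with hs
      have hs0 : 0 ≤ s := sq_nonneg _
      have h2 := hC x
      calc ε ^ 2 * (1 + ε ^ 2) * f x ^ 2 ≤ ε ^ 2 * (1 + 1) * (C * s) := by gcongr
        _ = 2 * C * (ε ^ 2 * s) := by ring
        _ ≤ 2 * C * (ε ^ 2 + s) ^ 2 := by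
            gcongr
            nlinarith [sq_nonneg (ε ^ 2), sq_nonneg s, mul_nonneg (sq_nonneg ε) hs0]
    · refine ae_of_all _ fun x => ?_
      by_cases hs : ⟪b 1, (x : E 2)⟫ = 0
      · have hfx : f x ^ 2 = 0 := le_antisymm (by simpa [hs] using hC x) (sq_nonneg _)
        refine tendsto_const_nhds.congr fun ε => ?_
        simp only [hG, hfx, mul_zero, zero_div]
      · have hc : ContinuousAt (fun ε : ℝ =>
            ε ^ 2 * (1 + ε ^ 2) * f x ^ 2 / (ε ^ 2 + ⟪b 1, (x : E 2)⟫ ^ 2) ^ 2) 0 := by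
          refine ContinuousAt.div (by fun_prop) (by fun_prop) ?_
          positivity
        have := hc.tendsto
        simp only [ne_eq, OfNat.ofNat_ne_zero, not_false_eq_true, zero_pow, zero_mul, zero_div]
          at this
        exact this.mono_left nhdsWithin_le_nhds
  rw [integral_zero] at hlim
  exact ge_of_tendsto hlim (by
    filter_upwards [self_mem_nhdsWithin] with ε hε
    exact hstep ε hε)

theorem IsC2.lap_add {n : ℕ} {f g : Sph n → ℝ} (hf : IsC2 f) (hg : IsC2 g) (x : Sph n) :
    lap (fun x => f x + g x) x = lap f x + lap g x := by
  rw [lap, hf.hess_add hg (sph_ne_zero x), ContinuousLinearMap.toLinearMap_add, map_add, lap, lap]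

theorem IsC2.lap_const_mul {n : ℕ} {f : Sph n → ℝ} (hf : IsC2 f) (c : ℝ) (x : Sph n) :
    lap (fun x => c * f x) x = c * lap f x := by
  rw [lap, hf.hess_const_mul c (sph_ne_zero x), ContinuousLinearMap.toLinearMap_smul, map_smul,
    lap, smul_eq_mul]

theorem lap_inner {n : ℕ} (v : E n) (x : Sph n) : lap (fun x : Sph n => ⟪(x : E n), v⟫) x = 0 := by
  rw [lap, hess_homExt_inner, ContinuousLinearMap.toLinearMap_zero, map_zero]

theorem IsPosC2.mul_hbmOp_eq (hh : IsPosC2 h) (hz : IsC2 z) (w : Sph 2 → ℝ) (x : Sph 2) :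
    h x * detHess h x * (w x * hbmOp h z x) =
      h x * detHess h x * (w x * z x) - w x * h x * lap (fun y => z y * h y) x := by
  rw [lap, ← hh.detHess_mul_relTrace (hz.mul hh.isC2), hbmOp]
  push_cast
  ring

/-- The symmetry of `hbmOp` for the disc, applied to `f / h` and `g / h`. -/
theorem IsC2.integral_mul_lap_comm {g : Sph 2 → ℝ} (hf : IsC2 f) (hg : IsC2 g) :
    ∫ x, g x * lap f x ∂(sphMeasure 2) = ∫ x, f x * lap g x ∂(sphMeasure 2) := by
  have hh := isPosC2_ellipsoidFn (Q := (1 : E 2 →L[ℝ] E 2)) (fun u v => rfl) fun u hu =>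
    real_inner_self_pos.2 hu
  set h := ellipsoidFn (1 : E 2 →L[ℝ] E 2)
  have hf' := hf.div hh.isC2 hh.pos
  have hg' := hg.div hh.isC2 hh.pos
  have hc : ∀ k : Sph 2 → ℝ, (fun y => k y / h y * h y) = k := fun k => funext fun y =>
    div_mul_cancel₀ _ (hh.pos y).ne'
  have hc' : ∀ (k : Sph 2 → ℝ) (y : Sph 2), k y / h y * h y = k y := fun k y =>
    div_mul_cancel₀ _ (hh.pos y).ne'
  have h1 := hh.integral_mul_hbmOp_comm le_rfl hf' hg'
  have e1 : ∀ x, h x * detHess h x * (g x / h x * hbmOp h (fun y => f y / h y) x) =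
      h x * detHess h x * (g x / h x * (f x / h x)) - g x * lap f x := fun x => by
    rw [hh.mul_hbmOp_eq hf' (fun y => g y / h y) x, hc, hc']
  have e2 : ∀ x, h x * detHess h x * (f x / h x * hbmOp h (fun y => g y / h y) x) =
      h x * detHess h x * (f x / h x * (g x / h x)) - f x * lap g x := fun x => by
    rw [hh.mul_hbmOp_eq hg' (fun y => f y / h y) x, hc, hc']
  simp_rw [e1, e2] at h1
  have c1 := hf.continuous
  have c2 := hg.continuous
  have c3 := hf'.continuous
  have c4 := hg'.continuous
  have c5 := hf.continuous_lap
  have c6 := hg.continuous_lap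
  have c7 := hh.isC2.continuous
  have c8 := continuous_detHess hh.isC2
  rw [integral_sub (integrable_sph (by fun_prop)) (integrable_sph (by fun_prop)),
    integral_sub (integrable_sph (by fun_prop)) (integrable_sph (by fun_prop))] at h1
  have h2 : ∫ x, h x * detHess h x * (g x / h x * (f x / h x)) ∂(sphMeasure 2) =
      ∫ x, h x * detHess h x * (f x / h x * (g x / h x)) ∂(sphMeasure 2) := by
    congr 1; ext x; ring
  linarith

/-- Minkowski's inequality in the plane, as a spectral inequality. -/
theorem IsPosC2.integral_mul_hbmOp_ge (hh : IsPosC2 h) (hz : IsC2 z) :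
    (∫ x, h x * detHess h x * z x ^ 2 ∂(sphMeasure 2)) -
        (∫ x, h x * detHess h x * z x ∂(sphMeasure 2)) ^ 2 /
          ∫ x, h x * detHess h x ∂(sphMeasure 2) ≤
      ∫ x, h x * detHess h x * (z x * hbmOp h z x) ∂(sphMeasure 2) := by
  have hf := hz.mul hh.isC2
  set f : Sph 2 → ℝ := fun x => z x * h x with hfdef
  set b := EuclideanSpace.basisFun (Fin 2) ℝ
  have hHp : ∀ y : E 2, y ≠ 0 → 0 < homExt h y := fun y hy => homExt_pos hh.pos hy
  have hb0 : b 0 ≠ 0 := b.orthonormal.ne_zero 0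
  have hd : 0 < homExt h (b 0) + homExt h (-b 0) :=
    add_pos (hHp _ hb0) (hHp _ (neg_ne_zero.2 hb0))
  -- The constants `c` and `a` are chosen so that `f - c h` minus a linear function vanishes at both
  -- `b 0` and `-b 0`, as the Wirtinger inequality requires.
  set c := (homExt f (b 0) + homExt f (-b 0)) / (homExt h (b 0) + homExt h (-b 0)) with hc
  set a := homExt f (b 0) - c * homExt h (b 0) with ha
  have hb00 : ⟪b 0, b 0⟫ = 1 := by
    rw [real_inner_self_eq_norm_sq, b.orthonormal.1 0, one_pow]
  set l : Sph 2 → ℝ := fun x => ⟪(x : E 2), a • b 0⟫ with hl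
  have hl2 : IsC2 l := isC2_inner _
  set k : Sph 2 → ℝ := fun x => f x + (-c) * h x with hk
  have hk2 : IsC2 k := hf.add (hh.isC2.const_mul (-c))
  set q : Sph 2 → ℝ := fun x => k x + (-1) * l x with hq
  have hq2 : IsC2 q := hk2.add (hl2.const_mul (-1))
  have hqe : ∀ y, homExt q y = homExt f y + (-c) * homExt h y + (-1) * ⟪y, a • b 0⟫ := by
    intro y
    rw [hq, homExt_add, homExt_const_mul, hk, homExt_add, homExt_const_mul, hl, homExt_inner]
  have hw := hq2.integral_mul_lap_nonpos b
    (by rw [hqe, real_inner_smul_right, hb00, ha]; ring)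
    (by
      rw [hqe, real_inner_smul_right, inner_neg_left, hb00, ha, hc]
      field_simp
      ring)
  have hqk : ∀ x, lap q x = lap k x := fun x => by
    rw [hq, hk2.lap_add (hl2.const_mul (-1)), hl2.lap_const_mul, hl, lap_inner, mul_zero, add_zero]
  have hkl : ∀ x, lap k x = lap f x + (-c) * detHess h x := fun x => by
    rw [hk, hf.lap_add (hh.isC2.const_mul (-c)), hh.isC2.lap_const_mul, hh.lap_eq_detHess]
  -- Linear functions have zero Laplacian, so by symmetry the linear correction drops out of both
  -- factors.
  have h1 : ∫ x, k x * lap k x ∂(sphMeasure 2) ≤ 0 := by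
    refine le_of_eq_of_le ?_ hw
    calc ∫ x, k x * lap k x ∂(sphMeasure 2) = ∫ x, k x * lap q x ∂(sphMeasure 2) := by
          simp_rw [hqk]
      _ = ∫ x, q x * lap k x ∂(sphMeasure 2) := hq2.integral_mul_lap_comm hk2
      _ = _ := by simp_rw [hqk]
  have cf := hf.continuous
  have ch := hh.isC2.continuous
  have cz := hz.continuous
  have cd := continuous_detHess hh.isC2
  have cl := hf.continuous_lap
  have h2 : ∫ x, h x * lap f x ∂(sphMeasure 2) = ∫ x, f x * detHess h x ∂(sphMeasure 2) := by
    rw [hf.integral_mul_lap_comm hh.isC2]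
    simp_rw [hh.lap_eq_detHess]
  have h3 : ∀ x, k x * lap k x = f x * lap f x - c * (f x * detHess h x) - c * (h x * lap f x) +
      c ^ 2 * (h x * detHess h x) := fun x => by
    rw [hkl, hk]; ring
  simp_rw [h3] at h1
  rw [integral_add (integrable_sph (by fun_prop)) (integrable_sph (by fun_prop)),
    integral_sub (integrable_sph (by fun_prop)) (integrable_sph (by fun_prop)),
    integral_sub (integrable_sph (by fun_prop)) (integrable_sph (by fun_prop)),
    integral_const_mul, integral_const_mul, integral_const_mul, h2] at h1
  have h4 : ∫ x, h x * detHess h x * (z x * hbmOp h z x) ∂(sphMeasure 2) =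
      (∫ x, h x * detHess h x * z x ^ 2 ∂(sphMeasure 2)) -
        ∫ x, f x * lap f x ∂(sphMeasure 2) := by
    rw [← integral_sub (integrable_sph (by fun_prop)) (integrable_sph (by fun_prop))]
    congr 1
    ext x
    rw [hh.mul_hbmOp_eq hz, ← hfdef]
    ring
  have h5 : ∫ x, h x * detHess h x * z x ∂(sphMeasure 2) =
      ∫ x, f x * detHess h x ∂(sphMeasure 2) := by
    congr 1
    ext x
    rw [hfdef]
    ring
  rw [h4, h5]
  set α := ∫ x, f x * detHess h x ∂(sphMeasure 2)
  set β := ∫ x, h x * detHess h x ∂(sphMeasure 2)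
  have h7 : 0 < β := hh.integral_mul_detHess_pos two_ne_zero
  -- Completing the square makes the bound independent of `c`.
  have h8 : 2 * c * α - c ^ 2 * β ≤ α ^ 2 / β := by
    rw [le_div_iff₀ h7]
    nlinarith [sq_nonneg (c * β - α)]
  linarith

end Plane

end ConvexStability

end

open MeasureTheory Topology
open scoped Pointwise Gradient RealInnerProductSpace

noncomputable section

namespace ConvexStability

open Filter
open scoped ENNReal

/-! ### Limits of sequences with vanishing energy or vanishing Hessian. -/

section Sequences

variable {n : ℕ} {h z : Sph n → ℝ}

/-- Cauchy-Schwarz on the finite measure space, through the discriminant of `t ↦ ∫ (‖g k‖ - t)²`. -/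
theorem tendsto_lintegral_enorm_of_sq {F : Type*} [NormedAddCommGroup F] {g : ℕ → Sph n → F}
    (hg : ∀ k, Continuous (g k)) {I : ℕ → ℝ}
    (hle : ∀ k, ∫ x, ‖g k x‖ ^ 2 ∂(sphMeasure n) ≤ I k) (hI : Tendsto I atTop (𝓝 0)) :
    Tendsto (fun k => ∫⁻ x, ‖g k x‖ₑ ∂(sphMeasure n)) atTop (𝓝 0) := by
  set M := (sphMeasure n).real Set.univ with hM
  have hM0 : 0 ≤ M := measureReal_nonneg
  have hint : ∀ k, Integrable (fun x => ‖g k x‖) (sphMeasure n) := fun k =>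
    integrable_sph (hg k).norm
  have hint2 : ∀ k, Integrable (fun x => ‖g k x‖ ^ 2) (sphMeasure n) := fun k =>
    integrable_sph ((hg k).norm.pow 2)
  have key : ∀ k (t : ℝ), 0 ≤ I k - 2 * t * ∫ x, ‖g k x‖ ∂(sphMeasure n) + t ^ 2 * M := by
    intro k t
    have h1 : 0 ≤ ∫ x, (‖g k x‖ - t) ^ 2 ∂(sphMeasure n) := integral_nonneg fun x => sq_nonneg _
    have h2 : ∀ x, (‖g k x‖ - t) ^ 2 = ‖g k x‖ ^ 2 - 2 * t * ‖g k x‖ + t ^ 2 := fun x => by ring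
    simp_rw [h2] at h1
    have h3 : Integrable (fun x => ‖g k x‖ ^ 2 - 2 * t * ‖g k x‖) (sphMeasure n) :=
      (hint2 k).sub ((hint k).const_mul _)
    rw [integral_add h3 (integrable_const _),
      integral_sub (hint2 k) ((hint k).const_mul _), integral_const_mul, integral_const,
      smul_eq_mul, mul_comm _ (t ^ 2)] at h1
    linarith [hle k]
  have h0 : ∀ k, 0 ≤ ∫ x, ‖g k x‖ ∂(sphMeasure n) := fun k => integral_nonneg fun x => norm_nonneg _
  have hsq : ∀ k, (∫ x, ‖g k x‖ ∂(sphMeasure n)) ^ 2 ≤ M * I k := by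
    intro k
    have := key k
    have hd := discrim_le_zero (a := M) (b := -2 * ∫ x, ‖g k x‖ ∂(sphMeasure n)) (c := I k)
      fun t => by linarith [key k t]
    rw [discrim] at hd
    linarith
  have hG : Tendsto (fun k => ∫ x, ‖g k x‖ ∂(sphMeasure n)) atTop (𝓝 0) := by
    refine squeeze_zero h0 (fun k => Real.le_sqrt_of_sq_le (hsq k)) ?_
    have := (Real.continuous_sqrt.tendsto _).comp (hI.const_mul M)
    rwa [mul_zero, Real.sqrt_zero] at this
  have h3 : ∀ k, ∫⁻ x, ‖g k x‖ₑ ∂(sphMeasure n) =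
      ENNReal.ofReal (∫ x, ‖g k x‖ ∂(sphMeasure n)) := fun k => by
    rw [ofReal_integral_eq_lintegral_ofReal (hint k) (ae_of_all _ fun x => norm_nonneg _)]
    simp_rw [ofReal_norm]
  simp_rw [h3]
  have := (ENNReal.continuous_ofReal.tendsto _).comp hG
  rwa [ENNReal.ofReal_zero] at this

/-- A limit in `L¹` of elements of a finite-dimensional space of functions belongs to it. -/
theorem exists_ae_eq_of_tendsto {V : Type*} [AddCommGroup V] [Module ℝ V] [FiniteDimensional ℝ V]
    (Φ : V →ₗ[ℝ] C(Sph n, ℝ)) (hz : Integrable z (sphMeasure n)) (v : ℕ → V)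
    (hv : Tendsto (fun k => ∫⁻ x, ‖z x - Φ (v k) x‖ₑ ∂(sphMeasure n)) atTop (𝓝 0)) :
    ∃ v, z =ᵐ[sphMeasure n] Φ v := by
  set T : V →ₗ[ℝ] Lp ℝ 1 (sphMeasure n) :=
    ((ContinuousMap.toLp 1 (sphMeasure n) ℝ : C(Sph n, ℝ) →L[ℝ] Lp ℝ 1 (sphMeasure n)) :
      C(Sph n, ℝ) →ₗ[ℝ] Lp ℝ 1 (sphMeasure n)) ∘ₗ Φ with hT
  have hTae : ∀ w, T w =ᵐ[sphMeasure n] Φ w := fun w =>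
    ContinuousMap.coeFn_toLp (p := 1) (𝕜 := ℝ) (sphMeasure n) (Φ w)
  have hlim : Tendsto (fun k => T (v k)) atTop (𝓝 (hz.toL1 z)) := by
    rw [tendsto_iff_edist_tendsto_0]
    refine hv.congr fun k => ?_
    rw [L1.edist_def]
    refine lintegral_congr_ae ?_
    filter_upwards [hTae (v k), hz.coeFn_toL1] with x h1 h2
    rw [h1, h2, edist_comm, edist_eq_enorm_sub]
  have hmem : hz.toL1 z ∈ (LinearMap.range T : Set (Lp ℝ 1 (sphMeasure n))) :=
    (Submodule.closed_of_finiteDimensional (LinearMap.range T)).mem_of_tendsto hlim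
      (Eventually.of_forall fun k => ⟨v k, rfl⟩)
  obtain ⟨w, hw⟩ := hmem
  refine ⟨w, ?_⟩
  filter_upwards [hTae w, hz.coeFn_toL1] with x h1 h2
  rw [← h1, ← h2, hw]

theorem exists_ae_eq_of_tendsto_of_tendsto {V : Type*} [AddCommGroup V] [Module ℝ V]
    [FiniteDimensional ℝ V] (Φ : V →ₗ[ℝ] C(Sph n, ℝ)) (hz : Integrable z (sphMeasure n))
    {zk : ℕ → Sph n → ℝ} (hk : ∀ k, Continuous (zk k))
    (hlim : Tendsto (fun k => ∫⁻ x, ‖zk k x - z x‖ₑ ∂(sphMeasure n)) atTop (𝓝 0)) (v : ℕ → V)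
    (hv : Tendsto (fun k => ∫⁻ x, ‖zk k x - Φ (v k) x‖ₑ ∂(sphMeasure n)) atTop (𝓝 0)) :
    ∃ v, z =ᵐ[sphMeasure n] Φ v := by
  refine exists_ae_eq_of_tendsto Φ hz v ?_
  have := hlim.add hv
  rw [add_zero] at this
  refine tendsto_of_tendsto_of_tendsto_of_le_of_le tendsto_const_nhds this (fun _ => zero_le)
    fun k => ?_
  have hm : AEMeasurable (fun x => ‖zk k x - z x‖ₑ) (sphMeasure n) :=
    ((hk k).aestronglyMeasurable.sub hz.1).enorm
  dsimp only
  rw [← lintegral_add_left' hm]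
  refine lintegral_mono fun x => ?_
  calc ‖z x - Φ (v k) x‖ₑ = ‖(zk k x - Φ (v k) x) - (zk k x - z x)‖ₑ := by congr 1; ring
    _ ≤ ‖zk k x - Φ (v k) x‖ₑ + ‖zk k x - z x‖ₑ := enorm_sub_le
    _ = _ := add_comm _ _

/-- The `0`-homogeneous extension. -/
theorem IsC2.contDiffOn_div_norm (hz : IsC2 z) :
    ContDiffOn ℝ 2 (fun y => homExt z y / ‖y‖) {0}ᶜ :=
  ContDiffOn.div hz contDiffOn_norm_compl fun _ hy => norm_ne_zero_iff.2 hy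

theorem homExt_div_norm_smul (z : Sph n → ℝ) {r : ℝ} (hr : 0 < r) (x : Sph n) :
    homExt z (r • (x : E n)) / ‖r • (x : E n)‖ = z x := by
  rw [homExt_smul_coe z hr, norm_smul, norm_sph, mul_one, Real.norm_of_nonneg hr.le]
  field_simp

/-- The extension of `zh` is `Z H` with `Z` the `0`-homogeneous extension of `z`, so the product
rule gives relative gradient `h ∇Z`. This turns the Dirichlet form into the quantity controlled by
the Poincaré inequality. -/
theorem IsPosC2.norm_relGrad_mul (hh : IsPosC2 h) (hz : IsC2 z) (x : Sph n) :
    ‖relGrad h (fun y => z y * h y) x‖ =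
      h x * ‖fderiv ℝ (fun y => homExt z y / ‖y‖) (x : E n)‖ := by
  set Z : E n → ℝ := fun y => homExt z y / ‖y‖ with hZ
  have hx := sph_ne_zero x
  have hd : DifferentiableAt ℝ Z x := ((hz.contDiffOn_div_norm).contDiffAt
    (isOpen_compl_singleton.mem_nhds hx)).differentiableAt (by norm_num)
  have h1 := hd.hasFDerivAt.mul (hh.isC2.differentiableAt hx).hasFDerivAt
  have h2 : homExt (fun y => z y * h y) = Z * homExt h := by
    rw [homExt_mul]; ext y; simp only [hZ, Pi.mul_apply]; ring
  have hZx : Z x = z x := by rw [hZ]; simp only [homExt_coe, norm_sph, div_one]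
  have h3 : relGrad h (fun y => z y * h y) x = h x • ∇ Z (x : E n) := by
    refine ext_inner_right ℝ fun u => ?_
    rw [relGrad, inner_sub_left, real_inner_smul_left, real_inner_smul_left, inner_gradient,
      inner_gradient, inner_gradient, h2, h1.fderiv]
    simp only [add_apply, smul_apply, smul_eq_mul, hZx, homExt_coe]
    have := (hh.pos x).ne'
    field_simp
    ring
  rw [h3, norm_smul, Real.norm_of_nonneg (hh.pos x).le, gradient, LinearIsometryEquiv.norm_map]

theorem exists_pos_le_of_continuous {w : Sph n → ℝ} (hn : n ≠ 0) (hw : Continuous w)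
    (hpos : ∀ x, 0 < w x) : ∃ c > 0, ∀ x, c ≤ w x := by
  have := nonempty_sph hn
  obtain ⟨p, hp⟩ := isCompact_univ.exists_isMinOn Set.univ_nonempty hw.continuousOn
  exact ⟨w p, hpos p, fun x => isMinOn_iff.1 hp.2 x (Set.mem_univ x)⟩

/-- Functions of asymptotically vanishing Dirichlet energy converge to constants. -/
theorem IsPosC2.exists_const_of_tendsto (hn : 2 ≤ n) (hh : IsPosC2 h)
    (hz : Integrable z (sphMeasure n)) {zk : ℕ → Sph n → ℝ} (hk : ∀ k, IsC2 (zk k))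
    (hlim : Tendsto (fun k => ∫⁻ x, ‖zk k x - z x‖ₑ ∂(sphMeasure n)) atTop (𝓝 0))
    (hE : Tendsto (fun k => ∫ x, h x * detHess h x * (zk k x * hbmOp h (zk k) x) ∂(sphMeasure n))
      atTop (𝓝 0)) : ∃ a : ℝ, z =ᵐ[sphMeasure n] fun _ => a := by
  have hn0 : n ≠ 0 := by omega
  obtain ⟨c, hc, hcle⟩ := hh.exists_extHessInv_ge hn0
  obtain ⟨d, hd, hdle⟩ := exists_pos_le_of_continuous hn0
    ((continuous_detHess hh.isC2).mul (hh.isC2.continuous.pow 2))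
    fun x => mul_pos (hh.detHess_pos x) (pow_pos (hh.pos x) 2)
  obtain ⟨C, hC, hP⟩ := exists_poincare_sph hn ℝ
  set D : ℕ → Sph n → (E n →L[ℝ] ℝ) := fun k x =>
    fderiv ℝ (fun y => homExt (zk k) y / ‖y‖) (x : E n) with hD
  have hcD : ∀ k, Continuous (D k) := fun k =>
    (((hk k).contDiffOn_div_norm.continuousOn_fderiv_of_isOpen isOpen_compl_singleton
      (by norm_num)).comp_continuous continuous_subtype_val sph_ne_zero)
  -- By compactness the inverse Hessian is at least `c` and `det D²h · h²` at least `d`, so the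
  -- Dirichlet energy controls the `L²` norm of the gradient.
  have hle : ∀ k, ∫ x, ‖D k x‖ ^ 2 ∂(sphMeasure n) ≤ (c * d)⁻¹ * (((n : ℝ) - 1) *
      ∫ x, h x * detHess h x * (zk k x * hbmOp h (zk k) x) ∂(sphMeasure n)) := by
    intro k
    rw [hh.integral_mul_hbmOp hn (hk k) (hk k), ← integral_const_mul]
    refine integral_mono (integrable_sph ((hcD k).norm.pow 2))
      (integrable_sph ((hh.continuous_dirichlet (hk k) (hk k)).const_mul _)) fun x => ?_
    dsimp only
    rw [le_inv_mul_iff₀ (by positivity), dirichlet]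
    have h1 := hcle x (relGrad h (fun y => zk k y * h y) x)
    rw [hh.norm_relGrad_mul (hk k), mul_pow] at h1
    calc c * d * ‖D k x‖ ^ 2 ≤ c * (detHess h x * h x ^ 2) * ‖D k x‖ ^ 2 := by
          gcongr; exact hdle x
      _ = detHess h x * (c * (h x ^ 2 * ‖D k x‖ ^ 2)) := by ring
      _ ≤ _ := mul_le_mul_of_nonneg_left h1 (hh.detHess_pos x).le
  have hT := tendsto_lintegral_enorm_of_sq hcD hle (by
    have := (hE.const_mul ((n : ℝ) - 1)).const_mul (c * d)⁻¹
    rwa [mul_zero, mul_zero] at this)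
  have hPk : ∀ k, ∃ a : ℝ, ∫⁻ x, ‖zk k x - a‖ₑ ∂(sphMeasure n) ≤
      C * ∫⁻ x, ‖D k x‖ₑ ∂(sphMeasure n) := by
    intro k
    obtain ⟨a, ha⟩ := hP (fun y => homExt (zk k) y / ‖y‖)
      ((hk k).contDiffOn_div_norm.of_le (by norm_num)) fun r hr x => by
        rw [homExt_div_norm_smul _ hr, homExt_coe, norm_sph, div_one]
    refine ⟨a, ?_⟩
    simpa only [homExt_coe, norm_sph, div_one] using ha
  choose a ha using hPk
  have hCT := ENNReal.Tendsto.const_mul (a := C) hT (Or.inr hC)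
  rw [mul_zero] at hCT
  set Φ : ℝ →ₗ[ℝ] C(Sph n, ℝ) :=
    { toFun := fun t => ContinuousMap.const _ t
      map_add' := fun _ _ => rfl
      map_smul' := fun _ _ => rfl } with hΦ
  obtain ⟨t, ht⟩ := exists_ae_eq_of_tendsto_of_tendsto Φ hz (fun k => (hk k).continuous) hlim a
    (tendsto_of_tendsto_of_tendsto_of_le_of_le tendsto_const_nhds hCT (fun _ => zero_le) ha)
  exact ⟨t, ht⟩

/-- Sequences asymptotically in the eigenspace of the eigenvalue `1` converge to the functions
`x ↦ ⟪x, v⟫ / h x`. -/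
theorem IsPosC2.exists_inner_of_tendsto (hn : 2 ≤ n) (hh : IsPosC2 h)
    (hz : Integrable z (sphMeasure n)) {zk : ℕ → Sph n → ℝ} (hk : ∀ k, IsC2 (zk k))
    (hlim : Tendsto (fun k => ∫⁻ x, ‖zk k x - z x‖ₑ ∂(sphMeasure n)) atTop (𝓝 0))
    (h1 : Tendsto (fun k => ∫ x, h x * detHess h x *
      (hbmOp h (zk k) x * hbmOp h (zk k) x - zk k x * hbmOp h (zk k) x) ∂(sphMeasure n))
      atTop (𝓝 0))
    (h2 : Tendsto (fun k => ∫ x, h x * detHess h x * (hbmOp h (zk k) x - zk k x) ^ 2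
      ∂(sphMeasure n)) atTop (𝓝 0)) :
    ∃ v : E n, z =ᵐ[sphMeasure n] fun x => ⟪(x : E n), v⟫ / h x := by
  have hn0 : n ≠ 0 := by omega
  have hn' : (2 : ℝ) ≤ n := by exact_mod_cast hn
  have hm0 : (n : ℝ) - 1 ≠ 0 := by linarith
  have ch := hh.isC2.continuous
  have cd := continuous_detHess hh.isC2
  obtain ⟨c, hc, hcle⟩ := hh.exists_norm_hess_sq_le hn0
  obtain ⟨d, hd, hdle⟩ := exists_pos_le_of_continuous hn0 (ch.mul cd)
    fun x => mul_pos (hh.pos x) (hh.detHess_pos x)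
  obtain ⟨C, hC, hP⟩ := exists_poincare_sph hn (E n)
  set f : ℕ → Sph n → ℝ := fun k x => zk k x * h x with hf
  have hf2 : ∀ k, IsC2 (f k) := fun k => (hk k).mul hh.isC2
  set J : ℕ → ℝ := fun k => c * d⁻¹ * ((n - 1) * (n - 2) * (∫ x, h x * detHess h x *
      (hbmOp h (zk k) x * hbmOp h (zk k) x - zk k x * hbmOp h (zk k) x) ∂(sphMeasure n)) +
      (n - 1) * ∫ x, h x * detHess h x * (hbmOp h (zk k) x - zk k x) ^ 2 ∂(sphMeasure n)) with hJ
  -- The Hessian is bounded by `tr S²`, which is its trace-free part, given by the Bochner formula,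
  -- plus `(tr S)² / (n-1)`, which is `(n-1)(Az - z)²`. Both integrals tend to zero.
  have hle : ∀ k, ∫ x : Sph n, ‖hess (homExt (f k)) (x : E n)‖ ^ 2 ∂(sphMeasure n) ≤ J k := by
    intro k
    have cz := (hk k).continuous
    have cT := hh.continuous_relTrace (hf2 k)
    have cU := hh.continuous_relTraceSq (hf2 k)
    have cA := hh.continuous_hbmOp (hk k)
    rw [hJ]
    dsimp only
    rw [← hh.integral_bochner hn (hk k), ← integral_const_mul, ← integral_add
      (integrable_sph (by fun_prop)) (integrable_sph (by fun_prop)), ← integral_const_mul]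
    refine integral_mono (integrable_sph ((hf2 k).continuous_hess.norm.pow 2))
      (integrable_sph (by fun_prop)) fun x => ?_
    dsimp only
    have e1 : (n - 1) * (h x * detHess h x * (hbmOp h (zk k) x - zk k x) ^ 2) =
        h x * detHess h x * (relTrace h (f k) x ^ 2 / (n - 1)) := by
      simp only [hbmOp, hf]
      field_simp
      ring
    rw [e1, ← mul_add, sub_add_cancel]
    have e2 := hcle (f k) (hf2 k) x
    have e3 : 0 ≤ relTraceSq h (f k) x :=
      nonneg_of_mul_nonneg_right ((sq_nonneg _).trans e2) hc
    calc _ ≤ c * relTraceSq h (f k) x := e2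
      _ = c * d⁻¹ * (d * relTraceSq h (f k) x) := by field_simp
      _ ≤ _ := by
        gcongr
        exact hdle x
  have hT := tendsto_lintegral_enorm_of_sq (fun k => (hf2 k).continuous_hess) hle (by
    have := ((h1.const_mul (((n : ℝ) - 1) * (n - 2))).add
      (h2.const_mul ((n : ℝ) - 1))).const_mul (c * d⁻¹)
    rwa [mul_zero, mul_zero, add_zero, mul_zero] at this)
  -- The Poincaré inequality applied to the `0`-homogeneous gradient gives a nearby constant vector
  -- `v`; as `f = ⟨x, ∇F⟩` on the sphere, `f` is then close to `⟨x,v⟩`.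
  have hPk : ∀ k, ∃ v : E n, ∫⁻ x : Sph n, ‖f k x - ⟪(x : E n), v⟫‖ₑ ∂(sphMeasure n) ≤
      C * ∫⁻ x : Sph n, ‖hess (homExt (f k)) (x : E n)‖ₑ ∂(sphMeasure n) := by
    intro k
    obtain ⟨v, hv⟩ := hP (∇ (homExt (f k))) (hf2 k).contDiffOn_gradient fun r hr x =>
      (hf2 k).gradient_smul hr (sph_ne_zero x)
    refine ⟨v, (lintegral_mono fun x => ?_).trans hv⟩
    rw [enorm_le_iff_norm_le]
    have e1 : f k x = ⟪(x : E n), ∇ (homExt (f k)) (x : E n)⟫ :=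
      ((hf2 k).inner_gradient_sph x).symm
    rw [e1, ← inner_sub_right]
    refine (norm_inner_le_norm _ _).trans ?_
    rw [norm_sph, one_mul]
  choose v hv using hPk
  have hCT := ENNReal.Tendsto.const_mul (a := C) hT (Or.inr hC)
  rw [mul_zero] at hCT
  set Φ : E n →ₗ[ℝ] C(Sph n, ℝ) :=
    { toFun := fun w => ⟨fun x => ⟪(x : E n), w⟫, by fun_prop⟩
      map_add' := fun _ _ => by ext x; simp [inner_add_right]
      map_smul' := fun _ _ => by ext x; simp [inner_smul_right] } with hΦ
  obtain ⟨M, hM⟩ := isCompact_univ.exists_bound_of_continuousOn ch.continuousOn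
  have hzh : Integrable (fun x => z x * h x) (sphMeasure n) :=
    hz.mul_bdd (c := M) ch.aestronglyMeasurable (ae_of_all _ fun x => hM x trivial)
  have hlim' : Tendsto (fun k => ∫⁻ x, ‖f k x - z x * h x‖ₑ ∂(sphMeasure n)) atTop (𝓝 0) := by
    have := ENNReal.Tendsto.const_mul (a := ENNReal.ofReal M) hlim (Or.inr ENNReal.ofReal_ne_top)
    rw [mul_zero] at this
    refine tendsto_of_tendsto_of_tendsto_of_le_of_le tendsto_const_nhds this (fun _ => zero_le)
      fun k => ?_
    dsimp only
    rw [← lintegral_const_mul' _ _ ENNReal.ofReal_ne_top]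
    refine lintegral_mono fun x => ?_
    rw [hf]
    dsimp only
    rw [← sub_mul, enorm_mul, mul_comm]
    gcongr
    rw [← ofReal_norm]
    exact ENNReal.ofReal_le_ofReal (hM x trivial)
  obtain ⟨w, hw⟩ := exists_ae_eq_of_tendsto_of_tendsto Φ hzh (fun k => (hf2 k).continuous) hlim' v
    (tendsto_of_tendsto_of_tendsto_of_le_of_le tendsto_const_nhds hCT (fun _ => zero_le) hv)
  refine ⟨w, ?_⟩
  filter_upwards [hw] with x hx
  rw [eq_div_iff (hh.pos x).ne', hx]
  rfl

end Sequences

end ConvexStability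

end

open MeasureTheory Topology
open scoped Pointwise Gradient RealInnerProductSpace

noncomputable section

namespace ConvexStability

open Filter
open scoped ENNReal

/-! ### Linearity of the operator and its explicit eigenfunctions. -/

section Linear

variable {n : ℕ} {h f g z w : Sph n → ℝ}

theorem relTrace_add (h : Sph n → ℝ) (hf : IsC2 f) (hg : IsC2 g) (x : Sph n) :
    relTrace h (fun y => f y + g y) x = relTrace h f x + relTrace h g x := by
  simp only [relTrace, relHess]
  rw [hf.hess_add hg (sph_ne_zero x), mul_add, ContinuousLinearMap.toLinearMap_add, map_add]

theorem relTrace_const_mul (h : Sph n → ℝ) (c : ℝ) (hf : IsC2 f) (x : Sph n) :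
    relTrace h (fun y => c * f y) x = c * relTrace h f x := by
  simp only [relTrace, relHess]
  have h1 : extHessInv h x * (c • hess (homExt f) (x : E n)) =
      c • (extHessInv h x * hess (homExt f) (x : E n)) := by
    ext1 u
    simp only [mul_apply_eq_comp, smul_apply, map_smul]
  rw [hf.hess_const_mul c (sph_ne_zero x), h1, ContinuousLinearMap.toLinearMap_smul, map_smul,
    smul_eq_mul]

theorem relTrace_inner (h : Sph n → ℝ) (v : E n) (x : Sph n) :
    relTrace h (fun y : Sph n => ⟪(y : E n), v⟫) x = 0 := by
  rw [relTrace, relHess, hess_homExt_inner, mul_zero, ContinuousLinearMap.toLinearMap_zero, map_zero]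

theorem IsPosC2.hbmOp_add (hh : IsPosC2 h) (hz : IsC2 z) (hw : IsC2 w) :
    hbmOp h (fun y => z y + w y) = fun x => hbmOp h z x + hbmOp h w x := by
  ext x
  simp only [hbmOp, add_mul]
  rw [relTrace_add h (hz.mul hh.isC2) (hw.mul hh.isC2)]
  ring

theorem IsPosC2.hbmOp_const_mul (hh : IsPosC2 h) (c : ℝ) (hz : IsC2 z) :
    hbmOp h (fun y => c * z y) = fun x => c * hbmOp h z x := by
  ext x
  simp only [hbmOp, mul_assoc]
  rw [relTrace_const_mul h c (hz.mul hh.isC2)]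
  ring

theorem IsPosC2.hbmOp_const (hn : 2 ≤ n) (hh : IsPosC2 h) (c : ℝ) :
    hbmOp h (fun _ => c) = fun _ => 0 := by
  have hn' : (2 : ℝ) ≤ n := by exact_mod_cast hn
  have hm0 : (n : ℝ) - 1 ≠ 0 := by linarith
  ext x
  rw [hbmOp, relTrace_const_mul h c hh.isC2, hh.relTrace_self]
  field_simp
  ring

/-- Multiplication by `h` turns the function into a linear one, whose restricted Hessian is zero. -/
theorem IsPosC2.hbmOp_inner_div (hh : IsPosC2 h) (v : E n) :
    hbmOp h (fun x : Sph n => ⟪(x : E n), v⟫ / h x) = fun x : Sph n => ⟪(x : E n), v⟫ / h x := by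
  ext x
  have : (fun y : Sph n => ⟪(y : E n), v⟫ / h y * h y) = fun y : Sph n => ⟪(y : E n), v⟫ :=
    funext fun y => div_mul_cancel₀ _ (hh.pos y).ne'
  rw [hbmOp, this, relTrace_inner, zero_div, sub_zero]

end Linear

/-! ### The space `L²(V_K)` and the closed operator. -/

section ConeMeasure

variable {n : ℕ} {K : ConvexBody (E n)} {z w : Sph n → ℝ}

/-- One of the `n - 1` arguments is `D²(zh)` and the others are `D²h`, so the mixed discriminant is
the first-order coefficient of `det (D²h + t D²(zh))` divided by `n - 1`. -/
theorem negHBM_eq (hn : 2 ≤ n) (hK : MemKPlusTwo K) (hz : IsC2 z) :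
    negHBM K z = hbmOp (supportFn K) z := by
  obtain ⟨m, rfl⟩ : ∃ m, n = m + 1 := ⟨n - 1, by omega⟩
  have hm : m ≠ 0 := by omega
  have hh := hK.isPosC2
  ext x
  have h1 := hh.mixedDiscTangent_one (hz.mul hh.isC2) x
    (s := {(⟨0, Nat.pos_of_ne_zero hm⟩ : Fin m)}) (Finset.card_singleton _) hm
  have h2 : (fun i : Fin m => if i ∈ ({⟨0, Nat.pos_of_ne_zero hm⟩} : Finset (Fin m)) then
      D2 (fun y => z y * supportFn K y) x else D2 (supportFn K) x) = fun i : Fin m =>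
      if (i : ℕ) = 0 then D2 (fun y => z y * supportFn K y) x else D2 (supportFn K) x := by
    ext1 i
    simp only [Finset.mem_singleton, Fin.ext_iff]
  rw [h2] at h1
  have h3 : negHBM K z x = z x - mixedDiscTangent x (fun i : Fin m =>
      if (i : ℕ) = 0 then D2 (fun y => z y * supportFn K y) x else D2 (supportFn K) x) /
      LinearMap.det (D2 (supportFn K) x) := rfl
  rw [h3, h1, hh.isC2.det_D2, hbmOp]
  have := (hh.detHess_pos x).ne'
  push_cast
  rw [add_sub_cancel_right]
  field_simp

/-- The density of the cone-volume measure. -/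
def coneDensity (K : ConvexBody (E n)) (x : Sph n) : ℝ :=
  (1 / (n : ℝ)) * (supportFn K x * detHess (supportFn K) x)

theorem MemKPlusTwo.coneMeasure_eq (hK : MemKPlusTwo K) : coneMeasure K =
    (sphMeasure n).withDensity fun x => ENNReal.ofReal (coneDensity K x) := by
  rw [coneMeasure]
  congr 1
  ext x
  rw [hK.isPosC2.isC2.det_D2, coneDensity, mul_assoc]

theorem MemKPlusTwo.continuous_coneDensity (hK : MemKPlusTwo K) : Continuous (coneDensity K) :=
  (hK.isPosC2.isC2.continuous.mul (continuous_detHess hK.isPosC2.isC2)).const_mul _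

theorem MemKPlusTwo.coneDensity_pos (hn : n ≠ 0) (hK : MemKPlusTwo K) (x : Sph n) :
    0 < coneDensity K x := by
  have := hK.isPosC2.pos x
  have := hK.isPosC2.detHess_pos x
  have : (0 : ℝ) < n := by exact_mod_cast Nat.pos_of_ne_zero hn
  rw [coneDensity]
  positivity

theorem MemKPlusTwo.isFiniteMeasure (hK : MemKPlusTwo K) : IsFiniteMeasure (coneMeasure K) := by
  rw [hK.coneMeasure_eq]
  exact isFiniteMeasure_withDensity_ofReal (integrable_sph hK.continuous_coneDensity).2

theorem MemKPlusTwo.integral_coneMeasure {F : Type*} [NormedAddCommGroup F] [NormedSpace ℝ F]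
    (hn : n ≠ 0) (hK : MemKPlusTwo K) (g : Sph n → F) :
    ∫ x, g x ∂(coneMeasure K) = ∫ x, coneDensity K x • g x ∂(sphMeasure n) := by
  rw [hK.coneMeasure_eq, integral_withDensity_eq_integral_toReal_smul
    hK.continuous_coneDensity.measurable.ennreal_ofReal (ae_of_all _ fun _ => ENNReal.ofReal_lt_top)]
  refine integral_congr_ae (ae_of_all _ fun x => ?_)
  dsimp only
  rw [ENNReal.toReal_ofReal (hK.coneDensity_pos hn x).le]

theorem MemKPlusTwo.absolutelyContinuous (hn : n ≠ 0) (hK : MemKPlusTwo K) :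
    sphMeasure n ≪ coneMeasure K := by
  rw [hK.coneMeasure_eq]
  refine withDensity_absolutelyContinuous' hK.continuous_coneDensity.measurable.ennreal_ofReal.aemeasurable
    (ae_of_all _ fun x => ?_)
  exact (ENNReal.ofReal_pos.2 (hK.coneDensity_pos hn x)).ne'

theorem coneMeasure_absolutelyContinuous (K : ConvexBody (E n)) :
    coneMeasure K ≪ sphMeasure n := withDensity_absolutelyContinuous _ _

theorem MemKPlusTwo.exists_sphMeasure_le (hn : n ≠ 0) (hK : MemKPlusTwo K) :
    ∃ C : ℝ≥0∞, C ≠ ∞ ∧ sphMeasure n ≤ C • coneMeasure K := by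
  obtain ⟨d, hd, hle⟩ := exists_pos_le_of_continuous hn hK.continuous_coneDensity
    (hK.coneDensity_pos hn)
  refine ⟨ENNReal.ofReal d⁻¹, ENNReal.ofReal_ne_top, ?_⟩
  rw [hK.coneMeasure_eq, ← withDensity_smul _ hK.continuous_coneDensity.measurable.ennreal_ofReal]
  conv_lhs => rw [← withDensity_one (μ := sphMeasure n)]
  refine withDensity_mono (ae_of_all _ fun x => ?_)
  rw [Pi.one_apply, Pi.smul_apply, smul_eq_mul, ← ENNReal.ofReal_mul (by positivity),
    ← ENNReal.ofReal_one]
  refine ENNReal.ofReal_le_ofReal ?_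
  rw [le_inv_mul_iff₀ hd, mul_one]
  exact hle x

theorem MemKPlusTwo.inner_eq (hn : n ≠ 0) (hK : MemKPlusTwo K) {u v : L2 K}
    (hu : u =ᵐ[coneMeasure K] z) (hv : v =ᵐ[coneMeasure K] w) : ⟪u, v⟫ = (1 / (n : ℝ)) *
      ∫ x, supportFn K x * detHess (supportFn K) x * (w x * z x) ∂(sphMeasure n) := by
  have h1 : ⟪u, v⟫ = ∫ x, w x * z x ∂(coneMeasure K) := by
    rw [L2.inner_def]
    refine integral_congr_ae ?_
    filter_upwards [hu, hv] with x h1 h2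
    rw [h1, h2]
    rfl
  rw [h1, hK.integral_coneMeasure hn, ← integral_const_mul]
  refine integral_congr_ae (ae_of_all _ fun x => ?_)
  simp only [coneDensity, smul_eq_mul]
  ring

theorem MemKPlusTwo.exists_L2 (hK : MemKPlusTwo K) (hz : Continuous z) :
    ∃ u : L2 K, u =ᵐ[coneMeasure K] z := by
  have := hK.isFiniteMeasure
  have h1 := ContinuousMap.memLp (p := 2) (coneMeasure K) ℝ ⟨z, hz⟩
  exact ⟨h1.toLp z, h1.coeFn_toLp⟩

/-- Convergence in `L²(V_K)` implies convergence in `L¹`. -/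
theorem MemKPlusTwo.tendsto_lintegral (hn : n ≠ 0) (hK : MemKPlusTwo K) {uk : ℕ → L2 K} {u : L2 K}
    (hu : Tendsto uk atTop (𝓝 u)) {zk : ℕ → Sph n → ℝ}
    (hz : ∀ k, uk k =ᵐ[coneMeasure K] zk k) :
    Tendsto (fun k => ∫⁻ x, ‖zk k x - u x‖ₑ ∂(sphMeasure n)) atTop (𝓝 0) := by
  have := hK.isFiniteMeasure
  obtain ⟨C, hC, hle⟩ := hK.exists_sphMeasure_le hn
  set M := coneMeasure K Set.univ ^ (1 / (1 : ℝ≥0∞).toReal - 1 / (2 : ℝ≥0∞).toReal) with hM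
  have hMtop : M ≠ ∞ := ENNReal.rpow_ne_top_of_nonneg (by norm_num) (measure_ne_top _ _)
  have h1 : ∀ k, ∫⁻ x, ‖zk k x - u x‖ₑ ∂(sphMeasure n) ≤ C * (edist (uk k) u * M) := by
    intro k
    calc ∫⁻ x, ‖zk k x - u x‖ₑ ∂(sphMeasure n)
        ≤ ∫⁻ x, ‖zk k x - u x‖ₑ ∂(C • coneMeasure K) := lintegral_mono' hle le_rfl
      _ = C * ∫⁻ x, ‖zk k x - u x‖ₑ ∂(coneMeasure K) := by
          rw [lintegral_smul_measure, smul_eq_mul]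
      _ = C * eLpNorm (uk k - u : Sph n → ℝ) 1 (coneMeasure K) := by
          rw [eLpNorm_one_eq_lintegral_enorm]
          congr 1
          refine lintegral_congr_ae ?_
          filter_upwards [hz k] with x hx
          rw [Pi.sub_apply, hx]
      _ ≤ _ := by
          gcongr
          rw [Lp.edist_def]
          exact eLpNorm_le_eLpNorm_mul_rpow_measure_univ (by norm_num)
            ((Lp.aestronglyMeasurable _).sub (Lp.aestronglyMeasurable _))
  have h2 := ENNReal.Tendsto.const_mul (a := C) (ENNReal.Tendsto.mul_const (b := M)
    (tendsto_iff_edist_tendsto_0.1 hu) (Or.inr hMtop)) (Or.inr hC)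
  rw [zero_mul, mul_zero] at h2
  exact tendsto_of_tendsto_of_tendsto_of_le_of_le tendsto_const_nhds h2 (fun _ => zero_le) h1

theorem MemKPlusTwo.integrable_L2 (hn : n ≠ 0) (hK : MemKPlusTwo K) (u : L2 K) :
    Integrable u (sphMeasure n) := by
  have := hK.isFiniteMeasure
  obtain ⟨C, hC, hle⟩ := hK.exists_sphMeasure_le hn
  exact Integrable.of_measure_le_smul hC hle ((Lp.memLp u).integrable (by norm_num))

/-- The spanning set of the graph is a subspace. -/
theorem mem_negHBMGraph (hn : 2 ≤ n) (hK : MemKPlusTwo K) {p : L2 K × L2 K} :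
    p ∈ negHBMGraph K ↔ ∃ z : Sph n → ℝ, IsC2 z ∧ p.1 =ᵐ[coneMeasure K] z ∧
      p.2 =ᵐ[coneMeasure K] hbmOp (supportFn K) z := by
  have hh := hK.isPosC2
  constructor
  · intro hp
    induction hp using Submodule.span_induction with
    | mem p hp =>
      obtain ⟨z, hz, h1, h2⟩ := hp
      exact ⟨z, hz, h1, by rwa [← negHBM_eq hn hK hz]⟩
    | zero =>
      refine ⟨fun _ => 0, isC2_const 0, Lp.coeFn_zero _ _ _, ?_⟩
      rw [hh.hbmOp_const hn]
      exact Lp.coeFn_zero _ _ _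
    | add p q _ _ hp hq =>
      obtain ⟨z, hz, h1, h2⟩ := hp
      obtain ⟨w, hw, h3, h4⟩ := hq
      refine ⟨_, hz.add hw, ?_, ?_⟩
      · filter_upwards [Lp.coeFn_add p.1 q.1, h1, h3] with x e1 e2 e3
        rw [Prod.fst_add, e1, Pi.add_apply, e2, e3]
      · rw [hh.hbmOp_add hz hw]
        filter_upwards [Lp.coeFn_add p.2 q.2, h2, h4] with x e1 e2 e3
        rw [Prod.snd_add, e1, Pi.add_apply, e2, e3]
    | smul c p _ hp =>
      obtain ⟨z, hz, h1, h2⟩ := hp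
      refine ⟨_, hz.const_mul c, ?_, ?_⟩
      · filter_upwards [Lp.coeFn_smul c p.1, h1] with x e1 e2
        rw [Prod.smul_fst, e1, Pi.smul_apply, e2, smul_eq_mul]
      · rw [hh.hbmOp_const_mul c hz]
        filter_upwards [Lp.coeFn_smul c p.2, h2] with x e1 e2
        rw [Prod.smul_snd, e1, Pi.smul_apply, e2, smul_eq_mul]
  · rintro ⟨z, hz, h1, h2⟩
    exact Submodule.subset_span ⟨z, hz, h1, by rwa [negHBM_eq hn hK hz]⟩

/-- The cone-volume measure charges every open set, so a continuous representative of zero is zero.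
Hence the subspace is the graph of an operator. -/
theorem negHBMGraph_functional (hn : 2 ≤ n) (hK : MemKPlusTwo K) :
    ∀ p ∈ negHBMGraph K, p.1 = 0 → p.2 = 0 := by
  have hn0 : n ≠ 0 := by omega
  intro p hp h0
  obtain ⟨z, hz, h1, h2⟩ := (mem_negHBMGraph hn hK).1 hp
  have h3 : z =ᵐ[coneMeasure K] fun _ => 0 := by
    rw [h0] at h1
    exact h1.symm.trans (Lp.coeFn_zero _ _ _)
  have h4 : z = fun _ => 0 := (Continuous.ae_eq_iff_eq (sphMeasure n) hz.continuous
    continuous_const).1 (hK.absolutelyContinuous hn0 h3)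
  rw [h4, hK.isPosC2.hbmOp_const hn] at h2
  exact Lp.ext (h2.trans (Lp.coeFn_zero _ _ _).symm)

/-- Identities and inequalities known for `C²` functions pass to the closed operator along such
sequences. -/
theorem negHBMOp_exists_seq (hn : 2 ≤ n) (hK : MemKPlusTwo K) (u : (negHBMOp K).domain) :
    ∃ (zk : ℕ → Sph n → ℝ) (uk wk : ℕ → L2 K), (∀ k, IsC2 (zk k)) ∧
      (∀ k, uk k =ᵐ[coneMeasure K] zk k) ∧
      (∀ k, wk k =ᵐ[coneMeasure K] hbmOp (supportFn K) (zk k)) ∧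
      Tendsto uk atTop (𝓝 (u : L2 K)) ∧ Tendsto wk atTop (𝓝 (negHBMOp K u)) := by
  have hgraph := Submodule.toLinearPMap_graph_eq _ (negHBMGraph_functional hn hK)
  have hmem : ((u : L2 K), negHBMOp K u) ∈ closure (negHBMGraph K : Set (L2 K × L2 K)) := by
    have h1 := LinearPMap.mem_graph _ u
    by_cases hc : (negHBMGraph K).toLinearPMap.IsClosable
    · have h2 := hc.graph_closure_eq_closure_graph
      rw [hgraph] at h2
      rw [← Submodule.topologicalClosure_coe, h2]
      exact h1
    -- By convention the closure of a non-closable operator is the operator itself, whose graph lies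
    -- in the closure as well.
    · have h2 : negHBMOp K = (negHBMGraph K).toLinearPMap := LinearPMap.closure_def' hc
      refine subset_closure ?_
      rw [SetLike.mem_coe, ← hgraph]
      have h3 : (negHBMOp K).graph = (negHBMGraph K).toLinearPMap.graph := by rw [h2]
      rw [← h3]
      exact h1
  obtain ⟨p, hp, hlim⟩ := mem_closure_iff_seq_limit.1 hmem
  choose z hz h1 h2 using fun k => (mem_negHBMGraph hn hK).1 (hp k)
  exact ⟨z, fun k => (p k).1, fun k => (p k).2, hz, h1, h2,
    (continuous_fst.tendsto _).comp hlim, (continuous_snd.tendsto _).comp hlim⟩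

theorem negHBMOp_exists_mem (hn : 2 ≤ n) (hK : MemKPlusTwo K) (hz : IsC2 z) :
    ∃ u : (negHBMOp K).domain, (u : L2 K) =ᵐ[coneMeasure K] z ∧
      negHBMOp K u =ᵐ[coneMeasure K] hbmOp (supportFn K) z := by
  obtain ⟨u, hu⟩ := hK.exists_L2 hz.continuous
  obtain ⟨w, hw⟩ := hK.exists_L2 (hK.isPosC2.continuous_hbmOp hz)
  have h1 : (u, w) ∈ (negHBMOp K).graph := by
    refine LinearPMap.le_graph_of_le (LinearPMap.le_closure _) ?_
    rw [Submodule.toLinearPMap_graph_eq _ (negHBMGraph_functional hn hK)]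
    exact (mem_negHBMGraph hn hK).2 ⟨z, hz, hu, hw⟩
  obtain ⟨y, hy1, hy2⟩ := (LinearPMap.mem_graph_iff _).1 h1
  exact ⟨y, by rwa [hy1], by rwa [hy2]⟩

end ConeMeasure

end ConvexStability

end

open MeasureTheory Topology
open scoped Pointwise Gradient RealInnerProductSpace

noncomputable section

namespace ConvexStability

open Filter

/-! ### The spectral gap of `-L_K`. -/

section Gap

variable {n : ℕ} {K : ConvexBody (E n)} {z w : Sph n → ℝ}

theorem negHBMOp_symm (hn : 2 ≤ n) (hK : MemKPlusTwo K) (u v : (negHBMOp K).domain) :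
    ⟪negHBMOp K u, (v : L2 K)⟫ = ⟪(u : L2 K), negHBMOp K v⟫ := by
  have hn0 : n ≠ 0 := by omega
  obtain ⟨z, uk, wk, hz, h1, h2, h3, h4⟩ := negHBMOp_exists_seq hn hK u
  obtain ⟨z', vk, wk', hz', h1', h2', h3', h4'⟩ := negHBMOp_exists_seq hn hK v
  refine tendsto_nhds_unique (h4.inner h3') ((h3.inner h4').congr fun k => ?_)
  rw [hK.inner_eq hn0 (h1 k) (h2' k), hK.inner_eq hn0 (h2 k) (h1' k),
    hK.isPosC2.integral_mul_hbmOp_comm hn (hz k) (hz' k)]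
  simp_rw [mul_comm (z k _)]

theorem negHBMOp_nonneg (hn : 2 ≤ n) (hK : MemKPlusTwo K) (u : (negHBMOp K).domain) :
    0 ≤ ⟪negHBMOp K u, (u : L2 K)⟫ := by
  have hn0 : n ≠ 0 := by omega
  obtain ⟨z, uk, wk, hz, h1, h2, h3, h4⟩ := negHBMOp_exists_seq hn hK u
  refine ge_of_tendsto' (h4.inner h3) fun k => ?_
  rw [hK.inner_eq hn0 (h2 k) (h1 k)]
  exact mul_nonneg (by positivity) (hK.isPosC2.integral_mul_hbmOp_self_nonneg hn (hz k))

/-- The left side of the Bochner formula is nonnegative by Cauchy-Schwarz for traces; dividing by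
`(n-1)(n-2)` requires `n ≥ 3`. -/
theorem IsPosC2.integral_mul_hbmOp_le {h : Sph n → ℝ} (hn : 3 ≤ n) (hh : IsPosC2 h)
    (hz : IsC2 z) : ∫ x, h x * detHess h x * (z x * hbmOp h z x) ∂(sphMeasure n) ≤
      ∫ x, h x * detHess h x * (hbmOp h z x * hbmOp h z x) ∂(sphMeasure n) := by
  have hn' : (3 : ℝ) ≤ n := by exact_mod_cast hn
  have h1 := hh.integral_bochner (by omega) hz
  have c1 := hh.isC2.continuous
  have c2 := continuous_detHess hh.isC2
  have c3 := hh.continuous_hbmOp hz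
  have c4 := hz.continuous
  have h2 : 0 ≤ ∫ x, h x * detHess h x * (relTraceSq h (fun y => z y * h y) x -
      relTrace h (fun y => z y * h y) x ^ 2 / (n - 1)) ∂(sphMeasure n) :=
    integral_nonneg fun x => mul_nonneg (mul_pos (hh.pos x) (hh.detHess_pos x)).le
      (sub_nonneg.2 (hh.relTrace_sq_le (hz.mul hh.isC2) (by omega) x))
  rw [h1] at h2
  have h3 : (0 : ℝ) < (n - 1) * (n - 2) := mul_pos (by linarith) (by linarith)
  have h4 := nonneg_of_mul_nonneg_right h2 h3
  simp_rw [mul_sub] at h4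
  rw [integral_sub (integrable_sph (by fun_prop)) (integrable_sph (by fun_prop))] at h4
  linarith

theorem negHBMOp_inner_le (hn : 3 ≤ n) (hK : MemKPlusTwo K) (u : (negHBMOp K).domain) :
    ⟪negHBMOp K u, (u : L2 K)⟫ ≤ ‖negHBMOp K u‖ ^ 2 := by
  have hn0 : n ≠ 0 := by omega
  obtain ⟨z, uk, wk, hz, h1, h2, h3, h4⟩ := negHBMOp_exists_seq (by omega) hK u
  rw [← real_inner_self_eq_norm_sq]
  refine le_of_tendsto_of_tendsto' (h4.inner h3) (h4.inner h4) fun k => ?_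
  rw [hK.inner_eq hn0 (h2 k) (h1 k), hK.inner_eq hn0 (h2 k) (h2 k)]
  exact mul_le_mul_of_nonneg_left (hK.isPosC2.integral_mul_hbmOp_le hn (hz k)) (by positivity)

/-- The eigenspace of the eigenvalue `0`. -/
theorem negHBMOp_ker (hn : 2 ≤ n) (hK : MemKPlusTwo K) (u : (negHBMOp K).domain)
    (hu : negHBMOp K u = 0) : ∃ a : ℝ, (u : L2 K) =ᵐ[coneMeasure K] fun _ => a := by
  have hn0 : n ≠ 0 := by omega
  have hn1 : (n : ℝ) ≠ 0 := by exact_mod_cast hn0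
  obtain ⟨z, uk, wk, hz, h1, h2, h3, h4⟩ := negHBMOp_exists_seq hn hK u
  have h5 := (h4.inner h3).const_mul (n : ℝ)
  rw [hu, inner_zero_left, mul_zero] at h5
  obtain ⟨a, ha⟩ := hK.isPosC2.exists_const_of_tendsto hn (hK.integrable_L2 hn0 (u : L2 K)) hz
    (hK.tendsto_lintegral hn0 h3 h1) (h5.congr fun k => by
      rw [hK.inner_eq hn0 (h2 k) (h1 k)]
      field_simp)
  exact ⟨a, coneMeasure_absolutelyContinuous K ha⟩

/-- The eigenspace of the eigenvalue `1`. -/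
theorem negHBMOp_eigenspace_one (hn : 2 ≤ n) (hK : MemKPlusTwo K) (u : (negHBMOp K).domain)
    (hu : negHBMOp K u = u) : ∃ v : E n,
      (u : L2 K) =ᵐ[coneMeasure K] fun x => ⟪(x : E n), v⟫ / supportFn K x := by
  have hn0 : n ≠ 0 := by omega
  have hn1 : (n : ℝ) ≠ 0 := by exact_mod_cast hn0
  obtain ⟨z, uk, wk, hz, h1, h2, h3, h4⟩ := negHBMOp_exists_seq hn hK u
  have hh := hK.isPosC2
  have c1 := hh.isC2.continuous
  have c2 := continuous_detHess hh.isC2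
  have c3 := fun k => hh.continuous_hbmOp (hz k)
  have c4 := fun k => (hz k).continuous
  -- For an eigenfunction of the value 1 both `‖Au‖² - ⟨Au,u⟩` and `‖Au - u‖²` vanish, so the
  -- corresponding integrals of the approximants tend to zero.
  have h5 := ((h4.inner h4).sub (h4.inner h3)).const_mul (n : ℝ)
  rw [hu, sub_self, mul_zero] at h5
  have h6 := ((h4.sub h3).inner (h4.sub h3)).const_mul (n : ℝ)
  rw [hu, sub_self, inner_zero_left, mul_zero] at h6
  obtain ⟨v, hv⟩ := hh.exists_inner_of_tendsto hn (hK.integrable_L2 hn0 (u : L2 K)) hz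
    (hK.tendsto_lintegral hn0 h3 h1) (h5.congr fun k => by
      rw [hK.inner_eq hn0 (h2 k) (h2 k), hK.inner_eq hn0 (h2 k) (h1 k), ← mul_sub,
        ← integral_sub (integrable_sph (by have := c3 k; fun_prop))
          (integrable_sph (by have := c3 k; have := c4 k; fun_prop)), ← mul_assoc,
        mul_one_div_cancel hn1, one_mul]
      simp_rw [mul_sub]) (h6.congr fun k => by
      have e1 : ((wk k - uk k : L2 K) : Sph n → ℝ) =ᵐ[coneMeasure K] fun x =>
          hbmOp (supportFn K) (z k) x - z k x := by
        filter_upwards [Lp.coeFn_sub (wk k) (uk k), h1 k, h2 k] with x e1 e2 e3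
        rw [e1, Pi.sub_apply, e2, e3]
      rw [hK.inner_eq hn0 e1 e1, ← mul_assoc, mul_one_div_cancel hn1, one_mul]
      simp_rw [sq])
  exact ⟨v, coneMeasure_absolutelyContinuous K hv⟩

/-- The variational inequality for the eigenvalue `λ₂`. -/
theorem eigenvalueHBM_two_mul_le (hn : 2 ≤ n) (hK : MemKPlusTwo K) (hz : IsC2 z)
    (h0 : ∫ x, supportFn K x * detHess (supportFn K) x * z x ∂(sphMeasure n) = 0)
    (h1 : ∀ v : E n, ∫ x : Sph n, detHess (supportFn K) x * (z x * ⟪(x : E n), v⟫)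
      ∂(sphMeasure n) = 0) :
    eigenvalueHBM K 2 * ∫ x, supportFn K x * detHess (supportFn K) x * z x ^ 2 ∂(sphMeasure n) ≤
      ∫ x, supportFn K x * detHess (supportFn K) x * (z x * hbmOp (supportFn K) z x)
        ∂(sphMeasure n) := by
  have hn0 : n ≠ 0 := by omega
  have hn1 : (0 : ℝ) < n := by exact_mod_cast Nat.pos_of_ne_zero hn0
  have hh := hK.isPosC2
  set h := supportFn K with hdef
  set β := ∫ x, h x * detHess h x ∂(sphMeasure n) with hβ
  have hβ0 : 0 < β := hh.integral_mul_detHess_pos hn0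
  -- The total mass of `V_K` is `β / n`, so the constant function `c` is a unit vector.
  set c := √(n / β) with hc
  have hc0 : 0 < c := Real.sqrt_pos.2 (by positivity)
  have hc2 : c * c = n / β := Real.mul_self_sqrt (by positivity)
  obtain ⟨e, he1, he2⟩ := negHBMOp_exists_mem hn hK (isC2_const c)
  obtain ⟨u, hu1, hu2⟩ := negHBMOp_exists_mem hn hK hz
  rw [← hdef, hh.hbmOp_const hn] at he2
  have hAe : negHBMOp K e = 0 := Lp.ext (he2.trans (Lp.coeFn_zero _ _ _).symm)
  have hinn : ∀ {w : Sph n → ℝ} {v : L2 K}, v =ᵐ[coneMeasure K] w →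
      ⟪(e : L2 K), v⟫ = c / n * ∫ x, h x * detHess h x * w x ∂(sphMeasure n) := by
    intro w v hv
    rw [hK.inner_eq hn0 he1 hv]
    simp_rw [← mul_assoc]
    rw [integral_mul_const]
    ring
  have hnorm : ‖(e : L2 K)‖ = 1 := by
    have h2 : ⟪(e : L2 K), (e : L2 K)⟫ = 1 := by
      rw [hinn he1, integral_mul_const, ← hβ]
      have : c / n * (β * c) = c * c * β / n := by ring
      rw [this, hc2]
      field_simp
    rw [real_inner_self_eq_norm_sq] at h2
    exact (pow_eq_one_iff_of_nonneg (norm_nonneg _) two_ne_zero).1 h2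
  have hmain := increasingList_two_mul_le (A := negHBMOp K) (negHBMOp_symm hn hK)
    (negHBMOp_nonneg hn hK) hnorm hAe
    (fun v hv => by
      obtain ⟨a, ha⟩ := negHBMOp_ker hn hK v hv
      refine ⟨a / c, Lp.ext ?_⟩
      filter_upwards [ha, he1, Lp.coeFn_smul (a / c) (e : L2 K)] with x e1 e2 e3
      rw [e1, e3, Pi.smul_apply, e2, smul_eq_mul, div_mul_cancel₀ _ hc0.ne'])
    (by
      -- The function `⟨x, x₀⟩ / h` is an eigenfunction for the value 1, nonzero because it is
      -- positive at `x₀`.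
      obtain ⟨x₀⟩ := nonempty_sph hn0
      obtain ⟨v, hv1, hv2⟩ := negHBMOp_exists_mem hn hK
        ((isC2_inner (x₀ : E n)).div hh.isC2 hh.pos)
      rw [← hdef, hh.hbmOp_inner_div] at hv2
      refine ⟨v, fun h2 => ?_, Lp.ext (hv2.trans hv1.symm)⟩
      rw [h2] at hv1
      have h3 := (Continuous.ae_eq_iff_eq (sphMeasure n) continuous_const
        ((isC2_inner (x₀ : E n)).div hh.isC2 hh.pos).continuous).1
        (hK.absolutelyContinuous hn0 ((Lp.coeFn_zero _ _ _).symm.trans hv1))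
      have h4 := congrFun h3 x₀
      simp only [inner_sph_self] at h4
      exact (one_div_pos.2 (hh.pos x₀)).ne h4)
    (by
      -- For `n ≥ 3` the bound comes from the Bochner formula, for `n = 2` from Minkowski's
      -- inequality in the plane.
      rcases hn.lt_or_eq with h2 | h2
      · exact Or.inl (negHBMOp_inner_le h2 hK)
      · subst h2
        right
        intro v
        obtain ⟨z, uk, wk, hz, h1, h2, h3, h4⟩ := negHBMOp_exists_seq hn hK v
        rw [← real_inner_self_eq_norm_sq]
        refine le_of_tendsto_of_tendsto' ((h3.inner h3).sub
          ((tendsto_const_nhds.inner h3).pow 2)) (h4.inner h3) fun k => ?_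
        rw [hinn (h1 k), hK.inner_eq hn0 (h1 k) (h1 k), hK.inner_eq hn0 (h2 k) (h1 k)]
        have h5 := hh.integral_mul_hbmOp_ge (hz k)
        rw [mul_pow, div_pow, sq c, hc2]
        rw [← hβ] at h5
        simp_rw [sq (z k _)] at h5
        have h6 := mul_le_mul_of_nonneg_left h5 (by positivity : (0 : ℝ) ≤ 1 / ((2 : ℕ) : ℝ))
        refine le_of_eq_of_le ?_ h6
        simp_rw [← hdef]
        push_cast
        field_simp)
    (z := u) (by rw [hinn hu1, h0, mul_zero])
    (fun v hv => by
      obtain ⟨a, ha⟩ := negHBMOp_eigenspace_one hn hK v hv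
      rw [hK.inner_eq hn0 hu1 ha]
      have : ∀ x, h x * detHess h x * (⟪(x : E n), a⟫ / h x * z x) =
          detHess h x * (z x * ⟪(x : E n), a⟫) := fun x => by
        have := (hh.pos x).ne'
        field_simp
      simp_rw [← hdef, this]
      rw [h1, mul_zero])
  rw [← real_inner_self_eq_norm_sq, hK.inner_eq hn0 hu1 hu1, hK.inner_eq hn0 hu2 hu1,
    mul_left_comm] at hmain
  have h2 := le_of_mul_le_mul_left hmain (by positivity)
  simp_rw [sq (z _)]
  exact h2

end Gap

end ConvexStability

end

open MeasureTheory Topology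
open scoped Pointwise Gradient RealInnerProductSpace

noncomputable section

namespace ConvexStability

/-! ### Mixed volumes as integrals of relative traces. -/

section MixedVolumes

variable {n : ℕ} {h g : Sph n → ℝ}

theorem IsPosC2.hbmOp_div (hh : IsPosC2 h) (g : Sph n → ℝ) (x : Sph n) :
    hbmOp h (fun y => g y / h y) x = g x / h x - relTrace h g x / (n - 1) := by
  have : (fun y => g y / h y * h y) = g := funext fun y => div_mul_cancel₀ _ (hh.pos y).ne'
  rw [hbmOp, this]

/-- Symmetry of the operator, tested against the constant 1, which it annihilates. -/
theorem IsPosC2.integral_relTrace (hn : 2 ≤ n) (hh : IsPosC2 h) (hg : IsC2 g) :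
    ∫ x, h x * (detHess h x * relTrace h g x / (n - 1)) ∂(sphMeasure n) =
      ∫ x, g x * detHess h x ∂(sphMeasure n) := by
  have hy := hg.div hh.isC2 hh.pos
  have h1 := hh.integral_mul_hbmOp_comm hn hy (isC2_const 1)
  rw [hh.hbmOp_const hn] at h1
  have c1 := hh.isC2.continuous
  have c2 := continuous_detHess hh.isC2
  have c3 := hh.continuous_relTrace hg
  have c4 := hg.continuous
  have h2 : ∀ x, h x * detHess h x * (1 * hbmOp h (fun y => g y / h y) x) =
      g x * detHess h x - h x * (detHess h x * relTrace h g x / (n - 1)) := fun x => by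
    have := (hh.pos x).ne'
    rw [hh.hbmOp_div]
    field_simp
  simp_rw [h2, mul_zero, integral_zero] at h1
  rw [integral_sub (integrable_sph (by fun_prop)) (integrable_sph (by fun_prop))] at h1
  linarith

theorem IsPosC2.integral_detHess_mul_inner (hn : 2 ≤ n) (hh : IsPosC2 h) (v : E n) :
    ∫ x : Sph n, ⟪(x : E n), v⟫ * detHess h x ∂(sphMeasure n) = 0 := by
  rw [← hh.integral_relTrace hn (isC2_inner v)]
  simp [relTrace_inner]

variable {K L : ConvexBody (E n)}

theorem MemKPlusTwo.vol_eq (hn : 2 ≤ n) (hK : MemKPlusTwo K) : vol K = (1 / (n : ℝ)) *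
    ∫ x, supportFn K x * detHess (supportFn K) x ∂(sphMeasure n) := by
  obtain ⟨m, rfl⟩ : ∃ m, n = m + 1 := ⟨n - 1, by omega⟩
  have h1 : vol K = (1 / ((m + 1 : ℕ) : ℝ)) * ∫ x, supportFn K x *
      mixedDiscTangent x (fun _ : Fin m => D2 (supportFn K) x) ∂(sphMeasure (m + 1)) := rfl
  rw [h1]
  simp_rw [hK.isPosC2.mixedDiscTangent_const]

/-- The argument with index 0 is the scalar factor, so Hessian slot `i` carries the argument `i +
1`; this is the shift in the description of `s`. -/
theorem mixedVol_succ {m : ℕ} (K L : ConvexBody (E (m + 1))) (j : ℕ) {s : Finset (Fin m)}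
    (hs : ∀ i : Fin m, i ∈ s ↔ ¬ (i : ℕ) + 1 < m + 1 - j) :
    mixedVol K L j = (1 / ((m + 1 : ℕ) : ℝ)) *
      ∫ x, (if 0 < m + 1 - j then supportFn K else supportFn L) x * mixedDiscTangent x
        (fun i : Fin m => if i ∈ s then D2 (supportFn L) x else D2 (supportFn K) x)
        ∂(sphMeasure (m + 1)) := by
  have h1 : mixedVol K L j = (1 / ((m + 1 : ℕ) : ℝ)) *
      ∫ x, (if 0 < m + 1 - j then supportFn K else supportFn L) x * mixedDiscTangent x
        (fun i : Fin m => D2 (if (i : ℕ) + 1 < m + 1 - j then supportFn K else supportFn L) x)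
        ∂(sphMeasure (m + 1)) := rfl
  rw [h1]
  congr 3
  ext1 x
  congr 2
  ext1 i
  by_cases hi : (i : ℕ) + 1 < m + 1 - j
  · rw [if_pos hi, if_neg (by rw [hs]; exact not_not.2 hi)]
  · rw [if_neg hi, if_pos ((hs i).2 hi)]

theorem MemKPlusTwo.mixedVol_one (hn : 2 ≤ n) (hK : MemKPlusTwo K) (hL : MemKPlusTwo L) :
    mixedVol K L 1 = (1 / (n : ℝ)) *
      ∫ x, supportFn L x * detHess (supportFn K) x ∂(sphMeasure n) := by
  rw [← hK.isPosC2.integral_relTrace hn hL.isPosC2.isC2]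
  obtain ⟨m, rfl⟩ : ∃ m, n = m + 1 := ⟨n - 1, by omega⟩
  have hm : m ≠ 0 := by omega
  rw [mixedVol_succ K L 1 (s := {⟨m - 1, by omega⟩}) fun i => by
    rw [Finset.mem_singleton, Fin.ext_iff]; dsimp only; omega]
  simp_rw [hK.isPosC2.mixedDiscTangent_one hL.isPosC2.isC2 _ (Finset.card_singleton _) hm]
  rw [if_pos (by omega)]
  push_cast
  rw [add_sub_cancel_right]

/-- For `n ≥ 3` both copies of `L` sit in Hessian slots, and the second-order integral identity
moves one of them outside. For `n = 2` the scalar factor is already `h_L`. -/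
theorem MemKPlusTwo.mixedVol_two (hn : 2 ≤ n) (hK : MemKPlusTwo K) (hL : MemKPlusTwo L) :
    mixedVol K L 2 = (1 / (n : ℝ)) * ∫ x, supportFn L x *
      (detHess (supportFn K) x * relTrace (supportFn K) (supportFn L) x / (n - 1))
        ∂(sphMeasure n) := by
  have hh := hK.isPosC2
  have hg := hL.isPosC2.isC2
  have h2 := hh.integral_relTrace_sq_sub (by omega) hg
  obtain ⟨m, rfl⟩ : ∃ m, n = m + 1 := ⟨n - 1, by omega⟩
  have hm : m ≠ 0 := by omega
  rcases Nat.lt_or_ge 1 m with h1 | h1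
  · have hcard : ({⟨m - 2, by omega⟩, ⟨m - 1, by omega⟩} : Finset (Fin m)).card = 2 :=
      Finset.card_pair (by rw [Ne, Fin.ext_iff]; dsimp only; omega)
    rw [mixedVol_succ K L 2 (s := {⟨m - 2, by omega⟩, ⟨m - 1, by omega⟩}) fun i => by
      rw [Finset.mem_insert, Finset.mem_singleton, Fin.ext_iff, Fin.ext_iff]; dsimp only; omega,
      if_pos (by omega)]
    congr 1
    have hm1 : (0 : ℝ) < (m : ℝ) - 1 := by
      have : (1 : ℝ) < m := by exact_mod_cast h1
      linarith
    have hm0 : (0 : ℝ) < m := by linarith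
    have h3 : ∀ x, mixedDiscTangent x (fun i : Fin m =>
        if i ∈ ({⟨m - 2, by omega⟩, ⟨m - 1, by omega⟩} : Finset (Fin m)) then
          D2 (supportFn L) x else D2 (supportFn K) x) = (m * ((m : ℝ) - 1))⁻¹ *
        (detHess (supportFn K) x * (relTrace (supportFn K) (supportFn L) x ^ 2 -
          relTraceSq (supportFn K) (supportFn L) x)) := by
      intro x
      have h4 := hh.choose_mul_mixedDiscTangent hg x {⟨m - 2, by omega⟩, ⟨m - 1, by omega⟩}
      rw [hcard, coeff_two_detPoly, Nat.cast_choose_two] at h4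
      rw [relTrace, relTraceSq, ContinuousLinearMap.toLinearMap_mul, eq_inv_mul_iff_mul_eq₀
        (by positivity)]
      linarith
    simp_rw [h3]
    have h4 : ∀ x, supportFn K x * ((m * ((m : ℝ) - 1))⁻¹ * (detHess (supportFn K) x *
        (relTrace (supportFn K) (supportFn L) x ^ 2 -
          relTraceSq (supportFn K) (supportFn L) x))) = (m * ((m : ℝ) - 1))⁻¹ *
        (supportFn K x * detHess (supportFn K) x *
        (relTrace (supportFn K) (supportFn L) x ^ 2 -
          relTraceSq (supportFn K) (supportFn L) x)) := fun x => by ring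
    simp_rw [h4]
    rw [integral_const_mul, h2, ← integral_const_mul, ← integral_const_mul]
    congr 1
    ext x
    push_cast
    have e1 : (m : ℝ) + 1 - 1 = m := by ring
    have e2 : (m : ℝ) + 1 - 2 = m - 1 := by ring
    rw [e1, e2]
    field_simp
  · obtain rfl : m = 1 := by omega
    rw [mixedVol_succ K L 2 (s := {0}) fun i => by
      rw [Finset.mem_singleton]; exact ⟨fun _ => by omega, fun _ => Subsingleton.elim _ _⟩,
      if_neg (by omega)]
    simp_rw [hh.mixedDiscTangent_one hg _ (Finset.card_singleton _) hm]
    push_cast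
    rw [show (2 : ℝ) - 1 = 1 by norm_num]

end MixedVolumes

/-! ### The homothetic transform and its translation vector. -/

section Transform

variable {n : ℕ} {K L : ConvexBody (E n)} {v : E n}

theorem supportFn_eq_inner {x : Sph n} {q : E n} (hq : q ∈ K)
    (hmax : ∀ p ∈ K, ⟪(x : E n), p⟫ ≤ ⟪(x : E n), q⟫) : supportFn K x = ⟪(x : E n), q⟫ := by
  rw [← homExt_coe (supportFn K) x, homExt_supportFn K (sph_ne_zero x) hq hmax]

theorem supportFn_smul_add_pointBody (K : ConvexBody (E n)) {c : ℝ} (hc : 0 ≤ c) (v : E n)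
    (x : Sph n) : supportFn (c • K + pointBody v) x = c * supportFn K x + ⟪(x : E n), v⟫ := by
  obtain ⟨q, hq, hmax⟩ := K.isCompact.exists_isMaxOn K.nonempty
    (f := fun p => ⟪(x : E n), p⟫) (by fun_prop)
  have hmem : ∀ p : E n, p ∈ c • K + pointBody v ↔ ∃ k ∈ K, c • k + v = p := by
    intro p
    rw [← SetLike.mem_coe, ConvexBody.coe_add, ConvexBody.coe_smul]
    have : ((pointBody v : ConvexBody (E n)) : Set (E n)) = {v} := rfl
    rw [this, Set.add_singleton, ← Set.image_smul, Set.image_image]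
    rfl
  rw [supportFn_eq_inner hq hmax, supportFn_eq_inner (q := c • q + v) ((hmem _).2 ⟨q, hq, rfl⟩)]
  · rw [inner_add_right, real_inner_smul_right]
  · intro p hp
    obtain ⟨k, hk, rfl⟩ := (hmem p).1 hp
    rw [inner_add_right, inner_add_right, real_inner_smul_right, real_inner_smul_right]
    have := mul_le_mul_of_nonneg_left (hmax hk) hc
    dsimp only at this
    linarith

theorem MemKPlusTwo.integral_surfaceAreaMeasure (hK : MemKPlusTwo K) (f : Sph n → ℝ) :
    ∫ x, f x ∂(surfaceAreaMeasure 2 K) =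
      ∫ x, (supportFn K x)⁻¹ * detHess (supportFn K) x * f x ∂(sphMeasure n) := by
  have hh := hK.isPosC2
  have h1 : surfaceAreaMeasure 2 K = (sphMeasure n).withDensity fun x =>
      ENNReal.ofReal ((supportFn K x)⁻¹ * detHess (supportFn K) x) := by
    rw [surfaceAreaMeasure]
    congr 1
    ext x
    rw [hh.isC2.det_D2]
    norm_num [Real.rpow_neg_one]
  have hc : Continuous fun x => (supportFn K x)⁻¹ * detHess (supportFn K) x :=
    (hh.isC2.continuous.inv₀ fun x => (hh.pos x).ne').mul (continuous_detHess hh.isC2)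
  rw [h1, integral_withDensity_eq_integral_toReal_smul hc.measurable.ennreal_ofReal
    (ae_of_all _ fun _ => ENNReal.ofReal_lt_top)]
  refine integral_congr_ae (ae_of_all _ fun x => ?_)
  dsimp only
  rw [ENNReal.toReal_ofReal (mul_pos (inv_pos.2 (hh.pos x)) (hh.detHess_pos x)).le, smul_eq_mul]

/-- The density in the equation of the translation vector. -/
def transformWeight (K : ConvexBody (E n)) (x : Sph n) : ℝ :=
  coneDensity K x / supportFn K x ^ 2

theorem MemKPlusTwo.continuous_transformWeight (hK : MemKPlusTwo K) :
    Continuous (transformWeight K) :=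
  hK.continuous_coneDensity.div (hK.isPosC2.isC2.continuous.pow 2) fun x =>
    (pow_pos (hK.isPosC2.pos x) 2).ne'

theorem MemKPlusTwo.transformWeight_pos (hn : n ≠ 0) (hK : MemKPlusTwo K) (x : Sph n) :
    0 < transformWeight K x :=
  div_pos (hK.coneDensity_pos hn x) (pow_pos (hK.isPosC2.pos x) 2)

theorem integrable_sph_smul {w : Sph n → ℝ} (hw : Continuous w) :
    Integrable (fun x : Sph n => w x • (x : E n)) (sphMeasure n) :=
  (hw.smul continuous_subtype_val).integrable_of_hasCompactSupport
    (HasCompactSupport.of_compactSpace _)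

theorem isTransformVector_iff (hn : n ≠ 0) (hK : MemKPlusTwo K) (hL : MemKPlusTwo L) :
    IsTransformVector K L v ↔ ∫ x : Sph n, (transformWeight K x *
      (supportFn L x - ⟪(x : E n), v⟫)) • (x : E n) ∂(sphMeasure n) = 0 := by
  rw [IsTransformVector, hK.integral_coneMeasure hn]
  have : ∀ x : Sph n, coneDensity K x • (⟪(x : E n), inverseGaussMap L x - v⟫ /
      supportFn K x ^ 2) • (x : E n) =
      (transformWeight K x * (supportFn L x - ⟪(x : E n), v⟫)) • (x : E n) := fun x => by
    rw [smul_smul, inner_sub_right, inverseGaussMap, hL.isPosC2.isC2.inner_gradient_sph,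
      transformWeight]
    congr 1
    ring
  simp_rw [this]

/-- The matrix of the linear system for the translation vector. -/
def transformMap (hK : MemKPlusTwo K) : E n →ₗ[ℝ] E n where
  toFun v := ∫ x : Sph n, (transformWeight K x * ⟪(x : E n), v⟫) • (x : E n) ∂(sphMeasure n)
  map_add' u v := by
    have c := hK.continuous_transformWeight
    rw [← integral_add (integrable_sph_smul (by fun_prop)) (integrable_sph_smul (by fun_prop))]
    simp_rw [inner_add_right, mul_add, add_smul]
  map_smul' t v := by
    rw [RingHom.id_apply, ← integral_smul]
    simp_rw [real_inner_smul_right, smul_smul, mul_left_comm]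

/-- The map is positive definite: `⟨v, T v⟩` is the integral of a positive weight times `⟨x,v⟩²`,
whose continuous integrand is positive at `v / ‖v‖`. -/
theorem transformMap_bijective (hn : n ≠ 0) (hK : MemKPlusTwo K) :
    Function.Bijective (transformMap hK) := by
  have c := hK.continuous_transformWeight
  have hinj : Function.Injective (transformMap hK) := by
    rw [injective_iff_map_eq_zero]
    intro v hv
    by_contra hv0
    obtain ⟨x₀, hx₀⟩ := exists_smul_sph hv0
    have h1 : ∫ x : Sph n, transformWeight K x * ⟪(x : E n), v⟫ ^ 2 ∂(sphMeasure n) = 0 := by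
      have h2 := congrArg (fun u => ⟪v, u⟫) hv
      simp only [inner_zero_right] at h2
      have h3 : transformMap hK v = ∫ x : Sph n, (transformWeight K x * ⟪(x : E n), v⟫) •
        (x : E n) ∂(sphMeasure n) := rfl
      rw [h3, ← integral_inner (integrable_sph_smul (by fun_prop))] at h2
      rw [← h2]
      congr 1
      ext x
      rw [real_inner_smul_right, real_inner_comm (x : E n) v]
      ring
    have cI : Continuous fun x : Sph n => transformWeight K x * ⟪(x : E n), v⟫ ^ 2 := by fun_prop
    rw [integral_eq_zero_iff_of_nonneg (fun x => mul_nonneg (hK.transformWeight_pos hn x).le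
      (sq_nonneg _)) (integrable_sph cI)] at h1
    have h4 := congrFun ((Continuous.ae_eq_iff_eq (sphMeasure n) cI continuous_const).1 h1) x₀
    have h5 : ⟪(x₀ : E n), v⟫ = ‖v‖ := by
      conv_lhs => rw [hx₀]
      rw [real_inner_smul_right, inner_sph_self, mul_one]
    rw [h5] at h4
    have := hK.transformWeight_pos hn x₀
    have := norm_pos_iff.2 hv0
    exact (by positivity : 0 < transformWeight K x₀ * ‖v‖ ^ 2).ne' h4
  exact ⟨hinj, LinearMap.injective_iff_surjective.1 hinj⟩

theorem existsUnique_isTransformVector (hn : n ≠ 0) (hK : MemKPlusTwo K) (hL : MemKPlusTwo L) :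
    ∃! v, IsTransformVector K L v := by
  have c := hK.continuous_transformWeight
  have cL := hL.isPosC2.isC2.continuous
  have h1 : ∀ v, IsTransformVector K L v ↔ transformMap hK v =
      ∫ x : Sph n, (transformWeight K x * supportFn L x) • (x : E n) ∂(sphMeasure n) := by
    intro v
    rw [isTransformVector_iff hn hK hL]
    simp_rw [mul_sub, sub_smul]
    rw [integral_sub (integrable_sph_smul (by fun_prop)) (integrable_sph_smul (by fun_prop)),
      sub_eq_zero, eq_comm]
    rfl
  simp_rw [h1]
  exact (transformMap_bijective hn hK).existsUnique _

/-- In `L²(V_K)` the equation for `v` says that `(h_L - ⟨x,v⟩) / h_K` is orthogonal to the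
eigenfunctions `⟨x,w⟩ / h_K`. -/
theorem IsTransformVector.integral_eq_zero (hn : n ≠ 0) (hK : MemKPlusTwo K) (hL : MemKPlusTwo L)
    (hv : IsTransformVector K L v) (w : E n) :
    ∫ x : Sph n, detHess (supportFn K) x * ((supportFn L x - ⟪(x : E n), v⟫) / supportFn K x *
      ⟪(x : E n), w⟫) ∂(sphMeasure n) = 0 := by
  have c := hK.continuous_transformWeight
  have cL := hL.isPosC2.isC2.continuous
  have hn1 : (n : ℝ) ≠ 0 := by exact_mod_cast hn
  have h1 := congrArg (fun u => (n : ℝ) * ⟪w, u⟫) ((isTransformVector_iff hn hK hL).1 hv)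
  simp only [inner_zero_right, mul_zero] at h1
  rw [← integral_inner (integrable_sph_smul (by fun_prop)), ← integral_const_mul] at h1
  rw [← h1]
  congr 1
  ext x
  have := (hK.isPosC2.pos x).ne'
  rw [real_inner_smul_right, real_inner_comm (x : E n) w, transformWeight, coneDensity]
  field_simp

end Transform

end ConvexStability

end

open MeasureTheory Topology
open scoped Pointwise Gradient RealInnerProductSpace

noncomputable section

namespace ConvexStability

/-! ### The deficit as a quadratic form, and the stability inequality. -/

section Deficit

variable {n : ℕ} {h g : Sph n → ℝ}

/-- The deficit in Minkowski's inequality as a quadratic form. -/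
theorem IsPosC2.integral_deficit (hn : 2 ≤ n) (hh : IsPosC2 h) (hg : IsC2 g) (c : ℝ) (v : E n)
    {z : Sph n → ℝ} (hz : z = fun x => (g x - (c * h x + ⟪(x : E n), v⟫)) / h x)
    (h0 : ∫ x, h x * detHess h x * z x ∂(sphMeasure n) = 0) :
    c ^ 2 * (∫ x, h x * detHess h x ∂(sphMeasure n)) -
      ∫ x, g x * (detHess h x * relTrace h g x / (n - 1)) ∂(sphMeasure n) =
      (∫ x, h x * detHess h x * (z x * hbmOp h z x) ∂(sphMeasure n)) -
        ∫ x, h x * detHess h x * z x ^ 2 ∂(sphMeasure n) := by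
  have hy := hg.div hh.isC2 hh.pos
  have hl := (isC2_inner v).div hh.isC2 hh.pos
  have hcl : IsC2 fun x : Sph n => c + ⟪(x : E n), v⟫ / h x := (isC2_const c).add hl
  have hz' : z = fun x => g x / h x + (-1) * (c + ⟪(x : E n), v⟫ / h x) := by
    rw [hz]
    ext x
    have := (hh.pos x).ne'
    field_simp
    ring
  have hz2 : IsC2 z := by
    rw [hz']
    exact hy.add (hcl.const_mul (-1))
  have hyz : (fun x => g x / h x) = fun x => z x + (c + ⟪(x : E n), v⟫ / h x) := by
    rw [hz']
    ext x
    ring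
  have hAy : ∀ x, hbmOp h (fun y => g y / h y) x = hbmOp h z x + ⟪(x : E n), v⟫ / h x := by
    intro x
    rw [hyz, hh.hbmOp_add hz2 hcl, hh.hbmOp_add (isC2_const c) hl, hh.hbmOp_const hn,
      hh.hbmOp_inner_div]
    ring
  have c1 := hh.isC2.continuous
  have c2 := continuous_detHess hh.isC2
  have c3 := hh.continuous_hbmOp hz2
  have c4 := hz2.continuous
  have c5 := hl.continuous
  have s1 := hh.integral_mul_hbmOp_comm hn hz2 (isC2_const c)
  rw [hh.hbmOp_const hn] at s1
  -- Since `⟨x,v⟩ / h` is fixed by the operator, symmetry cancels its cross terms with `z`; only the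
  -- cross term with the constant `c` requires the mean of `z` to vanish.
  have s2 := hh.integral_mul_hbmOp_comm hn hz2 hl
  rw [hh.hbmOp_inner_div] at s2
  have s3 := hh.integral_detHess_mul_inner hn v
  have e1 : ∀ x, g x * (detHess h x * relTrace h g x / (n - 1)) =
      h x * detHess h x * z x ^ 2 - h x * detHess h x * (z x * hbmOp h z x) +
      (2 * c * (h x * detHess h x * z x) + c ^ 2 * (h x * detHess h x) +
      (h x * detHess h x * (z x * (⟪(x : E n), v⟫ / h x)) -
        h x * detHess h x * (⟪(x : E n), v⟫ / h x * hbmOp h z x) +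
      (c * (⟪(x : E n), v⟫ * detHess h x) - h x * detHess h x * (c * hbmOp h z x)))) := by
    intro x
    have hx := (hh.pos x).ne'
    have e2 : relTrace h g x / (n - 1) = g x / h x - hbmOp h (fun y => g y / h y) x := by
      rw [hh.hbmOp_div]; ring
    have e3 : g x = h x * (z x + (c + ⟪(x : E n), v⟫ / h x)) := by
      rw [← congrFun hyz x]
      field_simp
    have e4 : ⟪(x : E n), v⟫ = h x * (⟪(x : E n), v⟫ / h x) := by field_simp
    rw [mul_div_assoc, e2, hAy, congrFun hyz x, e3]
    generalize ⟪(x : E n), v⟫ / h x = l at *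
    rw [e4]
    ring
  simp_rw [e1]
  have i0 : Integrable (fun x : Sph n => c * (⟪(x : E n), v⟫ * detHess h x)) (sphMeasure n) :=
    integrable_sph (by fun_prop)
  rw [integral_add (integrable_sph (by fun_prop)) (integrable_sph (by fun_prop)),
    integral_add (integrable_sph (by fun_prop)) (integrable_sph (by fun_prop)),
    integral_add (integrable_sph (by fun_prop)) (integrable_sph (by fun_prop)),
    integral_add (integrable_sph (by fun_prop)) (integrable_sph (by fun_prop)),
    integral_sub (integrable_sph (by fun_prop)) (integrable_sph (by fun_prop)),
    integral_sub (integrable_sph (by fun_prop)) (integrable_sph (by fun_prop)),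
    integral_sub i0 (integrable_sph (by fun_prop)), integral_const_mul, integral_const_mul,
    integral_const_mul, h0, s3, s1, s2]
  simp only [mul_zero, integral_zero]
  ring

end Deficit

/-- The stability form of Minkowski's second inequality. -/
theorem IsTransformVector.mixedVol_one_sq_div_sub_ge {n : ℕ} {K L : ConvexBody (E n)} {v : E n}
    (hv : IsTransformVector K L v) (hn : 2 ≤ n) (hK : MemKPlusTwo K) (hL : MemKPlusTwo L) :
    mixedVol K L 1 ^ 2 / vol K - mixedVol K L 2 ≥ (1 / (n : ℝ)) * (eigenvalueHBM K 2 - 1) *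
      delta2 (surfaceAreaMeasure 2 K) L (homotheticTransform K L v) ^ 2 := by
  have hn0 : n ≠ 0 := by omega
  have hn1 : (0 : ℝ) < n := by exact_mod_cast Nat.pos_of_ne_zero hn0
  have hh := hK.isPosC2
  have hg := hL.isPosC2
  have c1 := hh.isC2.continuous
  have c2 := continuous_detHess hh.isC2
  have c3 := hg.isC2.continuous
  set h := supportFn K with hdef
  set g := supportFn L with gdef
  set β := ∫ x, h x * detHess h x ∂(sphMeasure n) with hβ
  set α := ∫ x, g x * detHess h x ∂(sphMeasure n) with hα
  have hβ0 : 0 < β := hh.integral_mul_detHess_pos hn0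
  have hα0 : 0 < α := integral_pos_of_continuous hn0 (c3.mul c2) fun x =>
    mul_pos (hg.pos x) (hh.detHess_pos x)
  have hvol : vol K = 1 / n * β := hK.vol_eq hn
  have hmix : mixedVol K L 1 = 1 / n * α := hK.mixedVol_one hn hL
  set c := mixedVol K L 1 / vol K with hc
  have hcβ : c * β = α := by
    rw [hc, hvol, hmix]
    field_simp
  have hc0 : 0 ≤ c := by
    rw [hc, hvol, hmix]
    positivity
  set z : Sph n → ℝ := fun x => (g x - (c * h x + ⟪(x : E n), v⟫)) / h x with hz
  have hz2 : IsC2 z :=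
    (hg.isC2.sub ((hh.isC2.const_mul c).add (isC2_inner v))).div hh.isC2 hh.pos
  have hlin := hh.integral_detHess_mul_inner hn
  -- The ratio `c` is the one that gives `z` mean zero for `V_K`; the linear part integrates to zero
  -- anyway.
  have h0 : ∫ x, h x * detHess h x * z x ∂(sphMeasure n) = 0 := by
    have e1 : ∀ x, h x * detHess h x * z x = g x * detHess h x - c * (h x * detHess h x) -
        ⟪(x : E n), v⟫ * detHess h x := fun x => by
      have := (hh.pos x).ne'
      rw [hz]
      field_simp
      ring
    simp_rw [e1]
    rw [integral_sub (integrable_sph (by fun_prop)) (integrable_sph (by fun_prop)),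
      integral_sub (integrable_sph (by fun_prop)) (integrable_sph (by fun_prop)),
      integral_const_mul, hlin, ← hα, ← hβ, hcβ]
    ring
  -- Here the equation for `v` enters; the summand with `c` is harmless because linear functions
  -- integrate to zero against `det D²h`.
  have h1 : ∀ w : E n, ∫ x : Sph n, detHess h x * (z x * ⟪(x : E n), w⟫) ∂(sphMeasure n) = 0 := by
    intro w
    have e1 : ∀ x : Sph n, detHess h x * (z x * ⟪(x : E n), w⟫) =
        detHess h x * ((g x - ⟪(x : E n), v⟫) / h x * ⟪(x : E n), w⟫) -
          c * (⟪(x : E n), w⟫ * detHess h x) := fun x => by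
      have := (hh.pos x).ne'
      rw [hz]
      field_simp
      ring
    simp_rw [e1]
    have i1 : Continuous fun x : Sph n =>
        detHess h x * ((g x - ⟪(x : E n), v⟫) / h x * ⟪(x : E n), w⟫) :=
      c2.mul (((c3.sub (by fun_prop)).div c1 fun x => (hh.pos x).ne').mul (by fun_prop))
    rw [integral_sub (integrable_sph i1) (integrable_sph (by fun_prop)), integral_const_mul, hlin,
      hv.integral_eq_zero hn0 hK hL w, mul_zero, sub_zero]
  have hgap := eigenvalueHBM_two_mul_le hn hK hz2 h0 h1
  have hdef2 := hh.integral_deficit hn hg.isC2 c v hz h0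
  -- The difference of the support functions is `h z`, and the density of `S_2 K` is `h⁻¹ det D²h`,
  -- which leaves the weight `h det D²h`.
  have hdelta : delta2 (surfaceAreaMeasure 2 K) L (homotheticTransform K L v) ^ 2 =
      ∫ x, h x * detHess h x * z x ^ 2 ∂(sphMeasure n) := by
    rw [delta2, Real.sq_sqrt (integral_nonneg fun x => sq_nonneg _),
      hK.integral_surfaceAreaMeasure]
    congr 1
    ext x
    have := (hh.pos x).ne'
    rw [homotheticTransform, ← hc, supportFn_smul_add_pointBody K hc0, ← hdef, ← gdef, hz]
    field_simp
  have hlhs : mixedVol K L 1 ^ 2 / vol K = 1 / n * (c ^ 2 * β) := by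
    rw [hvol, hmix, ← hcβ]
    field_simp
  rw [hdelta, hlhs, hK.mixedVol_two hn hL, ← hdef, ← gdef, ← mul_sub, hdef2, mul_assoc]
  refine mul_le_mul_of_nonneg_left ?_ (by positivity)
  rw [sub_mul, one_mul]
  exact sub_le_sub_right hgap _

end ConvexStability

end

theorem mainTheorem5 (n : ℕ) (hn : 2 ≤ n)
    (K L : ConvexBody (EuclideanSpace ℝ (Fin n)))
    (hK : ConvexStability.MemKPlusTwo K) (hL : ConvexStability.MemKPlusTwo L) :
    (∃! v : EuclideanSpace ℝ (Fin n), ConvexStability.IsTransformVector K L v) ∧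
    ∀ v : EuclideanSpace ℝ (Fin n), ConvexStability.IsTransformVector K L v →
      ConvexStability.mixedVol K L 1 ^ 2 / ConvexStability.vol K - ConvexStability.mixedVol K L 2 ≥
        (1 / (n : ℝ)) * (ConvexStability.eigenvalueHBM K 2 - 1) *
          ConvexStability.delta2 (ConvexStability.surfaceAreaMeasure 2 K) L
            (ConvexStability.homotheticTransform K L v) ^ 2 :=
  ⟨ConvexStability.existsUnique_isTransformVector (by omega) hK hL, fun _ hv =>
    hv.mixedVol_one_sq_div_sub_ge hn hK hL⟩
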